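/- **Model.** For each sample size $n$ let $p=p_n$ satisfy $p\ge n^{C}$ for all large $n$, for some constant $C>0$, let $\mathbf X\in\mathbb R^{n\times p}$ be a non-random design with rows $x_i^\top$, and let $Y_1,\dots,Y_n$ be independent, $Y_i$ having density $\exp\{y\,x_i^\top\theta_0-b(x_i^\top\theta_0)+k(y)\}$ with respect to a fixed measure $\mu$ on $\mathbb R$. Here $y\mapsto\exp\{y\eta-b(\eta)+k(y)\}$ is a probability density for every $\eta\in\mathbb R$, $b$ is strictly convex and three times differentiable, and for some $C_{\rm dev}\ge1$, $b''(x+y)\le C_{\rm dev}b''(x)$ whenever $x\in\mathbb R$, $|y|\le 1/2$. Let $S_\theta=\{j:\theta_j\ne0\}$, $S_0=S_{\theta_0}$, $s_0=|S_0|\ge1$. Write $\mathbb P_0,\mathbb E$ for the true law of $\mathbf Y$ and its expectation, $L_{n,\theta}$ for the log-likelihood. For $S\subset[p]$ and $\theta_S\in\mathbb R^{S}$, let $L_{n,\theta_S}$ be the log-likelihood of the model with the columns $\mathbf X_S$ only, $\mathbf F_{n,\theta_S}=\mathbf X_S^\top\mathrm{diag}\{b''(x_{i,S}^\top\theta_S)\}\mathbf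 X_S$, $\hat\theta_S$ a maximizer of $L_{n,\theta_S}$ (the vector $0$, by convention, if there is none), $\theta_S^*$ a maximizer of $\mathbb E L_{n,\theta_S}$ (understood up to terms free of $\theta_S$), $\mathbf W_0=\mathrm{diag}\{b''(x_i^\top\theta_0)\}$, $\mathbf F_{n,\theta_0}=\mathbf X^\top\mathbf W_0\mathbf X$ and $\zeta_{n,S}=\max_i\|\mathbf F_{n,\theta_S^*}^{-1/2}x_{i,S}\|_2$. For real $s\ge1$ put $$\phi_1^2(s)=\inf_{0<|S_\theta|\le s}\frac{|S_\theta|\,\theta^\top\mathbf F_{n,\theta_0}\theta}{n\|\theta\|_1^2},\qquad \phi_2^2(s)=\inf_{0<|S_\theta|\le s}\frac{\theta^\top\mathbf F_{n,\theta_0}\theta}{n\|\theta\|_2^2},\qquad \phi_1,\phi_2\ge0.$$ **Prior and posterior.** Let $s_0\le s_{\max}\le\mathrm{rank}(\mathbf X)$, let $w_n$ be a probability mass function on $\{0,\dots,s_{\max}\}$ with $A_1p^{-A_3}w_n(s-1)\le w_n(s)\le A_2p^{-A_4}w_n(s-1)$ for $1\le s\le s_{\max}$, with constants $A_1,\dots,A_4>0$,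 and let $\lambda=\lambda_n$. The empirical prior $\Pi_n$ draws $|S|$ from $w_n$, then $S$ uniformly among the sets of that size, then $\theta_S\sim\mathcal N(\hat\theta_S,\{\lambda\mathbf F_{n,\hat\theta_S}\}^{-1})$, and sets $\theta_{S^c}=0$. The fractional posterior is $\Pi_\alpha^n(A)=\int_Ae^{\alpha L_{n,\theta}}\Pi_n(d\theta)\big/\int e^{\alpha L_{n,\theta}}\Pi_n(d\theta)$. **Assumptions** (pointwise conditions are required for all large $n$). (A1) There are non-random $D_n>\sqrt2$ and $\bar\theta_S\in\mathbb R^{S}$ with $\mathbf F_{n,\bar\theta_S}$ nonsingular for all $|S|\le s_{\max}$, such that with $\mathbb P_0$-probability at least $1-p^{-1}$, for all $|S|\le s_{\max}$ simultaneously: $L_{n,\theta_S}$ has a maximizer, $D_n^{-1}\mathbf F_{n,\bar\theta_S}\preceq\mathbf F_{n,\hat\theta_S}\preceq D_n\mathbf F_{n,\bar\theta_S}$, and $\|\mathbf F_{n,\bar\theta_S}^{1/2}(\hat\theta_S-\bar\theta_S)\|_2^2\le D_n|S|\log p$. Moreover $\mathbf F_{n,\theta^*_{S_0}}$ is nonsingular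 and $\zeta_{n,S_0}^2s_0\log p=o(1)$. (A2) $\log\big(\max_ib''(x_i^\top\theta_0)\vee\|\mathbf X_{S_0}\|_\infty\vee\lambda_{\min}^{-1}(\mathbf F_{n,\theta^*_{S_0}})\vee\lambda_{\max}(\mathbf F_{n,\theta^*_{S_0}})\big)=O(\log p)$, where $\|\cdot\|_\infty$ is the largest absolute row sum; $s_0\log p=o(n)$; there are constants $A_5,A_6>0$, $A_7\ge0$ with $p^{-A_5}\le\lambda\le A_6p^{-A_7}$ and $A_6p^{-A_7}<A_4$; $\log_pD_n=o(1)$; and $\alpha\in(0,1)$ is fixed. (A3) for a constant $K$: $\phi_2((K+1)s_0)>0$ and $\|\mathbf X\|_{\max}^2s_0^2\log p\,/\,\phi_2^2((K+1)s_0)=o(n)$, where $\|\mathbf X\|_{\max}$ is the largest absolute entry. Call $K>1$ a *dimension constant* if, for all sufficiently large $n$, $\mathbb E\,\Pi_\alpha^n\{\theta:|S_\theta|>Ks_0\}\le(s_0\log p)^{-1}+2p^{-1}+p^{-s_0}$. **Theorem.** Suppose that (A1) and (A2) hold. Then a dimension constant exists. Moreover, for every dimension constant $K_{\rm dim}$ for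 which (A3) holds with $K=K_{\rm dim}$, there is a constant $K_{\rm theta}>0$ such that, with $\tilde s_n=(K_{\rm dim}+1)s_0$, for all sufficiently large $n$ each of $$\mathbb E\,\Pi_\alpha^n\Big(\|\theta-\theta_0\|_1>\tfrac{K_{\rm theta}s_0}{\phi_1(\tilde s_n)}\sqrt{\tfrac{\log p}{n}}\Big),\quad \mathbb E\,\Pi_\alpha^n\Big(\|\theta-\theta_0\|_2>\tfrac{K_{\rm theta}}{\phi_2(\tilde s_n)}\sqrt{\tfrac{s_0\log p}{n}}\Big),\quad \mathbb E\,\Pi_\alpha^n\Big(\|\mathbf F_{n,\theta_0}^{1/2}(\theta-\theta_0)\|_2^2>K_{\rm theta}s_0\log p\Big)$$ is at most $2(s_0\log p)^{-1}+4p^{-1}+2p^{-s_0}$. -/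

import Mathlib

open MeasureTheory Filter Topology

open scoped Matrix

noncomputable section

namespace SparseGLM

/-! ### Exponential-family response model -/

/-- A one-parameter canonical exponential family on `ℝ`, with densities
`y ↦ exp (y η - b η + k y)` with respect to `μ`, for every `η : ℝ`. -/
structure Family where
  /-- dominating measure (for instance Lebesgue or counting measure on the response space) -/
  μ : Measure ℝ
  b : ℝ → ℝ
  k : ℝ → ℝ
  measurable_k : Measurable k
  normalized : ∀ η : ℝ, ∫⁻ y, ENNReal.ofReal (Real.exp (y * η - b η + k y)) ∂μ = 1
  strictConvex : StrictConvexOn ℝ Set.univ b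
  /-- `b` is three times differentiable -/
  differentiable : ∀ m : ℕ, m ≤ 2 → Differentiable ℝ (iteratedDeriv m b)
  /-- local stability of `b''` -/
  stable : ∃ Cdev : ℝ, 1 ≤ Cdev ∧ ∀ x y : ℝ, |y| ≤ 1 / 2 →
    iteratedDeriv 2 b (x + y) ≤ Cdev * iteratedDeriv 2 b x

/-- The law of a response with canonical parameter `η`. -/
def Family.law (G : Family) (η : ℝ) : Measure ℝ :=
  G.μ.withDensity fun y => ENNReal.ofReal (Real.exp (y * η - G.b η + G.k y))

/-! The following notions are stated for a design matrix whose columns are indexed by an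
arbitrary finite type, so that they apply to the full design and to every sub-model. -/

section Design

variable {n : ℕ} {ι : Type*} [Fintype ι]

/-- Joint law of `Y = (Y_1, …, Y_n)` with independent coordinates, under coefficient `θ`. -/
def Family.jointLaw (G : Family) (X : Matrix (Fin n) ι ℝ) (θ : ι → ℝ) : Measure (Fin n → ℝ) :=
  Measure.pi fun i => G.law ((X *ᵥ θ) i)

/-- Log-likelihood `L_{n,θ}`. -/
def Family.logLik (G : Family) (X : Matrix (Fin n) ι ℝ) (y : Fin n → ℝ) (θ : ι → ℝ) : ℝ :=
  ∑ i, (y i * (X *ᵥ θ) i - G.b ((X *ᵥ θ) i) + G.k (y i))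

/-- The diagonal weight matrix `W_θ = diag (b'' (x_iᵀ θ))`. -/
def Family.weight (G : Family) (X : Matrix (Fin n) ι ℝ) (θ : ι → ℝ) :
    Matrix (Fin n) (Fin n) ℝ :=
  Matrix.diagonal fun i => iteratedDeriv 2 G.b ((X *ᵥ θ) i)

/-- Fisher information `F_{n,θ} = Xᵀ W_θ X`. -/
def Family.fisher (G : Family) (X : Matrix (Fin n) ι ℝ) (θ : ι → ℝ) : Matrix ι ι ℝ :=
  Xᵀ * G.weight X θ * X

end Design

/-- `x` maximizes `f` over the whole space. -/
def IsArgmax {E : Type*} (f : E → ℝ) (x : E) : Prop := ∀ z, f z ≤ f x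

open Classical in
/-- A maximizer of `f`, if there is one; the value `0` is a convention otherwise. -/
def argmax {E : Type*} [Zero E] (f : E → ℝ) : E :=
  if h : ∃ x, IsArgmax f x then h.choose else 0

/-- The columns of `X` in `S`. -/
def cols {n p : ℕ} (X : Matrix (Fin n) (Fin p) ℝ) (S : Finset (Fin p)) :
    Matrix (Fin n) S ℝ :=
  X.submatrix id (fun j => (j : Fin p))

/-- `θ̃_S`: extension of a vector on `S` by zero. -/
def zeroExtend {p : ℕ} (S : Finset (Fin p)) (v : S → ℝ) : Fin p → ℝ :=
  fun j => if h : j ∈ S then v ⟨j, h⟩ else 0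

/-- `vᵀ A v`.  For positive semidefinite `A` this is `‖A^{1/2} v‖₂²`. -/
def quad {ι : Type*} [Fintype ι] (A : Matrix ι ι ℝ) (v : ι → ℝ) : ℝ := v ⬝ᵥ (A *ᵥ v)

def l1norm {ι : Type*} [Fintype ι] (v : ι → ℝ) : ℝ := ∑ j, |v j|

def l2norm {ι : Type*} [Fintype ι] (v : ι → ℝ) : ℝ := √(∑ j, v j ^ 2)

/-- `S_θ = {j : θ_j ≠ 0}`. -/
def supp {p : ℕ} (θ : Fin p → ℝ) : Finset (Fin p) := Finset.univ.filter fun j => θ j ≠ 0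

/-- Largest singular value of a square matrix. -/
def lamMax {ι : Type*} [Fintype ι] (A : Matrix ι ι ℝ) : ℝ :=
  sSup {r : ℝ | ∃ v : ι → ℝ, l2norm v = 1 ∧ r = l2norm (A *ᵥ v)}

/-- Smallest singular value of a square matrix. -/
def lamMin {ι : Type*} [Fintype ι] (A : Matrix ι ι ℝ) : ℝ :=
  sInf {r : ℝ | ∃ v : ι → ℝ, l2norm v = 1 ∧ r = l2norm (A *ᵥ v)}

/-- `‖A‖_max`, the largest absolute entry. -/
def maxNorm {n : ℕ} {ι : Type*} (A : Matrix (Fin n) ι ℝ) : ℝ := ⨆ i, ⨆ j, |A i j|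

/-- `‖A‖_∞`, the largest absolute row sum. -/
def rowSumNorm {n : ℕ} {ι : Type*} [Fintype ι] (A : Matrix (Fin n) ι ℝ) : ℝ :=
  ⨆ i, ∑ j, |A i j|

/-- Density at `v` of the normal law with mean `m` and covariance `Q⁻¹` (`Q` is the precision). -/
def gaussianDensity {ι : Type*} [Fintype ι] [DecidableEq ι] (m : ι → ℝ) (Q : Matrix ι ι ℝ)
    (v : ι → ℝ) : ℝ :=
  √Q.det / (√(2 * Real.pi)) ^ Fintype.card ι * Real.exp (-(quad Q (v - m)) / 2)

/-- Squared uniform compatibility number `φ₁²(s; W)`. -/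
def phi1sq {n p : ℕ} (X : Matrix (Fin n) (Fin p) ℝ) (W : Matrix (Fin n) (Fin n) ℝ) (s : ℝ) : ℝ :=
  sInf {r : ℝ | ∃ θ : Fin p → ℝ, 0 < (supp θ).card ∧ ((supp θ).card : ℝ) ≤ s ∧
    r = (supp θ).card * quad ((n : ℝ)⁻¹ • (Xᵀ * W * X)) θ / l1norm θ ^ 2}

/-- Squared sparse singular value `φ₂²(s; W)`. -/
def phi2sq {n p : ℕ} (X : Matrix (Fin n) (Fin p) ℝ) (W : Matrix (Fin n) (Fin n) ℝ) (s : ℝ) : ℝ :=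
  sInf {r : ℝ | ∃ θ : Fin p → ℝ, 0 < (supp θ).card ∧ ((supp θ).card : ℝ) ≤ s ∧
    r = quad ((n : ℝ)⁻¹ • (Xᵀ * W * X)) θ / l2norm θ ^ 2}

/-! ### One regression problem: design, truth and prior hyper-parameters -/

/-- The non-random data at sample size `n` with `p` covariates. -/
structure Problem (n p : ℕ) where
  /-- design matrix -/
  X : Matrix (Fin n) (Fin p) ℝ
  /-- true coefficient -/
  θ0 : Fin p → ℝ
  /-- largest model size charged by the prior -/
  smax : ℕ
  /-- prior mass function of the model size -/
  w : ℕ → ℝ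
  /-- precision factor of the Gaussian slab -/
  lam : ℝ

namespace Problem

variable {n p : ℕ}

/-- `S_0`. -/
def S0 (P : Problem n p) : Finset (Fin p) := supp P.θ0

/-- `s_0 = |S_0|`. -/
def s0 (P : Problem n p) : ℕ := P.S0.card

/-- The true law of the responses. -/
def truth (P : Problem n p) (G : Family) : Measure (Fin n → ℝ) := G.jointLaw P.X P.θ0

/-- `W_0`. -/
def W0 (P : Problem n p) (G : Family) : Matrix (Fin n) (Fin n) ℝ := G.weight P.X P.θ0

/-- Maximum likelihood estimator in the model `S`. -/
def mle (P : Problem n p) (G : Family) (S : Finset (Fin p)) (y : Fin n → ℝ) : S → ℝ :=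
  argmax (G.logLik (cols P.X S) y)

/-- `θ*_S`, the maximizer of the expected log-likelihood in the model `S`.  The log-likelihood is
taken relative to its value at zero: this does not change the maximizer, and removes the term
`k (Y_i)`, which need not be integrable. -/
def best (P : Problem n p) (G : Family) (S : Finset (Fin p)) : S → ℝ :=
  argmax fun θ : S → ℝ =>
    ∫ y, (G.logLik (cols P.X S) y θ - G.logLik (cols P.X S) y 0) ∂(P.truth G)

/-- `F_{n, θ*_S}`. -/
def fisherBest (P : Problem n p) (G : Family) (S : Finset (Fin p)) : Matrix S S ℝ :=
  G.fisher (cols P.X S) (P.best G S)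

/-- Design regularity `ζ_{n,S} = max_i ‖F_{n,θ*_S}^{-1/2} x_{i,S}‖₂`. -/
def zeta (P : Problem n p) (G : Family) (S : Finset (Fin p)) : ℝ :=
  ⨆ i, √(quad (P.fisherBest G S)⁻¹ (cols P.X S i))

/-- The Gaussian slab `g_S` on the model `S`, centred at the MLE, with precision
`λ F_{n, θ_S^MLE}`. -/
def slab (P : Problem n p) (G : Family) (S : Finset (Fin p)) (y : Fin n → ℝ) (v : S → ℝ) : ℝ :=
  gaussianDensity (P.mle G S y) (P.lam • G.fisher (cols P.X S) (P.mle G S y)) v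

/-- The empirical prior `Π_n` on `ℝ^p`. -/
def prior (P : Problem n p) (G : Family) (y : Fin n → ℝ) : Measure (Fin p → ℝ) :=
  ∑ S : Finset (Fin p), ENNReal.ofReal (P.w S.card / (p.choose S.card : ℝ)) •
    Measure.map (zeroExtend S)
      (volume.withDensity fun v : S → ℝ => ENNReal.ofReal (P.slab G S y v))

/-- Probability of `A` under the `α`-fractional posterior `Π_α^n`. -/
def posterior (P : Problem n p) (G : Family) (α : ℝ) (y : Fin n → ℝ) (A : Set (Fin p → ℝ)) :
    ENNReal :=
  (∫⁻ θ in A, ENNReal.ofReal (Real.exp (α * G.logLik P.X y θ)) ∂(P.prior G y)) /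
    ∫⁻ θ, ENNReal.ofReal (Real.exp (α * G.logLik P.X y θ)) ∂(P.prior G y)

/-- Expected posterior probability `𝔼 Π_α^n (A)` under the truth. -/
def expPosterior (P : Problem n p) (G : Family) (α : ℝ) (A : Set (Fin p → ℝ)) : ENNReal :=
  ∫⁻ y, P.posterior G α y A ∂(P.truth G)

/-- Standing requirements on the truth and on the prior for the model size. -/
structure Admissible (P : Problem n p) (A₁ A₂ A₃ A₄ : ℝ) : Prop where
  θ0_ne_zero : P.θ0 ≠ 0
  s0_le_smax : P.s0 ≤ P.smax
  smax_le_rank : P.smax ≤ P.X.rank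
  w_nonneg : ∀ s, 0 ≤ P.w s
  w_eq_zero : ∀ s, P.smax < s → P.w s = 0
  w_sum : ∑ s ∈ Finset.range (P.smax + 1), P.w s = 1
  w_lower : ∀ s, s + 1 ≤ P.smax → A₁ * (p : ℝ) ^ (-A₃) * P.w s ≤ P.w (s + 1)
  w_upper : ∀ s, s + 1 ≤ P.smax → P.w (s + 1) ≤ A₂ * (p : ℝ) ^ (-A₄) * P.w s

/-- The event that, in every model `S` with `|S| ≤ s_max`, the MLE exists, its Fisher information
is comparable to that at `θ̄_S` up to a factor `D`, and it is close to `θ̄_S`. -/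
def mleEvent (P : Problem n p) (G : Family) (D : ℝ) (θbar : ∀ S : Finset (Fin p), S → ℝ) :
    Set (Fin n → ℝ) :=
  {y | ∀ S : Finset (Fin p), S.card ≤ P.smax →
    (∃ v, IsArgmax (G.logLik (cols P.X S) y) v) ∧
    (G.fisher (cols P.X S) (P.mle G S y)
      - D⁻¹ • G.fisher (cols P.X S) (θbar S)).PosSemidef ∧
    (D • G.fisher (cols P.X S) (θbar S)
      - G.fisher (cols P.X S) (P.mle G S y)).PosSemidef ∧
    quad (G.fisher (cols P.X S) (θbar S)) (P.mle G S y - θbar S) ≤ D * S.card * Real.log p}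

end Problem

/-! ### The asymptotic assumptions -/

/-- Assumption (A1). -/
structure A1 (G : Family) (p : ℕ → ℕ) (P : ∀ n, Problem n (p n)) (D : ℕ → ℝ)
    (θbar : ∀ n, ∀ S : Finset (Fin (p n)), S → ℝ) : Prop where
  D_gt : ∀ᶠ n in atTop, √2 < D n
  nonsingular : ∀ᶠ n in atTop, ∀ S : Finset (Fin (p n)), S.card ≤ (P n).smax →
    (G.fisher (cols (P n).X S) (θbar n S)).det ≠ 0
  mle_close : ∀ᶠ n in atTop,
    1 - (p n : ℝ)⁻¹ ≤ ((P n).truth G).real ((P n).mleEvent G (D n) (θbar n))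
  nonsingular_S0 : ∀ᶠ n in atTop, ((P n).fisherBest G (P n).S0).det ≠ 0
  regular : Tendsto (fun n => (P n).zeta G (P n).S0 ^ 2 * (P n).s0 * Real.log (p n)) atTop (𝓝 0)

/-- Assumption (A2), with the constant `A₄` of the prior on the model size. -/
structure A2 (G : Family) (p : ℕ → ℕ) (P : ∀ n, Problem n (p n)) (D : ℕ → ℝ)
    (α A₄ A₅ A₆ A₇ : ℝ) : Prop where
  polynomial :
    (fun n => Real.log
      (max (⨆ i, iteratedDeriv 2 G.b (((P n).X *ᵥ (P n).θ0) i))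
        (max (rowSumNorm (cols (P n).X (P n).S0))
          (max (lamMin ((P n).fisherBest G (P n).S0))⁻¹
            (lamMax ((P n).fisherBest G (P n).S0))))))
      =O[atTop] fun n => Real.log (p n)
  sparse : (fun n => ((P n).s0 : ℝ) * Real.log (p n)) =o[atTop] fun n => (n : ℝ)
  A₅_pos : 0 < A₅
  A₆_pos : 0 < A₆
  A₇_nonneg : 0 ≤ A₇
  lam_bounds : ∀ᶠ n in atTop,
    (p n : ℝ) ^ (-A₅) ≤ (P n).lam ∧ (P n).lam ≤ A₆ * (p n : ℝ) ^ (-A₇)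
  α_pos : 0 < α
  α_lt_one : α < 1
  lt_A₄ : ∀ᶠ n in atTop, A₆ * (p n : ℝ) ^ (-A₇) < A₄
  logD : Tendsto (fun n => Real.logb (p n) (D n)) atTop (𝓝 0)

/-- Assumption (A3), with `s̃_n = (Kdim + 1) s_0`.  Positivity of `φ₂` is part of the assumption,
since it occurs in a denominator. -/
structure A3 (G : Family) (p : ℕ → ℕ) (P : ∀ n, Problem n (p n)) (Kdim : ℝ) : Prop where
  phi2_pos : ∀ᶠ n in atTop, 0 < phi2sq (P n).X ((P n).W0 G) ((Kdim + 1) * (P n).s0)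
  design : (fun n => maxNorm (P n).X ^ 2 * ((P n).s0 : ℝ) ^ 2 * Real.log (p n) /
      phi2sq (P n).X ((P n).W0 G) ((Kdim + 1) * (P n).s0)) =o[atTop] fun n => (n : ℝ)

/-- The constant `Kdim > 1` bounds the effective dimension of the posterior:
models of size larger than `Kdim * s_0` have small expected posterior mass for all large `n`. -/
def IsDimConstant (G : Family) (p : ℕ → ℕ) (P : ∀ n, Problem n (p n)) (α Kdim : ℝ) : Prop :=
  1 < Kdim ∧ ∀ᶠ n in atTop,
    (P n).expPosterior G α {θ | Kdim * (P n).s0 < ((supp θ).card : ℝ)} ≤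
      ENNReal.ofReal (((P n).s0 * Real.log (p n))⁻¹ + 2 * (p n : ℝ)⁻¹
        + (p n : ℝ) ^ (-((P n).s0 : ℝ)))

/-- `2 (s_0 log p)⁻¹ + 4 p⁻¹ + 2 p^{-s_0}`. -/
def failureBound (s p : ℕ) : ℝ :=
  2 * (s * Real.log p)⁻¹ + 4 * (p : ℝ)⁻¹ + 2 * (p : ℝ) ^ (-(s : ℝ))

end SparseGLM

end

/-!
The posterior mass of a set `A` of parameters is the ratio of its evidence `∫_A (L_θ / L_θ₀) ^ α dΠ`
to the total evidence.  Both are controlled on a good event, by elementary convexity arguments.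

*Total evidence.*  Only the true model `S₀` is kept.  There the likelihood ratio of a Gaussian
mixture around `θ₀` has expectation one, hence is at most `p ^ s₀` outside an event of probability
`p ^ (-s₀)`; if the maximum likelihood estimator were far from `θ₀` in Fisher norm, concavity of the
likelihood would make this mixture too large (`Family.quad_sub_le_of_isArgmax`).  So the estimator
lies where the information is stable, and integrating the slab over an ellipsoid around it bounds the
evidence from below by a power `p ^ (-M s₀)`
(`Family.le_lintegral_exp_mul_gaussianDensity`, `Problem.Admissible.le_evidenceBound`).  Gradients
never appear, as all integrals are symmetrized about the centre of the ellipsoid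
(`setLIntegral_exp_le_of_even`).

*Evidence of `A`.*  On the event of the first assumption each random slab on a model of size `s` is at
most `(√2 D p ^ (λ / 2)) ^ s` times a fixed Gaussian density (`gaussianDensity_le_of_comparable`).  By
Tonelli's theorem the expected evidence is then governed by the expectation of
`(L_θ / L_θ₀) ^ α`, which equals the exponential of minus a sum of Jensen gaps of the cumulant function
`b` (`Family.lintegral_exp_natLogLik`).  The prior penalty `p ^ (-A₄ s)` beats the inflation of the
slabs because `λ < A₄` (`Problem.Admissible.w_mul_inflation_le`).

For `A = {|S_θ| > K s₀}` the Jensen gaps are dropped and the remaining penalty `p ^ (-A₄ s / 4)` is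
small enough once `K` is large.  For sparse `θ` far from `θ₀` in the norm of the Fisher information,
the gaps exceed a multiple of `s₀ log p` (`Problem.le_totalGap`), with the sparse singular value
ensuring that the linear predictors move little after shrinking `θ` towards `θ₀`.  The rates in the
other two norms follow from the definition of the compatibility numbers (`Problem.norm_bounds`).

All posterior bounds are stated through measurable majorants (`Problem.Regular.exists_majorant`), and
the event of the first assumption is shown to be measurable (`Problem.measurableSet_mleEvent`), since
the maximum likelihood estimators are given by a choice of maximizers.
-/

namespace SparseGLM

/-! ### Quadratic forms and Fisher information -/

section Quadratic

variable {ι : Type*} [Fintype ι]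

lemma quad_smul_vec (A : Matrix ι ι ℝ) (t : ℝ) (v : ι → ℝ) :
    quad A (t • v) = t ^ 2 * quad A v := by
  simp only [quad, Matrix.mulVec_smul, dotProduct_smul, smul_dotProduct, smul_eq_mul]
  ring

lemma quad_smul (c : ℝ) (A : Matrix ι ι ℝ) (v : ι → ℝ) : quad (c • A) v = c * quad A v := by
  simp only [quad, Matrix.smul_mulVec, dotProduct_smul, smul_eq_mul]

lemma quad_sub (A B : Matrix ι ι ℝ) (v : ι → ℝ) : quad (A - B) v = quad A v - quad B v := by
  simp only [quad, Matrix.sub_mulVec, dotProduct_sub]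

lemma quad_neg_vec (A : Matrix ι ι ℝ) (v : ι → ℝ) : quad A (-v) = quad A v := by
  simpa using quad_smul_vec A (-1) v

lemma quad_add_add_quad_sub (A : Matrix ι ι ℝ) (u v : ι → ℝ) :
    quad A (u + v) + quad A (u - v) = 2 * quad A u + 2 * quad A v := by
  simp only [quad, Matrix.mulVec_add, Matrix.mulVec_sub, dotProduct_add, add_dotProduct,
    dotProduct_sub, sub_dotProduct]
  ring

lemma quad_nonneg {A : Matrix ι ι ℝ} (hA : A.PosSemidef) (v : ι → ℝ) : 0 ≤ quad A v := by
  have := hA.dotProduct_mulVec_nonneg v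
  rwa [star_trivial] at this

lemma quad_pos {A : Matrix ι ι ℝ} (hA : A.PosDef) {v : ι → ℝ} (hv : v ≠ 0) : 0 < quad A v := by
  have := hA.dotProduct_mulVec_pos hv
  rwa [star_trivial] at this

lemma quad_le_of_posSemidef_sub {A B : Matrix ι ι ℝ} (h : (A - B).PosSemidef) (v : ι → ℝ) :
    quad B v ≤ quad A v := by
  have := quad_nonneg h v
  rw [quad_sub] at this
  linarith

lemma posSemidef_sub_iff {A B : Matrix ι ι ℝ} (hA : A.IsHermitian) (hB : B.IsHermitian) :
    (A - B).PosSemidef ↔ ∀ v, quad B v ≤ quad A v := by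
  refine ⟨quad_le_of_posSemidef_sub, fun h => ?_⟩
  refine Matrix.PosSemidef.of_dotProduct_mulVec_nonneg (hA.sub hB) fun v => ?_
  have h1 := h v
  have h2 := quad_sub A B v
  simp only [quad] at h1 h2
  simp only [star_trivial]
  linarith

/-- Cauchy–Schwarz for the pairing of a positive definite form with its inverse. -/
lemma sq_dotProduct_le_quad_inv_mul_quad [DecidableEq ι] {A : Matrix ι ι ℝ} (hA : A.PosDef)
    (x v : ι → ℝ) : (x ⬝ᵥ v) ^ 2 ≤ quad A⁻¹ x * quad A v := by
  have hdet : IsUnit A.det := (Matrix.isUnit_iff_isUnit_det A).mp hA.isUnit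
  set a := A⁻¹ *ᵥ x with ha
  have hAa : A *ᵥ a = x := by
    rw [ha, Matrix.mulVec_mulVec, Matrix.mul_nonsing_inv _ hdet, Matrix.one_mulVec]
  have hT : Aᵀ = A := by simpa using hA.isHermitian.eq
  have hsymm : v ⬝ᵥ (A *ᵥ a) = a ⬝ᵥ (A *ᵥ v) := by
    rw [Matrix.dotProduct_mulVec, ← Matrix.mulVec_transpose, hT, dotProduct_comm]
  have hq : quad A⁻¹ x = quad A a := by
    simp only [quad]; rw [hAa, ← ha, dotProduct_comm]
  have hxv : x ⬝ᵥ v = a ⬝ᵥ (A *ᵥ v) := by rw [← hsymm, hAa, dotProduct_comm]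
  rw [hq, hxv]
  have key : ∀ t : ℝ, 0 ≤ quad A v * (t * t) + (2 * (a ⬝ᵥ (A *ᵥ v))) * t + quad A a := by
    intro t
    have := quad_nonneg hA.posSemidef (a + t • v)
    simp only [quad, Matrix.mulVec_add, Matrix.mulVec_smul, dotProduct_add, add_dotProduct,
      dotProduct_smul, smul_dotProduct, smul_eq_mul, hsymm] at this
    simp only [quad]
    linarith
  have := discrim_le_zero key
  simp only [discrim] at this
  nlinarith

end Quadratic

section Fisher

variable {n : ℕ} {ι : Type*} [Fintype ι]

lemma Family.quad_fisher (G : Family) (X : Matrix (Fin n) ι ℝ) (θ v : ι → ℝ) :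
    quad (G.fisher X θ) v = ∑ i, iteratedDeriv 2 G.b ((X *ᵥ θ) i) * (X *ᵥ v) i ^ 2 := by
  simp only [quad, Family.fisher, Family.weight]
  rw [← Matrix.mulVec_mulVec, ← Matrix.mulVec_mulVec, Matrix.dotProduct_mulVec,
    Matrix.vecMul_transpose]
  simp only [dotProduct, Matrix.mulVec_diagonal]
  exact Finset.sum_congr rfl fun i _ => by ring

lemma Family.fisher_isHermitian (G : Family) (X : Matrix (Fin n) ι ℝ) (θ : ι → ℝ) :
    (G.fisher X θ).IsHermitian := by
  simp [Matrix.IsHermitian, Family.fisher, Family.weight, Matrix.mul_assoc]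

lemma Family.contDiff_two (G : Family) : ContDiff ℝ 2 G.b :=
  contDiff_of_differentiable_iteratedDeriv (n := 2)
    fun m hm => G.differentiable m (by exact_mod_cast hm)

lemma Family.continuous_b (G : Family) : Continuous G.b := G.contDiff_two.continuous

lemma Family.continuous_deriv2 (G : Family) : Continuous (iteratedDeriv 2 G.b) :=
  (G.differentiable 2 le_rfl).continuous

lemma Family.deriv2_nonneg (G : Family) (x : ℝ) : 0 ≤ iteratedDeriv 2 G.b x := by
  have h1 : Differentiable ℝ G.b := G.contDiff_two.differentiable (by norm_num)
  have hmono : Monotone (deriv G.b) := by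
    have := G.strictConvex.convexOn.monotoneOn_deriv (fun x _ => h1 x)
    exact monotoneOn_univ.mp this
  rw [iteratedDeriv_succ, iteratedDeriv_one]
  exact hmono.deriv_nonneg

lemma Family.fisher_posSemidef (G : Family) (X : Matrix (Fin n) ι ℝ) (θ : ι → ℝ) :
    (G.fisher X θ).PosSemidef := by
  refine Matrix.PosSemidef.of_dotProduct_mulVec_nonneg (G.fisher_isHermitian X θ) fun v => ?_
  have := G.quad_fisher X θ v
  simp only [quad] at this
  simp only [star_trivial]
  rw [this]
  exact Finset.sum_nonneg fun i _ => mul_nonneg (G.deriv2_nonneg _) (sq_nonneg _)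

end Fisher

lemma posDef_of_det_ne_zero {ι : Type*} [Fintype ι] [DecidableEq ι] {A : Matrix ι ι ℝ}
    (hA : A.PosSemidef) (h : A.det ≠ 0) : A.PosDef :=
  hA.posDef_iff_isUnit.mpr ((Matrix.isUnit_iff_isUnit_det A).mpr h.isUnit)

/-! ### Gaussian integrals with a given precision matrix -/

section Gaussian

variable {ι : Type*} [Fintype ι]

lemma lintegral_exp_neg_sum_sq :
    ∫⁻ v : ι → ℝ, ENNReal.ofReal (Real.exp (-(∑ j, v j ^ 2) / 2)) =
      ENNReal.ofReal (√(2 * Real.pi) ^ Fintype.card ι) := by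
  have hint : Integrable fun x : ℝ => Real.exp (-(1 / 2) * x ^ 2) :=
    integrable_exp_neg_mul_sq (by norm_num)
  have hfun : ∀ v : ι → ℝ, Real.exp (-(∑ j, v j ^ 2) / 2) =
      ∏ j, Real.exp (-(1 / 2) * v j ^ 2) := by
    intro v
    rw [← Real.exp_sum, ← Finset.mul_sum]
    congr 1; ring
  simp_rw [hfun]
  rw [← ofReal_integral_eq_lintegral_ofReal]
  · rw [integral_fintype_prod_volume_eq_pow (fun x : ℝ => Real.exp (-(1 / 2) * x ^ 2)),
      integral_gaussian]
    congr 3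
    ring
  · exact Integrable.fintype_prod fun _ => hint
  · exact Eventually.of_forall fun v => Finset.prod_nonneg fun j _ => (Real.exp_pos _).le

lemma continuous_quad (Q : Matrix ι ι ℝ) : Continuous (quad Q) := by
  unfold quad
  fun_prop

/-- Averaging over `w` and `-w`: an exponential integral over a symmetric set is at least the
integral obtained from the even part of the exponent. -/
lemma setLIntegral_exp_le_of_even {U : Set (ι → ℝ)} (hU : MeasurableSet U)
    (hsymm : ∀ w, w ∈ U → -w ∈ U) {g h : (ι → ℝ) → ℝ} (hg : Measurable g)
    (hgh : ∀ w ∈ U, 2 * h w ≤ g w + g (-w)) :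
    ∫⁻ w in U, ENNReal.ofReal (Real.exp (h w)) ≤ ∫⁻ w in U, ENNReal.ofReal (Real.exp (g w)) := by
  have hge : Measurable fun w => ENNReal.ofReal (Real.exp (g w)) := by fun_prop
  have hneg : ∫⁻ w in U, ENNReal.ofReal (Real.exp (g (-w))) =
      ∫⁻ w in U, ENNReal.ofReal (Real.exp (g w)) := by
    have hpre : (fun w : ι → ℝ => -w) ⁻¹' U = U := by
      ext w
      exact ⟨fun h => by simpa using hsymm _ h, fun h => hsymm _ h⟩
    have := (Measure.measurePreserving_neg (volume : Measure (ι → ℝ))).setLIntegral_comp_preimage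
      hU hge
    rw [← this]
    congr 2
    exact hpre.symm
  have h2 : 2 * ∫⁻ w in U, ENNReal.ofReal (Real.exp (h w)) ≤
      2 * ∫⁻ w in U, ENNReal.ofReal (Real.exp (g w)) := by
    calc 2 * ∫⁻ w in U, ENNReal.ofReal (Real.exp (h w))
        = ∫⁻ w in U, 2 * ENNReal.ofReal (Real.exp (h w)) :=
          (lintegral_const_mul' _ _ (by simp)).symm
      _ ≤ ∫⁻ w in U, (ENNReal.ofReal (Real.exp (g w)) + ENNReal.ofReal (Real.exp (g (-w)))) := by
          refine setLIntegral_mono (by fun_prop) fun w hw => ?_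
          rw [← ENNReal.ofReal_add (Real.exp_pos _).le (Real.exp_pos _).le]
          have h2' : (2 : ENNReal) = ENNReal.ofReal 2 := by simp
          rw [h2', ← ENNReal.ofReal_mul (by norm_num)]
          refine ENNReal.ofReal_le_ofReal ?_
          have h3 : h w ≤ g w / 2 + g (-w) / 2 := by linarith [hgh w hw]
          have h4 : Real.exp (g w / 2 + g (-w) / 2) = Real.exp (g w / 2) * Real.exp (g (-w) / 2) :=
            Real.exp_add _ _
          have h5 : Real.exp (g w) = Real.exp (g w / 2) ^ 2 := by
            rw [← Real.exp_nat_mul]; congr 1; push_cast; ring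
          have h6 : Real.exp (g (-w)) = Real.exp (g (-w) / 2) ^ 2 := by
            rw [← Real.exp_nat_mul]; congr 1; push_cast; ring
          have h7 := Real.exp_le_exp.mpr h3
          rw [h5, h6]
          nlinarith [sq_nonneg (Real.exp (g w / 2) - Real.exp (g (-w) / 2))]
      _ = 2 * ∫⁻ w in U, ENNReal.ofReal (Real.exp (g w)) := by
          rw [lintegral_add_left hge, hneg, two_mul]
  exact (ENNReal.mul_le_mul_iff_right (by simp) (by simp)).mp h2

variable [DecidableEq ι]

open scoped MatrixOrder Matrix.Norms.L2Operator in
lemma lintegral_exp_neg_quad {Q : Matrix ι ι ℝ} (hQ : Q.PosDef) :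
    ∫⁻ v, ENNReal.ofReal (Real.exp (-(quad Q v) / 2)) =
      ENNReal.ofReal (√(2 * Real.pi) ^ Fintype.card ι / √Q.det) := by
  obtain ⟨M, hM⟩ : ∃ M : Matrix ι ι ℝ, Q = Mᵀ * M := by
    obtain ⟨M, hM⟩ := CStarAlgebra.nonneg_iff_eq_star_mul_self.mp hQ.posSemidef.nonneg
    exact ⟨M, by rw [hM, Matrix.star_eq_conjTranspose, Matrix.conjTranspose_eq_transpose_of_trivial]⟩
  have hdet : Q.det = M.det ^ 2 := by rw [hM, Matrix.det_mul, Matrix.det_transpose, sq]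
  have hM0 : M.det ≠ 0 := by
    intro h; have := hQ.det_pos; rw [hdet, h] at this; simp at this
  have hquad : ∀ v, quad Q v = ∑ j, (Matrix.toLin' M v) j ^ 2 := by
    intro v
    rw [quad, hM, ← Matrix.mulVec_mulVec, Matrix.dotProduct_mulVec, Matrix.vecMul_transpose]
    simp [dotProduct, sq]
  simp_rw [hquad]
  have hmeas : Measurable fun v : ι → ℝ => ENNReal.ofReal (Real.exp (-(∑ j, v j ^ 2) / 2)) := by
    fun_prop
  have hlin : Measurable (Matrix.toLin' M) :=
    (LinearMap.continuous_of_finiteDimensional _).measurable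
  rw [← lintegral_map (f := fun v : ι → ℝ => ENNReal.ofReal (Real.exp (-(∑ j, v j ^ 2) / 2)))
    hmeas hlin, Real.map_matrix_volume_pi_eq_smul_volume_pi hM0, lintegral_smul_measure,
    lintegral_exp_neg_sum_sq, hdet, Real.sqrt_sq_eq_abs, smul_eq_mul,
    ← ENNReal.ofReal_mul (abs_nonneg _), abs_inv, div_eq_inv_mul]

lemma lintegral_gaussianDensity {Q : Matrix ι ι ℝ} (hQ : Q.PosDef) (m : ι → ℝ) :
    ∫⁻ v, ENNReal.ofReal (gaussianDensity m Q v) = 1 := by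
  unfold gaussianDensity
  rw [lintegral_sub_right_eq_self (fun v => ENNReal.ofReal (√Q.det /
    (√(2 * Real.pi)) ^ Fintype.card ι * Real.exp (-(quad Q v) / 2))) m]
  have h0 : 0 ≤ √Q.det / (√(2 * Real.pi)) ^ Fintype.card ι := by positivity
  simp_rw [ENNReal.ofReal_mul h0]
  rw [lintegral_const_mul' _ _ ENNReal.ofReal_ne_top, lintegral_exp_neg_quad hQ,
    ← ENNReal.ofReal_mul h0]
  have h1 : √Q.det ≠ 0 := (Real.sqrt_pos.mpr hQ.det_pos).ne'
  have h2 : √(2 * Real.pi) ≠ 0 := (Real.sqrt_pos.mpr (by positivity)).ne'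
  rw [div_mul_div_cancel₀ (pow_ne_zero _ h2), div_self h1, ENNReal.ofReal_one]

/-- Monotonicity of the determinant, read off from the Gaussian integrals. -/
lemma det_le_det_of_quad_le {A B : Matrix ι ι ℝ} (hA : A.PosDef) (hB : B.PosDef)
    (h : ∀ v, quad A v ≤ quad B v) : A.det ≤ B.det := by
  have h1 : ∫⁻ v, ENNReal.ofReal (Real.exp (-(quad B v) / 2)) ≤
      ∫⁻ v, ENNReal.ofReal (Real.exp (-(quad A v) / 2)) :=
    lintegral_mono fun v => ENNReal.ofReal_le_ofReal (Real.exp_le_exp.mpr (by linarith [h v]))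
  rw [lintegral_exp_neg_quad hA, lintegral_exp_neg_quad hB,
    ENNReal.ofReal_le_ofReal_iff (by positivity)] at h1
  have hc : 0 < √(2 * Real.pi) ^ Fintype.card ι := by positivity
  have hA' := Real.sqrt_pos.mpr hA.det_pos
  have hB' := Real.sqrt_pos.mpr hB.det_pos
  rw [div_le_div_iff_of_pos_left hc hB' hA'] at h1
  exact (Real.sqrt_le_sqrt_iff hB.det_pos.le).mp h1

lemma sqrt_pow_nat {a : ℝ} (ha : 0 ≤ a) (k : ℕ) : √(a ^ k) = √a ^ k := by
  induction k with
  | zero => simp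
  | succ k ih => rw [pow_succ, Real.sqrt_mul (pow_nonneg ha k), ih, pow_succ]

lemma gaussianDensity_nonneg (m : ι → ℝ) (Q : Matrix ι ι ℝ) (v : ι → ℝ) :
    0 ≤ gaussianDensity m Q v := by
  unfold gaussianDensity; positivity

lemma continuous_gaussianDensity (m : ι → ℝ) (Q : Matrix ι ι ℝ) :
    Continuous (gaussianDensity m Q) := by
  unfold gaussianDensity quad
  fun_prop

/-- Tilting a Gaussian density by the exponential of a multiple of its own exponent rescales the
precision. -/
lemma gaussianDensity_mul_exp {Q : Matrix ι ι ℝ} {a b : ℝ} (ha : 0 < a) (hb : 0 < b)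
    (v : ι → ℝ) :
    gaussianDensity 0 (a • Q) v * Real.exp (-((b - a) * quad Q v) / 2) =
      √(a / b) ^ Fintype.card ι * gaussianDensity 0 (b • Q) v := by
  unfold gaussianDensity
  rw [sub_zero, quad_smul, quad_smul, Matrix.det_smul, Matrix.det_smul, mul_assoc, ← Real.exp_add]
  have h1 : √(a ^ Fintype.card ι * Q.det) = √a ^ Fintype.card ι * √Q.det := by
    rw [Real.sqrt_mul (by positivity), sqrt_pow_nat ha.le]
  have h2 : √(b ^ Fintype.card ι * Q.det) = √b ^ Fintype.card ι * √Q.det := by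
    rw [Real.sqrt_mul (by positivity), sqrt_pow_nat hb.le]
  have hb' : √b ≠ 0 := (Real.sqrt_pos.mpr hb).ne'
  have h3 : √(a / b) ^ Fintype.card ι = √a ^ Fintype.card ι / √b ^ Fintype.card ι := by
    rw [Real.sqrt_div ha.le, div_pow]
  rw [h1, h2, h3]
  have h4 : -(a * quad Q v) / 2 + -((b - a) * quad Q v) / 2 = -(b * quad Q v) / 2 := by ring
  rw [h4]
  field_simp

/-- A Gaussian tilted by `exp (-C quad Q / 2)` keeps half of its total mass on an ellipsoid of
squared radius `T` as soon as `T` exceeds a multiple of the dimension. -/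
lemma le_setLIntegral_gaussianDensity_mul_exp {Q : Matrix ι ι ℝ} (hQ : Q.PosDef) {a C T : ℝ}
    (ha : 0 < a) (hC : 0 ≤ C)
    (hT : √2 ^ Fintype.card ι * Real.exp (-((a + C) * T) / 4) ≤ 1 / 2) :
    ENNReal.ofReal (1 / 2 * √(a / (a + C)) ^ Fintype.card ι) ≤
      ∫⁻ w in {w | quad Q w ≤ T},
        ENNReal.ofReal (gaussianDensity 0 (a • Q) w * Real.exp (-(C * quad Q w) / 2)) := by
  have haC : 0 < a + C := by linarith
  have hset : MeasurableSet {w | quad Q w ≤ T} :=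
    measurableSet_le (continuous_quad Q).measurable measurable_const
  have hfun : ∀ w, gaussianDensity 0 (a • Q) w * Real.exp (-(C * quad Q w) / 2) =
      √(a / (a + C)) ^ Fintype.card ι * gaussianDensity 0 ((a + C) • Q) w := by
    intro w
    rw [← gaussianDensity_mul_exp ha haC, add_sub_cancel_left]
  simp_rw [hfun]
  have h0 : 0 ≤ √(a / (a + C)) ^ Fintype.card ι := by positivity
  simp_rw [ENNReal.ofReal_mul h0]
  rw [lintegral_const_mul' _ _ ENNReal.ofReal_ne_top, mul_comm (1 / 2 : ℝ), ENNReal.ofReal_mul h0]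
  gcongr
  have htot := lintegral_gaussianDensity (hQ.smul haC) (0 : ι → ℝ)
  have hsplit := lintegral_add_compl (μ := volume)
    (fun w => ENNReal.ofReal (gaussianDensity 0 ((a + C) • Q) w)) hset
  rw [htot] at hsplit
  have htail : ∫⁻ w in {w | quad Q w ≤ T}ᶜ, ENNReal.ofReal (gaussianDensity 0 ((a + C) • Q) w) ≤
      ENNReal.ofReal (1 / 2) := by
    calc ∫⁻ w in {w | quad Q w ≤ T}ᶜ, ENNReal.ofReal (gaussianDensity 0 ((a + C) • Q) w)
        ≤ ∫⁻ w in {w | quad Q w ≤ T}ᶜ, ENNReal.ofReal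
            (√2 ^ Fintype.card ι * Real.exp (-((a + C) * T) / 4)) *
            ENNReal.ofReal (gaussianDensity 0 (((a + C) / 2) • Q) w) := by
          refine setLIntegral_mono (by
            exact (ENNReal.measurable_ofReal.comp
              (continuous_gaussianDensity _ _).measurable).const_mul _) fun w hw => ?_
          rw [← ENNReal.ofReal_mul (by positivity)]
          refine ENNReal.ofReal_le_ofReal ?_
          have hw' : T < quad Q w := not_le.mp hw
          have h1 := gaussianDensity_mul_exp (Q := Q) haC (half_pos haC) w
          have h2 : (a + C) / ((a + C) / 2) = 2 := by field_simp
          rw [h2] at h1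
          have h3 : Real.exp (-(((a + C) / 2 - (a + C)) * quad Q w) / 2) =
              (Real.exp (-((a + C) * quad Q w) / 4))⁻¹ := by
            rw [← Real.exp_neg]; congr 1; ring
          rw [h3, ← div_eq_mul_inv, div_eq_iff (Real.exp_pos _).ne'] at h1
          rw [h1]
          have h4 : Real.exp (-((a + C) * quad Q w) / 4) ≤ Real.exp (-((a + C) * T) / 4) := by
            apply Real.exp_le_exp.mpr; nlinarith
          have h5 := gaussianDensity_nonneg 0 (((a + C) / 2) • Q) w
          calc _ = √2 ^ Fintype.card ι * Real.exp (-((a + C) * quad Q w) / 4) *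
                gaussianDensity 0 (((a + C) / 2) • Q) w := by ring
            _ ≤ _ := by gcongr
      _ ≤ ∫⁻ w, ENNReal.ofReal (√2 ^ Fintype.card ι * Real.exp (-((a + C) * T) / 4)) *
            ENNReal.ofReal (gaussianDensity 0 (((a + C) / 2) • Q) w) :=
          setLIntegral_le_lintegral _ _
      _ = ENNReal.ofReal (√2 ^ Fintype.card ι * Real.exp (-((a + C) * T) / 4)) := by
          rw [lintegral_const_mul' _ _ ENNReal.ofReal_ne_top,
            lintegral_gaussianDensity (hQ.smul (half_pos haC)), mul_one]
      _ ≤ _ := ENNReal.ofReal_le_ofReal hT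
  have h12 : (1 : ENNReal) = ENNReal.ofReal (1 / 2) + ENNReal.ofReal (1 / 2) := by
    rw [← ENNReal.ofReal_add (by norm_num) (by norm_num)]; norm_num
  rw [h12] at hsplit
  by_contra hlt
  push Not at hlt
  have := ENNReal.add_lt_add_of_lt_of_le (by
    exact (htail.trans_lt ENNReal.ofReal_lt_top).ne) hlt htail
  rw [hsplit] at this
  exact lt_irrefl _ this

end Gaussian

/-! ### Second-order inequalities for the cumulant function -/

section Cumulant

variable (G : Family)

lemma Family.hasDerivAt_b (x : ℝ) : HasDerivAt G.b (deriv G.b x) x :=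
  (G.contDiff_two.differentiable (by norm_num) x).hasDerivAt

lemma Family.hasDerivAt_deriv_b (x : ℝ) :
    HasDerivAt (deriv G.b) (iteratedDeriv 2 G.b x) x := by
  have h := (G.differentiable 1 (by norm_num) x).hasDerivAt
  rw [iteratedDeriv_one] at h
  rwa [iteratedDeriv_succ, iteratedDeriv_one]

/-- `σ b - c x²` is convex wherever `σ b'' ≥ 2 c`. -/
lemma Family.convexOn_sub_sq {D : Set ℝ} (hD : Convex ℝ D) {σ c : ℝ}
    (h : ∀ x ∈ D, 2 * c ≤ σ * iteratedDeriv 2 G.b x) :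
    ConvexOn ℝ D fun x => σ * G.b x - c * x ^ 2 := by
  have h1 : ∀ x, HasDerivAt (fun x => σ * G.b x - c * x ^ 2) (σ * deriv G.b x - 2 * c * x) x := by
    intro x
    exact (((G.hasDerivAt_b x).const_mul σ).sub ((hasDerivAt_pow 2 x).const_mul c)).congr_deriv
      (by simp only [Nat.cast_ofNat, Nat.add_one_sub_one, pow_one]; ring)
  have h2 : ∀ x, HasDerivAt (fun x => σ * deriv G.b x - 2 * c * x)
      (σ * iteratedDeriv 2 G.b x - 2 * c) x := by
    intro x
    exact (((G.hasDerivAt_deriv_b x).const_mul σ).sub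
      ((hasDerivAt_id x).const_mul (2 * c))).congr_deriv (by simp)
  have h3 : deriv (fun x => σ * G.b x - c * x ^ 2) = fun x => σ * deriv G.b x - 2 * c * x :=
    funext fun x => (h1 x).deriv
  refine convexOn_of_deriv2_nonneg' hD (fun x _ => (h1 x).differentiableAt.differentiableWithinAt)
    ?_ fun x hx => ?_
  · rw [h3]
    exact fun x _ => (h2 x).differentiableAt.differentiableWithinAt
  · rw [Function.iterate_succ, Function.iterate_one, Function.comp_apply, h3, (h2 x).deriv]
    linarith [h x hx]

lemma Family.symm_second_difference_le {c h M : ℝ}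
    (hM : ∀ x, |x - c| ≤ |h| → iteratedDeriv 2 G.b x ≤ M) :
    G.b (c + h) + G.b (c - h) ≤ 2 * G.b c + M * h ^ 2 := by
  have hconv := G.convexOn_sub_sq (D := Metric.closedBall c |h|) (convex_closedBall c |h|)
    (σ := -1) (c := -(M / 2)) fun x hx => by
      rw [Metric.mem_closedBall, Real.dist_eq] at hx
      linarith [hM x hx]
  have h1 : c + h ∈ Metric.closedBall c |h| := by simp
  have h2 : c - h ∈ Metric.closedBall c |h| := by simp
  have := hconv.2 h1 h2 (by norm_num : (0 : ℝ) ≤ 1 / 2) (by norm_num : (0 : ℝ) ≤ 1 / 2) (by norm_num)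
  simp only [smul_eq_mul] at this
  have hc : 1 / 2 * (c + h) + 1 / 2 * (c - h) = c := by ring
  rw [hc] at this
  nlinarith

/-- Gap in Jensen's inequality for `b` at the points `x`, `y` with weights `1 - a`, `a`; this is the
exponent of the Rényi-type affinity of two members of the family. -/
def Family.jensenGap (a x y : ℝ) : ℝ := (1 - a) * G.b x + a * G.b y - G.b ((1 - a) * x + a * y)

lemma Family.jensenGap_nonneg {a : ℝ} (ha0 : 0 ≤ a) (ha1 : a ≤ 1) (x y : ℝ) :
    0 ≤ G.jensenGap a x y := by
  have := G.strictConvex.convexOn.2 (Set.mem_univ x) (Set.mem_univ y) (sub_nonneg.mpr ha1) ha0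
    (by ring)
  simp only [smul_eq_mul] at this
  unfold Family.jensenGap; linarith

lemma Family.le_jensenGap {a : ℝ} (ha0 : 0 ≤ a) (ha1 : a ≤ 1) {x h m : ℝ}
    (hm : ∀ z, |z - x| ≤ |h| → m ≤ iteratedDeriv 2 G.b z) :
    m * (a * (1 - a)) / 2 * h ^ 2 ≤ G.jensenGap a x (x + h) := by
  have hconv := G.convexOn_sub_sq (D := Metric.closedBall x |h|) (convex_closedBall x |h|)
    (σ := 1) (c := m / 2) fun z hz => by
      rw [Metric.mem_closedBall, Real.dist_eq] at hz
      linarith [hm z hz]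
  have h1 : x + h ∈ Metric.closedBall x |h| := by simp
  have h2 : x ∈ Metric.closedBall x |h| := by simp
  have := hconv.2 h2 h1 (sub_nonneg.mpr ha1) ha0 (by ring)
  simp only [smul_eq_mul] at this
  unfold Family.jensenGap
  nlinarith

/-- The Jensen gap grows along rays. -/
lemma Family.jensenGap_mono {a t : ℝ} (ha0 : 0 ≤ a) (ha1 : a < 1) (ht0 : 0 ≤ t) (ht1 : t ≤ 1)
    (x h : ℝ) : G.jensenGap a x (x + t * h) ≤ G.jensenGap a x (x + h) := by
  have hpos : 0 < 1 - a * t := by nlinarith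
  set μ := (a - a * t) / (1 - a * t) with hμ
  set ν := (t - a * t) / (1 - a * t) with hν
  have hμ0 : 0 ≤ μ := div_nonneg (by nlinarith) hpos.le
  have hν0 : 0 ≤ ν := div_nonneg (by nlinarith) hpos.le
  have hμ1 : μ ≤ 1 := (div_le_one hpos).mpr (by linarith)
  have hν1 : ν ≤ 1 := (div_le_one hpos).mpr (by linarith)
  have e1 : μ * (1 - a * t) = a - a * t := by rw [hμ, div_mul_cancel₀ _ hpos.ne']
  have e2 : ν * (1 - a * t) = t - a * t := by rw [hν, div_mul_cancel₀ _ hpos.ne']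
  have e3 : μ + a * ν = a := by rw [hμ, hν, ← mul_div_assoc, ← add_div, div_eq_iff hpos.ne']; ring
  have c1 := G.strictConvex.convexOn.2 (Set.mem_univ (x + a * t * h)) (Set.mem_univ (x + h))
    (sub_nonneg.mpr hμ1) hμ0 (by ring)
  have c2 := G.strictConvex.convexOn.2 (Set.mem_univ (x + a * t * h)) (Set.mem_univ (x + h))
    (sub_nonneg.mpr hν1) hν0 (by ring)
  simp only [smul_eq_mul] at c1 c2
  have p1 : (1 - μ) * (x + a * t * h) + μ * (x + h) = (1 - a) * x + a * (x + h) := by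
    linear_combination h * e1
  have p2 : (1 - ν) * (x + a * t * h) + ν * (x + h) = x + t * h := by
    linear_combination h * e2
  rw [p1] at c1
  rw [p2] at c2
  have p3 : (1 - a) * x + a * (x + t * h) = x + a * t * h := by ring
  unfold Family.jensenGap
  rw [p3]
  have c3 := mul_le_mul_of_nonneg_left c2 ha0
  have e3' : a * ν = a - μ := by linarith
  have c4 : a * ((1 - ν) * G.b (x + a * t * h) + ν * G.b (x + h)) =
      μ * G.b (x + a * t * h) + (a - μ) * G.b (x + h) := by
    linear_combination (G.b (x + h) - G.b (x + a * t * h)) * e3'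
  nlinarith

end Cumulant

/-! ### The log-likelihood in the natural parameters -/

section NaturalParameter

variable {n : ℕ} (G : Family)

/-- Log-likelihood as a function of the natural parameters `η = X θ`, without the carrier term. -/
def Family.natLogLik (y η : Fin n → ℝ) : ℝ := ∑ i, (y i * η i - G.b (η i))

lemma Family.logLik_eq {ι : Type*} [Fintype ι] (X : Matrix (Fin n) ι ℝ) (y : Fin n → ℝ)
    (θ : ι → ℝ) : G.logLik X y θ = G.natLogLik y (X *ᵥ θ) + ∑ i, G.k (y i) := by
  simp only [Family.logLik, Family.natLogLik, Finset.sum_add_distrib]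

lemma Family.isArgmax_logLik_iff {ι : Type*} [Fintype ι] (X : Matrix (Fin n) ι ℝ)
    (y : Fin n → ℝ) (v : ι → ℝ) :
    IsArgmax (G.logLik X y) v ↔ ∀ z, G.natLogLik y (X *ᵥ z) ≤ G.natLogLik y (X *ᵥ v) := by
  simp only [IsArgmax, Family.logLik_eq, add_le_add_iff_right]

lemma Family.continuous_natLogLik :
    Continuous fun q : (Fin n → ℝ) × (Fin n → ℝ) => G.natLogLik q.1 q.2 := by
  unfold Family.natLogLik
  have := G.continuous_b
  fun_prop

lemma Family.natLogLik_symm {M : Fin n → ℝ} (y : Fin n → ℝ) {η δ : Fin n → ℝ}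
    (hM : ∀ i x, |x - η i| ≤ |δ i| → iteratedDeriv 2 G.b x ≤ M i) :
    2 * G.natLogLik y η - ∑ i, M i * δ i ^ 2 ≤
      G.natLogLik y (η + δ) + G.natLogLik y (η - δ) := by
  simp only [Family.natLogLik, Finset.mul_sum, ← Finset.sum_sub_distrib, ← Finset.sum_add_distrib]
  refine Finset.sum_le_sum fun i _ => ?_
  have := G.symm_second_difference_le (hM i)
  simp only [Pi.add_apply, Pi.sub_apply]
  linarith

lemma Family.natLogLik_combo (y η δ : Fin n → ℝ) (a : ℝ) :
    G.natLogLik y (η + a • δ) = (1 - a) * G.natLogLik y η + a * G.natLogLik y (η + δ) +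
      ∑ i, G.jensenGap a (η i) (η i + δ i) := by
  simp only [Family.natLogLik, Finset.mul_sum, ← Finset.sum_add_distrib]
  refine Finset.sum_congr rfl fun i _ => ?_
  have : (1 - a) * η i + a * (η i + δ i) = η i + a * δ i := by ring
  simp only [Family.jensenGap, this, Pi.add_apply, Pi.smul_apply, smul_eq_mul]
  ring

/-- By strict convexity of `b`, two points at which a log-likelihood takes the same value coincide
if their midpoint does no better.  The score weights `m` are the responses or their means. -/
lemma eq_of_isMax_of_strictConvex {g : (Fin n → ℝ) → ℝ} {m η η' : Fin n → ℝ}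
    (hg : ∀ η, g η = ∑ i, (m i * η i - G.b (η i)))
    (hmax : g ((1 / 2 : ℝ) • η + (1 / 2 : ℝ) • η') ≤ g η) (heq : g η = g η') : η = η' := by
  by_contra hne
  obtain ⟨j, hj⟩ := Function.ne_iff.mp hne
  have hlt : 1 / 2 * g η + 1 / 2 * g η' < g ((1 / 2 : ℝ) • η + (1 / 2 : ℝ) • η') := by
    simp only [hg, Finset.mul_sum, ← Finset.sum_add_distrib]
    refine Finset.sum_lt_sum (fun i _ => ?_) ⟨j, Finset.mem_univ _, ?_⟩
    · have := G.strictConvex.convexOn.2 (Set.mem_univ (η i)) (Set.mem_univ (η' i))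
        (by norm_num : (0 : ℝ) ≤ 1 / 2) (by norm_num : (0 : ℝ) ≤ 1 / 2) (by norm_num)
      simp only [smul_eq_mul] at this
      simp only [Pi.add_apply, Pi.smul_apply, smul_eq_mul]
      linarith
    · have := G.strictConvex.2 (Set.mem_univ (η j)) (Set.mem_univ (η' j)) hj
        (by norm_num : (0 : ℝ) < 1 / 2) (by norm_num : (0 : ℝ) < 1 / 2) (by norm_num)
      simp only [smul_eq_mul] at this
      simp only [Pi.add_apply, Pi.smul_apply, smul_eq_mul]
      linarith
  linarith

/-! ### Exponential moments of likelihood ratios -/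

lemma Family.measurable_density (η : ℝ) :
    Measurable fun y => ENNReal.ofReal (Real.exp (y * η - G.b η + G.k y)) := by
  have := G.measurable_k
  fun_prop

instance Family.isProbabilityMeasure_law (η : ℝ) : IsProbabilityMeasure (G.law η) := by
  constructor
  rw [Family.law, withDensity_apply _ MeasurableSet.univ, Measure.restrict_univ, G.normalized η]

lemma Family.lintegral_exp_law (a η0 η : ℝ) :
    ∫⁻ y, ENNReal.ofReal (Real.exp (a * ((y * η - G.b η) - (y * η0 - G.b η0)))) ∂(G.law η0) =
      ENNReal.ofReal (Real.exp (-G.jensenGap a η0 η)) := by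
  rw [Family.law, lintegral_withDensity_eq_lintegral_mul _ (G.measurable_density η0)
    (by fun_prop)]
  have hfun : ∀ y, ((fun y => ENNReal.ofReal (Real.exp (y * η0 - G.b η0 + G.k y))) *
      fun y => ENNReal.ofReal (Real.exp (a * ((y * η - G.b η) - (y * η0 - G.b η0))))) y =
      ENNReal.ofReal (Real.exp (-G.jensenGap a η0 η)) *
        ENNReal.ofReal (Real.exp (y * ((1 - a) * η0 + a * η) - G.b ((1 - a) * η0 + a * η)
          + G.k y)) := by
    intro y
    simp only [Pi.mul_apply]
    rw [← ENNReal.ofReal_mul (Real.exp_pos _).le, ← ENNReal.ofReal_mul (Real.exp_pos _).le,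
      ← Real.exp_add, ← Real.exp_add]
    congr 2
    unfold Family.jensenGap
    ring
  simp_rw [hfun]
  rw [lintegral_const_mul' _ _ ENNReal.ofReal_ne_top, G.normalized, mul_one]

/-- Exponential moments of the log-likelihood ratio in terms of Jensen gaps of `b`. -/
lemma Family.lintegral_exp_natLogLik (a : ℝ) (η0 η : Fin n → ℝ) :
    ∫⁻ y, ENNReal.ofReal (Real.exp (a * (G.natLogLik y η - G.natLogLik y η0)))
      ∂(Measure.pi fun i => G.law (η0 i)) =
      ENNReal.ofReal (Real.exp (-∑ i, G.jensenGap a (η0 i) (η i))) := by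
  have hfun : ∀ y : Fin n → ℝ,
      ENNReal.ofReal (Real.exp (a * (G.natLogLik y η - G.natLogLik y η0))) =
      ∏ i, ENNReal.ofReal (Real.exp (a * ((y i * η i - G.b (η i)) -
        (y i * η0 i - G.b (η0 i))))) := by
    intro y
    rw [← ENNReal.ofReal_prod_of_nonneg fun i _ => (Real.exp_pos _).le, ← Real.exp_sum,
      ← Finset.mul_sum, Finset.sum_sub_distrib]
    rfl
  simp_rw [hfun]
  have hind : ProbabilityTheory.iIndepFun (fun (i : Fin n) (y : Fin n → ℝ) =>
      ENNReal.ofReal (Real.exp (a * ((y i * η i - G.b (η i)) - (y i * η0 i - G.b (η0 i))))))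
      (Measure.pi fun i => G.law (η0 i)) :=
    ProbabilityTheory.iIndepFun_pi (μ := fun i => G.law (η0 i))
      (X := fun i x => ENNReal.ofReal (Real.exp (a * ((x * η i - G.b (η i)) -
        (x * η0 i - G.b (η0 i)))))) fun i => by fun_prop
  rw [ProbabilityTheory.lintegral_prod_eq_prod_lintegral_of_indepFun Finset.univ _ hind fun i => by fun_prop]
  rw [← Finset.sum_neg_distrib, Real.exp_sum, ENNReal.ofReal_prod_of_nonneg
    fun i _ => (Real.exp_pos _).le]
  refine Finset.prod_congr rfl fun i _ => ?_
  rw [← G.lintegral_exp_law]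
  exact (measurePreserving_eval (fun i => G.law (η0 i)) i).lintegral_comp
    (f := fun x => ENNReal.ofReal (Real.exp (a * ((x * η i - G.b (η i)) -
        (x * η0 i - G.b (η0 i)))))) (by fun_prop)

lemma Family.jensenGap_one (x y : ℝ) : G.jensenGap 1 x y = 0 := by simp [Family.jensenGap]

/-! ### The expected log-likelihood is maximal at the truth -/

lemma Family.integrable_exp_mul (η0 t : ℝ) : Integrable (fun y => Real.exp (t * y)) (G.law η0) := by
  refine ⟨by fun_prop, ?_⟩
  rw [hasFiniteIntegral_iff_ofReal (Eventually.of_forall fun y => (Real.exp_pos _).le)]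
  have h := G.lintegral_exp_law 1 η0 (η0 + t)
  have hfun : ∀ y, ENNReal.ofReal (Real.exp (t * y)) =
      ENNReal.ofReal (Real.exp (G.b (η0 + t) - G.b η0)) *
      ENNReal.ofReal (Real.exp (1 * ((y * (η0 + t) - G.b (η0 + t)) - (y * η0 - G.b η0)))) := by
    intro y
    rw [← ENNReal.ofReal_mul (Real.exp_pos _).le, ← Real.exp_add]
    congr 2; ring
  simp_rw [hfun]
  rw [lintegral_const_mul' _ _ ENNReal.ofReal_ne_top, h]
  exact ENNReal.mul_lt_top ENNReal.ofReal_lt_top ENNReal.ofReal_lt_top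

lemma Family.integrable_id_law (η0 : ℝ) : Integrable (fun y => y) (G.law η0) := by
  refine ((G.integrable_exp_mul η0 1).add (G.integrable_exp_mul η0 (-1))).mono' (by fun_prop)
    (Eventually.of_forall fun y => ?_)
  simp only [Pi.add_apply, one_mul, neg_mul, Real.norm_eq_abs]
  have h1 := Real.add_one_le_exp y
  have h2 := Real.add_one_le_exp (-y)
  have h3 := Real.exp_pos y
  have h4 := Real.exp_pos (-y)
  rw [abs_le]
  constructor <;> linarith

/-- Nonnegativity of the Kullback–Leibler divergence within the family, from `1 + x ≤ exp x`. -/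
lemma Family.mean_mul_sub_le (η0 η : ℝ) :
    (∫ y, y ∂(G.law η0)) * η - G.b η ≤ (∫ y, y ∂(G.law η0)) * η0 - G.b η0 := by
  have hint := G.integrable_id_law η0
  have hexp : Integrable (fun y => Real.exp ((y * η - G.b η) - (y * η0 - G.b η0))) (G.law η0) := by
    have := (G.integrable_exp_mul η0 (η - η0)).const_mul (Real.exp (G.b η0 - G.b η))
    refine this.congr (Eventually.of_forall fun y => ?_)
    simp only
    rw [← Real.exp_add]; congr 1; ring
  have h1 : ∫ y, Real.exp ((y * η - G.b η) - (y * η0 - G.b η0)) ∂(G.law η0) = 1 := by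
    rw [integral_eq_lintegral_of_nonneg_ae (Eventually.of_forall fun y => (Real.exp_pos _).le)
      (by fun_prop)]
    have := G.lintegral_exp_law 1 η0 η
    simp only [one_mul, G.jensenGap_one, neg_zero, Real.exp_zero, ENNReal.ofReal_one] at this
    rw [this, ENNReal.toReal_one]
  have hlin : Integrable (fun y => y * (η - η0)) (G.law η0) := hint.mul_const _
  have h2 : ∫ y, (y * (η - η0) + (G.b η0 - G.b η + 1)) ∂(G.law η0) ≤
      ∫ y, Real.exp ((y * η - G.b η) - (y * η0 - G.b η0)) ∂(G.law η0) := by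
    refine integral_mono (hlin.add (integrable_const _)) hexp fun y => ?_
    have := Real.add_one_le_exp ((y * η - G.b η) - (y * η0 - G.b η0))
    simp only
    linarith
  have h3 : ∫ y, (y * (η - η0) + (G.b η0 - G.b η + 1)) ∂(G.law η0) =
      (∫ y, y ∂(G.law η0)) * (η - η0) + (G.b η0 - G.b η + 1) := by
    rw [integral_add hlin (integrable_const _), integral_mul_const]
    simp
  rw [h1, h3] at h2
  linarith

end NaturalParameter

/-! ### Sub-models and the pseudo-true parameter -/

section SubModel

lemma cols_mulVec {n p : ℕ} (X : Matrix (Fin n) (Fin p) ℝ) (S : Finset (Fin p)) (v : S → ℝ) :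
    cols X S *ᵥ v = X *ᵥ zeroExtend S v := by
  ext i
  simp only [Matrix.mulVec, dotProduct, cols, Matrix.submatrix_apply, id, zeroExtend]
  rw [← Finset.sum_subset (Finset.subset_univ S) fun j _ hj => by simp [hj],
    ← Finset.sum_attach S]
  exact Finset.sum_congr rfl fun j _ => by simp

lemma supp_zeroExtend_card_le {p : ℕ} (S : Finset (Fin p)) (v : S → ℝ) :
    (supp (zeroExtend S v)).card ≤ S.card := by
  refine Finset.card_le_card fun j hj => ?_
  by_contra hjS
  simp [supp, zeroExtend, hjS] at hj

lemma measurable_zeroExtend {p : ℕ} (S : Finset (Fin p)) : Measurable (zeroExtend S) := by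
  refine measurable_pi_lambda _ fun j => ?_
  unfold zeroExtend
  by_cases h : j ∈ S
  · simpa [h] using measurable_pi_apply _
  · simp [h]

variable {n : ℕ} {ι : Type*} [Fintype ι]

lemma Family.fisher_congr (G : Family) {X : Matrix (Fin n) ι ℝ} {θ θ' : ι → ℝ}
    (h : X *ᵥ θ = X *ᵥ θ') : G.fisher X θ = G.fisher X θ' := by
  simp only [Family.fisher, Family.weight, h]

lemma argmax_isArgmax {E : Type*} [Zero E] {f : E → ℝ} (h : ∃ x, IsArgmax f x) :
    IsArgmax f (argmax f) := by
  unfold argmax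
  rw [dif_pos h]
  exact h.choose_spec

lemma Family.integral_logLik_sub (G : Family) (X : Matrix (Fin n) ι ℝ) (η0 : Fin n → ℝ)
    (θ : ι → ℝ) :
    ∫ y, (G.logLik X y θ - G.logLik X y 0) ∂(Measure.pi fun i => G.law (η0 i)) =
      ∑ i, ((∫ y, y ∂(G.law (η0 i))) * (X *ᵥ θ) i - G.b ((X *ᵥ θ) i)) + n * G.b 0 := by
  have hfun : ∀ y, G.logLik X y θ - G.logLik X y 0 =
      ∑ i, (y i * (X *ᵥ θ) i + (G.b 0 - G.b ((X *ᵥ θ) i))) := by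
    intro y
    simp only [Family.logLik, ← Finset.sum_sub_distrib, Matrix.mulVec_zero, Pi.zero_apply]
    exact Finset.sum_congr rfl fun i _ => by ring
  have hint : ∀ i, Integrable (fun y : Fin n → ℝ => y i) (Measure.pi fun i => G.law (η0 i)) :=
    fun i => integrable_comp_eval (μ := fun i => G.law (η0 i)) (f := fun x => x)
      (G.integrable_id_law (η0 i))
  simp_rw [hfun]
  have hint' : ∀ i ∈ Finset.univ, Integrable
      (fun y : Fin n → ℝ => y i * (X *ᵥ θ) i + (G.b 0 - G.b ((X *ᵥ θ) i)))
      (Measure.pi fun i => G.law (η0 i)) :=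
    fun i _ => ((hint i).mul_const _).add (integrable_const _)
  rw [integral_finsetSum _ hint']
  have hterm : ∀ i, ∫ y : Fin n → ℝ, (y i * (X *ᵥ θ) i + (G.b 0 - G.b ((X *ᵥ θ) i)))
      ∂(Measure.pi fun i => G.law (η0 i)) =
      ((∫ y, y ∂(G.law (η0 i))) * (X *ᵥ θ) i - G.b ((X *ᵥ θ) i)) + G.b 0 := by
    intro i
    rw [integral_add ((hint i).mul_const _) (integrable_const _), integral_mul_const,
      integral_comp_eval (μ := fun i => G.law (η0 i)) (f := fun x => x)
        (G.integrable_id_law (η0 i)).aestronglyMeasurable]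
    simp
    ring
  simp_rw [hterm]
  rw [Finset.sum_add_distrib]
  simp

variable {p : ℕ} (P : Problem n p) (G : Family)

/-- The true coefficient vector, restricted to its support. -/
def Problem.trueRestrict : P.S0 → ℝ := fun j => P.θ0 j

lemma Problem.zeroExtend_trueRestrict : zeroExtend P.S0 P.trueRestrict = P.θ0 := by
  ext j
  by_cases h : j ∈ P.S0
  · simp [zeroExtend, h, Problem.trueRestrict]
  · have : P.θ0 j = 0 := by simpa [Problem.S0, supp] using h
    simp [zeroExtend, h, this]

lemma Problem.cols_mulVec_trueRestrict :
    cols P.X P.S0 *ᵥ P.trueRestrict = P.X *ᵥ P.θ0 := by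
  rw [cols_mulVec, P.zeroExtend_trueRestrict]

/-- The model `S₀` is correctly specified, so its pseudo-true parameter has the true natural
parameters. -/
lemma Problem.cols_mulVec_best : cols P.X P.S0 *ᵥ P.best G P.S0 = P.X *ᵥ P.θ0 := by
  set f : (P.S0 → ℝ) → ℝ := fun θ =>
    ∫ y, (G.logLik (cols P.X P.S0) y θ - G.logLik (cols P.X P.S0) y 0) ∂(P.truth G) with hf
  set g : (Fin n → ℝ) → ℝ := fun η =>
    ∑ i, ((∫ y, y ∂(G.law ((P.X *ᵥ P.θ0) i))) * η i - G.b (η i)) with hg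
  have hfg : ∀ θ, f θ = g (cols P.X P.S0 *ᵥ θ) + n * G.b 0 := fun θ =>
    G.integral_logLik_sub _ _ θ
  have hmax : IsArgmax f P.trueRestrict := by
    intro z
    rw [hfg, hfg, P.cols_mulVec_trueRestrict]
    refine add_le_add_left (Finset.sum_le_sum fun i _ => ?_) _
    exact G.mean_mul_sub_le _ _
  have hbest : IsArgmax f (P.best G P.S0) := argmax_isArgmax ⟨_, hmax⟩
  have h1 := hbest P.trueRestrict
  have h2 := hmax (P.best G P.S0)
  have h3 := hmax ((1 / 2 : ℝ) • P.best G P.S0 + (1 / 2 : ℝ) • P.trueRestrict)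
  rw [hfg, hfg] at h1 h2 h3
  rw [P.cols_mulVec_trueRestrict] at h1 h2 h3
  rw [Matrix.mulVec_add, Matrix.mulVec_smul, Matrix.mulVec_smul,
    P.cols_mulVec_trueRestrict] at h3
  refine eq_of_isMax_of_strictConvex G (g := g) (fun η => rfl) ?_ ?_
  · linarith
  · linarith

lemma Problem.fisherBest_eq :
    P.fisherBest G P.S0 = G.fisher (cols P.X P.S0) P.trueRestrict :=
  G.fisher_congr (by rw [P.cols_mulVec_best, P.cols_mulVec_trueRestrict])

/-- Design regularity: `ζ` converts the Fisher norm into a uniform bound on the linear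
predictors. -/
lemma Problem.sq_cols_mulVec_le (S : Finset (Fin p)) (hF : (P.fisherBest G S).PosDef) (v : S → ℝ)
    (i : Fin n) : (cols P.X S *ᵥ v) i ^ 2 ≤ P.zeta G S ^ 2 * quad (P.fisherBest G S) v := by
  have h1 := sq_dotProduct_le_quad_inv_mul_quad hF (cols P.X S i) v
  have h2 : √(quad (P.fisherBest G S)⁻¹ (cols P.X S i)) ≤ P.zeta G S :=
    le_ciSup (f := fun i => √(quad (P.fisherBest G S)⁻¹ (cols P.X S i)))
      (Set.finite_range _).bddAbove i
  have h3 : 0 ≤ quad (P.fisherBest G S)⁻¹ (cols P.X S i) := quad_nonneg hF.inv.posSemidef _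
  have h4 : quad (P.fisherBest G S)⁻¹ (cols P.X S i) ≤ P.zeta G S ^ 2 := by
    rw [← Real.sq_sqrt h3]
    exact pow_le_pow_left₀ (Real.sqrt_nonneg _) h2 2
  exact h1.trans (mul_le_mul_of_nonneg_right h4 (quad_nonneg hF.posSemidef v))

end SubModel

/-! ### Uniqueness and measurability of the maximum likelihood estimator -/

section Measurability

variable {n : ℕ} {ι : Type*} [Fintype ι] (G : Family)

/-- One nonsingular information matrix already forces the design to have full column rank. -/
lemma Family.mulVec_injective_of_posDef {X : Matrix (Fin n) ι ℝ} {θ : ι → ℝ}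
    (h : (G.fisher X θ).PosDef) : Function.Injective (X *ᵥ ·) := by
  intro v w hvw
  by_contra hne
  have h1 := quad_pos h (sub_ne_zero.mpr hne)
  rw [G.quad_fisher, Matrix.mulVec_sub] at h1
  simp only at hvw
  rw [hvw] at h1
  simp at h1

lemma Family.isArgmax_unique {X : Matrix (Fin n) ι ℝ} (hX : Function.Injective (X *ᵥ ·))
    {y : Fin n → ℝ} {v w : ι → ℝ} (hv : IsArgmax (G.logLik X y) v)
    (hw : IsArgmax (G.logLik X y) w) : v = w := by
  rw [G.isArgmax_logLik_iff] at hv hw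
  refine hX (eq_of_isMax_of_strictConvex G (g := fun η => G.natLogLik y η) (m := y)
    (fun η => rfl) ?_ (le_antisymm (hw v) (hv w)))
  simp only
  rw [← Matrix.mulVec_smul, ← Matrix.mulVec_smul, ← Matrix.mulVec_add]
  exact hv _

/-- The responses for which a maximizer of the likelihood lies in a given closed set form a
`σ`-compact set, being the projection of a closed set. -/
lemma Family.measurableSet_exists_isArgmax (X : Matrix (Fin n) ι ℝ) {K : Set (ι → ℝ)}
    (hK : IsClosed K) : MeasurableSet {y | ∃ v ∈ K, IsArgmax (G.logLik X y) v} := by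
  set Z : Set ((Fin n → ℝ) × (ι → ℝ)) := {q | q.2 ∈ K ∧ IsArgmax (G.logLik X q.1) q.2} with hZ
  have hclosed : IsClosed Z := by
    have hset : Z = (Prod.snd ⁻¹' K) ∩ ⋂ z : ι → ℝ,
        {q | G.natLogLik q.1 (X *ᵥ z) ≤ G.natLogLik q.1 (X *ᵥ q.2)} := by
      ext q
      simp [hZ, G.isArgmax_logLik_iff]
    rw [hset]
    refine (hK.preimage continuous_snd).inter (isClosed_iInter fun z => isClosed_le ?_ ?_)
    · exact G.continuous_natLogLik.comp (continuous_fst.prodMk continuous_const)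
    · exact G.continuous_natLogLik.comp
        (continuous_fst.prodMk (Continuous.matrix_mulVec continuous_const continuous_snd))
  have himage : {y | ∃ v ∈ K, IsArgmax (G.logLik X y) v} = Prod.fst '' Z := by
    ext y
    simp [hZ]
  rw [himage]
  obtain ⟨A, hA, hAZ⟩ := (isSigmaCompact_univ.of_isClosed_subset hclosed
    (Set.subset_univ _)).image continuous_fst
  rw [← hAZ]
  exact MeasurableSet.iUnion fun i => (hA i).measurableSet

lemma Family.continuous_quad_fisher (X : Matrix (Fin n) ι ℝ) (x : ι → ℝ) :
    Continuous fun v => quad (G.fisher X v) x := by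
  simp_rw [G.quad_fisher]
  have := G.continuous_deriv2
  have h2 : Continuous fun v => X *ᵥ v := Continuous.matrix_mulVec continuous_const continuous_id
  refine continuous_finsetSum _ fun i _ => ?_
  exact (this.comp ((continuous_apply i).comp h2)).mul continuous_const

/-- Measurability is not automatic, since the estimator is chosen among the maximizers; it holds
because nonsingularity makes the maximizer unique, so that the event is a finite intersection of
projections of closed sets. -/
lemma Problem.measurableSet_mleEvent {p : ℕ} (P : Problem n p) (D : ℝ)
    (θbar : ∀ S : Finset (Fin p), S → ℝ)
    (hns : ∀ S : Finset (Fin p), S.card ≤ P.smax → (G.fisher (cols P.X S) (θbar S)).det ≠ 0) :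
    MeasurableSet (P.mleEvent G D θbar) := by
  have hset : P.mleEvent G D θbar = ⋂ S : Finset (Fin p), {y | S.card ≤ P.smax →
    (∃ v, IsArgmax (G.logLik (cols P.X S) y) v) ∧
    (G.fisher (cols P.X S) (P.mle G S y)
      - D⁻¹ • G.fisher (cols P.X S) (θbar S)).PosSemidef ∧
    (D • G.fisher (cols P.X S) (θbar S)
      - G.fisher (cols P.X S) (P.mle G S y)).PosSemidef ∧
    quad (G.fisher (cols P.X S) (θbar S)) (P.mle G S y - θbar S) ≤ D * S.card * Real.log p} := by
    ext y; simp [Problem.mleEvent]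
  rw [hset]
  refine MeasurableSet.iInter fun S => ?_
  by_cases hS : S.card ≤ P.smax
  swap
  · simp [hS]
  simp only [hS, true_imp_iff]
  set X := cols P.X S
  set F := G.fisher X (θbar S)
  have hinj := G.mulVec_injective_of_posDef
    (posDef_of_det_ne_zero (G.fisher_posSemidef X (θbar S)) (hns S hS))
  set K : Set (S → ℝ) := {v | (∀ x, D⁻¹ * quad F x ≤ quad (G.fisher X v) x) ∧
    (∀ x, quad (G.fisher X v) x ≤ D * quad F x) ∧
    quad F (v - θbar S) ≤ D * S.card * Real.log p} with hK
  have hKc : IsClosed K := by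
    have : K = (⋂ x, {v | D⁻¹ * quad F x ≤ quad (G.fisher X v) x}) ∩
        ((⋂ x, {v | quad (G.fisher X v) x ≤ D * quad F x}) ∩
          {v | quad F (v - θbar S) ≤ D * S.card * Real.log p}) := by
      ext v; simp [hK]
    rw [this]
    refine (isClosed_iInter fun x => isClosed_le continuous_const
      (G.continuous_quad_fisher X x)).inter ((isClosed_iInter fun x => isClosed_le
      (G.continuous_quad_fisher X x) continuous_const).inter
      (isClosed_le ((continuous_quad F).comp (continuous_id.sub continuous_const))
        continuous_const))
  have hmem : ∀ v, v ∈ K ↔ (G.fisher X v - D⁻¹ • F).PosSemidef ∧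
      (D • F - G.fisher X v).PosSemidef ∧
      quad F (v - θbar S) ≤ D * S.card * Real.log p := by
    intro v
    have hF : F.IsHermitian := G.fisher_isHermitian _ _
    have hs : ∀ c : ℝ, (c • F).IsHermitian := fun c => by
      rw [Matrix.IsHermitian, Matrix.conjTranspose_smul, hF.eq, star_trivial]
    rw [posSemidef_sub_iff (G.fisher_isHermitian X v) (hs _),
      posSemidef_sub_iff (hs _) (G.fisher_isHermitian X v)]
    simp only [hK, Set.mem_ofPred_eq, quad_smul]
  convert G.measurableSet_exists_isArgmax X hKc using 1
  ext y
  simp only [Set.mem_ofPred_eq]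
  constructor
  · rintro ⟨hex, h⟩
    exact ⟨P.mle G S y, (hmem _).mpr h, argmax_isArgmax hex⟩
  · rintro ⟨v, hvK, hv⟩
    have : P.mle G S y = v := G.isArgmax_unique hinj (argmax_isArgmax ⟨v, hv⟩) hv
    rw [this]
    exact ⟨⟨v, hv⟩, (hmem v).mp hvK⟩

end Measurability

/-! ### Localization of the maximum likelihood estimator in a correctly specified model -/

section Localization

variable {n : ℕ} {ι : Type*} [Fintype ι] (G : Family)

/-- Local stability of `b''` with constant `c`. -/
def Family.IsStable (c : ℝ) : Prop :=
  1 ≤ c ∧ ∀ x y : ℝ, |y| ≤ 1 / 2 → iteratedDeriv 2 G.b (x + y) ≤ c * iteratedDeriv 2 G.b x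

variable {G}

lemma Family.IsStable.pos {c : ℝ} (h : G.IsStable c) : 0 < c := lt_of_lt_of_le one_pos h.1

lemma Family.IsStable.le_mul {c : ℝ} (h : G.IsStable c) {x z : ℝ} (hxz : |z - x| ≤ 1 / 2) :
    iteratedDeriv 2 G.b z ≤ c * iteratedDeriv 2 G.b x := by
  have := h.2 x (z - x) hxz
  rwa [add_sub_cancel] at this

lemma Family.IsStable.quad_fisher_le {c : ℝ} (h : G.IsStable c) {X : Matrix (Fin n) ι ℝ}
    {θ θ' : ι → ℝ} (hθ : ∀ i, |(X *ᵥ (θ' - θ)) i| ≤ 1 / 2) (v : ι → ℝ) :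
    quad (G.fisher X θ) v ≤ c * quad (G.fisher X θ') v := by
  rw [G.quad_fisher, G.quad_fisher, Finset.mul_sum]
  refine Finset.sum_le_sum fun i _ => ?_
  rw [← mul_assoc]
  refine mul_le_mul_of_nonneg_right (h.le_mul ?_) (sq_nonneg _)
  have := hθ i
  rw [Matrix.mulVec_sub, Pi.sub_apply, abs_sub_comm] at this
  exact this

lemma Family.natLogLik_le_of_combo (G : Family) {y η δ : Fin n → ℝ} {t : ℝ} (ht0 : 0 ≤ t)
    (ht1 : t ≤ 1)
    (h : G.natLogLik y η ≤ G.natLogLik y (η + δ)) :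
    G.natLogLik y η ≤ G.natLogLik y (η + t • δ) := by
  rw [G.natLogLik_combo]
  have : 0 ≤ ∑ i, G.jensenGap t (η i) (η i + δ i) :=
    Finset.sum_nonneg fun i _ => G.jensenGap_nonneg ht0 ht1 _ _
  nlinarith

variable [DecidableEq ι]

variable (G) in
/-- Likelihood ratio of the mixture over a Gaussian neighbourhood of `θ0` (with precision
`ρ F_{θ0}`) against `θ0`. -/
noncomputable def Family.mixtureRatio (X : Matrix (Fin n) ι ℝ) (θ0 : ι → ℝ) (ρ : ℝ)
    (y : Fin n → ℝ) : ENNReal :=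
  ∫⁻ v, ENNReal.ofReal (gaussianDensity 0 (ρ • G.fisher X θ0) v *
    Real.exp (G.natLogLik y (X *ᵥ (θ0 + v)) - G.natLogLik y (X *ᵥ θ0)))

lemma Family.measurable_mixtureRatio_integrand (X : Matrix (Fin n) ι ℝ) (θ0 : ι → ℝ) (ρ : ℝ) :
    Measurable fun q : (Fin n → ℝ) × (ι → ℝ) =>
      ENNReal.ofReal (gaussianDensity 0 (ρ • G.fisher X θ0) q.2 *
      Real.exp (G.natLogLik q.1 (X *ᵥ (θ0 + q.2)) - G.natLogLik q.1 (X *ᵥ θ0))) := by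
  refine ENNReal.measurable_ofReal.comp (Continuous.measurable ?_)
  refine ((continuous_gaussianDensity _ _).comp continuous_snd).mul (Real.continuous_exp.comp ?_)
  refine Continuous.sub ?_ ?_
  · exact G.continuous_natLogLik.comp (continuous_fst.prodMk
      (Continuous.matrix_mulVec continuous_const (continuous_const.add continuous_snd)))
  · exact G.continuous_natLogLik.comp (continuous_fst.prodMk continuous_const)

lemma Family.measurable_mixtureRatio (X : Matrix (Fin n) ι ℝ) (θ0 : ι → ℝ) (ρ : ℝ) :
    Measurable (G.mixtureRatio X θ0 ρ) :=
  (G.measurable_mixtureRatio_integrand X θ0 ρ).lintegral_prod_right'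

/-- The mixture likelihood ratio has expectation one under `θ0`. -/
lemma Family.lintegral_mixtureRatio {X : Matrix (Fin n) ι ℝ} {θ0 : ι → ℝ} {ρ : ℝ} (hρ : 0 < ρ)
    (hF : (G.fisher X θ0).PosDef) :
    ∫⁻ y, G.mixtureRatio X θ0 ρ y ∂(Measure.pi fun i => G.law ((X *ᵥ θ0) i)) = 1 := by
  unfold Family.mixtureRatio
  rw [lintegral_lintegral_swap (G.measurable_mixtureRatio_integrand X θ0 ρ).aemeasurable,
    ← lintegral_gaussianDensity (hF.smul hρ) 0]
  refine lintegral_congr fun v => ?_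
  simp_rw [ENNReal.ofReal_mul (gaussianDensity_nonneg _ _ _)]
  rw [lintegral_const_mul' _ _ ENNReal.ofReal_ne_top]
  have := G.lintegral_exp_natLogLik 1 (X *ᵥ θ0) (X *ᵥ (θ0 + v))
  simp only [one_mul, G.jensenGap_one, Finset.sum_const_zero, neg_zero, Real.exp_zero,
    ENNReal.ofReal_one] at this
  rw [this, mul_one]

/-- If the maximum likelihood estimator were far from `θ0`, concavity would make the likelihood
exponentially large around the midpoint of a segment inside the region where the information is
stable, and so would be the mixture likelihood ratio. -/
lemma Family.quad_sub_le_of_isArgmax {c : ℝ} (hst : G.IsStable c) {X : Matrix (Fin n) ι ℝ}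
    {θ0 θh : ι → ℝ} (hF : (G.fisher X θ0).PosDef) {R ρ : ℝ} (hR : 0 < R) (hρ : ρ = 1 / (2 * c))
    (hreg : ∀ v, quad (G.fisher X θ0) v ≤ R → ∀ i, |(X *ᵥ v) i| ≤ 1 / 2)
    {y : Fin n → ℝ} (hmax : IsArgmax (G.logLik X y) θh)
    (hT : √2 ^ Fintype.card ι * Real.exp (-((ρ + c) * (R / 4)) / 4) ≤ 1 / 2)
    (hZ : G.mixtureRatio X θ0 ρ y <
      ENNReal.ofReal (Real.exp (R / (16 * c)) * (1 / 2 * √(ρ / (ρ + c)) ^ Fintype.card ι))) :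
    quad (G.fisher X θ0) (θh - θ0) ≤ R := by
  by_contra hfar
  push Not at hfar
  refine absurd hZ (not_lt.mpr ?_)
  have hc := hst.pos
  have hρ0 : 0 < ρ := by rw [hρ]; positivity
  set F := G.fisher X θ0 with hFdef
  set q := quad F (θh - θ0) with hq
  have hq0 : 0 < q := hR.trans hfar
  set t := √(R / q) with ht
  have ht2 : t ^ 2 = R / q := Real.sq_sqrt (by positivity)
  have ht0 : 0 ≤ t := Real.sqrt_nonneg _
  have ht1 : t ≤ 1 := Real.sqrt_le_one.mpr ((div_le_one hq0).mpr hfar.le)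
  set u := t • (θh - θ0) with hu
  have hqu : quad F u = R := by
    rw [hu, quad_smul_vec, ← hq, ht2, div_mul_cancel₀ _ hq0.ne']
  rw [G.isArgmax_logLik_iff] at hmax
  have hup : G.natLogLik y (X *ᵥ θ0) ≤ G.natLogLik y (X *ᵥ θ0 + X *ᵥ u) := by
    rw [hu, Matrix.mulVec_smul]
    refine G.natLogLik_le_of_combo ht0 ht1 ?_
    rw [← Matrix.mulVec_add, add_sub_cancel]
    exact hmax θ0
  have hmid : G.natLogLik y (X *ᵥ θ0) + R / (8 * c) ≤
      G.natLogLik y (X *ᵥ θ0 + (1 / 2 : ℝ) • (X *ᵥ u)) := by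
    rw [G.natLogLik_combo]
    have hgap : R / (8 * c) ≤ ∑ i, G.jensenGap (1 / 2) ((X *ᵥ θ0) i)
        ((X *ᵥ θ0) i + (X *ᵥ u) i) := by
      rw [← hqu, hFdef, G.quad_fisher, Finset.sum_div]
      refine Finset.sum_le_sum fun i _ => ?_
      have := G.le_jensenGap (a := 1 / 2) (by norm_num) (by norm_num) (x := (X *ᵥ θ0) i)
        (h := (X *ᵥ u) i) (m := iteratedDeriv 2 G.b ((X *ᵥ θ0) i) / c) fun z hz => by
          rw [div_le_iff₀' hc]
          refine hst.le_mul ?_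
          rw [abs_sub_comm]
          exact hz.trans (hreg u hqu.le i)
      refine le_trans (le_of_eq ?_) this
      field_simp
      norm_num
    linarith
  -- integrate over the ellipsoid of squared radius `R / 4` around the midpoint
  set U : Set (ι → ℝ) := {w | quad F w ≤ R / 4} with hU
  have hUm : MeasurableSet U := measurableSet_le (continuous_quad F).measurable measurable_const
  have hUreg : ∀ w ∈ U, ∀ i, |(X *ᵥ w) i| ≤ 1 / 4 := by
    intro w hw i
    have h1 : quad F ((2 : ℝ) • w) ≤ R := by
      rw [quad_smul_vec]
      have : quad F w ≤ R / 4 := hw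
      linarith
    have h2 := hreg _ h1 i
    rw [Matrix.mulVec_smul, Pi.smul_apply, smul_eq_mul, abs_mul, abs_two] at h2
    linarith
  set K := √(ρ • F).det / (√(2 * Real.pi)) ^ Fintype.card ι with hK
  have hK0 : 0 ≤ K := by positivity
  set g : (ι → ℝ) → ℝ := fun w => -(ρ * quad F ((1 / 2 : ℝ) • u + w)) / 2 +
    (G.natLogLik y (X *ᵥ (θ0 + ((1 / 2 : ℝ) • u + w))) - G.natLogLik y (X *ᵥ θ0)) with hg
  set h : (ι → ℝ) → ℝ := fun w => R / (16 * c) - (ρ + c) * quad F w / 2 with hh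
  have hgm : Measurable g := by
    refine Continuous.measurable ?_
    have h1 : Continuous fun w => X *ᵥ (θ0 + ((1 / 2 : ℝ) • u + w)) :=
      Continuous.matrix_mulVec continuous_const (by fun_prop)
    have h2 : Continuous fun w => quad F ((1 / 2 : ℝ) • u + w) :=
      (continuous_quad F).comp (by fun_prop)
    have h3 : Continuous fun w => G.natLogLik y (X *ᵥ (θ0 + ((1 / 2 : ℝ) • u + w))) :=
      G.continuous_natLogLik.comp (continuous_const.prodMk h1)
    fun_prop
  have hkey : ∀ w ∈ U, 2 * h w ≤ g w + g (-w) := by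
    intro w hw
    have h1 := quad_add_add_quad_sub F ((1 / 2 : ℝ) • u) w
    rw [quad_smul_vec, hqu] at h1
    have h2 := G.natLogLik_symm (M := fun i => c * iteratedDeriv 2 G.b ((X *ᵥ θ0) i)) y
      (η := X *ᵥ θ0 + (1 / 2 : ℝ) • (X *ᵥ u)) (δ := X *ᵥ w) fun i x hx => by
        refine hst.le_mul ?_
        have a1 := hUreg w hw i
        have a2 := hreg u hqu.le i
        replace hx := hx.trans a1
        simp only [Pi.add_apply, Pi.smul_apply, smul_eq_mul] at hx
        rw [abs_le] at hx a2 ⊢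
        constructor <;> linarith [hx.1, hx.2, a2.1, a2.2]
    have h3 : ∑ i, c * iteratedDeriv 2 G.b ((X *ᵥ θ0) i) * (X *ᵥ w) i ^ 2 = c * quad F w := by
      rw [hFdef, G.quad_fisher, Finset.mul_sum]
      exact Finset.sum_congr rfl fun i _ => by ring
    rw [h3] at h2
    have e1 : X *ᵥ (θ0 + ((1 / 2 : ℝ) • u + w)) =
        X *ᵥ θ0 + (1 / 2 : ℝ) • (X *ᵥ u) + X *ᵥ w := by
      rw [Matrix.mulVec_add, Matrix.mulVec_add, Matrix.mulVec_smul, add_assoc]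
    have e2 : X *ᵥ (θ0 + ((1 / 2 : ℝ) • u + -w)) =
        X *ᵥ θ0 + (1 / 2 : ℝ) • (X *ᵥ u) - X *ᵥ w := by
      rw [Matrix.mulVec_add, Matrix.mulVec_add, Matrix.mulVec_smul, Matrix.mulVec_neg, ← add_assoc,
        sub_eq_add_neg]
    simp only [hg, hh, e1, e2]
    have e3 : ρ * R = R / (2 * c) := by rw [hρ]; ring
    have e4 : R / (8 * c) = R / (2 * c) / 4 := by field_simp; norm_num
    have e5 : R / (16 * c) = R / (2 * c) / 8 := by field_simp; norm_num
    rw [← sub_eq_add_neg ((1 / 2 : ℝ) • u) w]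
    have e6 : ρ * quad F ((1 / 2 : ℝ) • u + w) + ρ * quad F ((1 / 2 : ℝ) • u - w) =
        R / (2 * c) / 2 + 2 * (ρ * quad F w) := by
      rw [← mul_add, h1, ← e3]; ring
    rw [e5]
    rw [e4] at hmid
    nlinarith
  have hsymm : ∀ w, w ∈ U → -w ∈ U := by
    intro w hw
    simpa [hU, quad_neg_vec] using hw
  have hint := setLIntegral_exp_le_of_even hUm hsymm hgm hkey
  have htr := le_setLIntegral_gaussianDensity_mul_exp hF hρ0 hc.le hT
  calc ENNReal.ofReal (Real.exp (R / (16 * c)) * (1 / 2 * √(ρ / (ρ + c)) ^ Fintype.card ι))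
      = ENNReal.ofReal (Real.exp (R / (16 * c))) *
        ENNReal.ofReal (1 / 2 * √(ρ / (ρ + c)) ^ Fintype.card ι) :=
        ENNReal.ofReal_mul (Real.exp_pos _).le
    _ ≤ ENNReal.ofReal (Real.exp (R / (16 * c))) * ∫⁻ w in U,
        ENNReal.ofReal (gaussianDensity 0 (ρ • F) w * Real.exp (-(c * quad F w) / 2)) := by
        gcongr
    _ = ENNReal.ofReal K * ∫⁻ w in U, ENNReal.ofReal (Real.exp (h w)) := by
        rw [← lintegral_const_mul' _ _ ENNReal.ofReal_ne_top,
          ← lintegral_const_mul' _ _ ENNReal.ofReal_ne_top]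
        refine lintegral_congr fun w => ?_
        rw [← ENNReal.ofReal_mul (Real.exp_pos _).le, ← ENNReal.ofReal_mul hK0]
        congr 1
        have e : h w = R / (16 * c) + (-(ρ * quad F w) / 2 + -(c * quad F w) / 2) := by
          simp only [hh]; ring
        rw [e, Real.exp_add, Real.exp_add]
        unfold gaussianDensity
        rw [sub_zero, quad_smul]
        ring
    _ ≤ ENNReal.ofReal K * ∫⁻ w in U, ENNReal.ofReal (Real.exp (g w)) := by gcongr
    _ ≤ ENNReal.ofReal K * ∫⁻ w, ENNReal.ofReal (Real.exp (g w)) := by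
        gcongr; exact Measure.restrict_le_self
    _ = ∫⁻ w, ENNReal.ofReal (gaussianDensity 0 (ρ • F) ((1 / 2 : ℝ) • u + w) *
        Real.exp (G.natLogLik y (X *ᵥ (θ0 + ((1 / 2 : ℝ) • u + w))) -
          G.natLogLik y (X *ᵥ θ0))) := by
        rw [← lintegral_const_mul' _ _ ENNReal.ofReal_ne_top]
        refine lintegral_congr fun w => ?_
        rw [← ENNReal.ofReal_mul hK0]
        congr 1
        simp only [hg]
        rw [Real.exp_add]
        unfold gaussianDensity
        rw [sub_zero, quad_smul]
        ring
    _ = G.mixtureRatio X θ0 ρ y := by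
        rw [Family.mixtureRatio]
        exact lintegral_add_left_eq_self (fun v => ENNReal.ofReal
          (gaussianDensity 0 (ρ • F) v *
          Real.exp (G.natLogLik y (X *ᵥ (θ0 + v)) - G.natLogLik y (X *ᵥ θ0)))) _

/-! ### Lower bound for the evidence of the true model -/

/-- Lower bound for the fractional evidence of a model against a parameter `θ0` that is close to
the maximum likelihood estimator.  Averaging over `θh ± w` removes the gradient at `θh`. -/
lemma Family.le_lintegral_exp_mul_gaussianDensity {c : ℝ} (hst : G.IsStable c)
    {X : Matrix (Fin n) ι ℝ} {θ0 θh : ι → ℝ} (hF : (G.fisher X θh).PosDef) {R T a lam : ℝ}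
    (hclose : quad (G.fisher X θ0) (θh - θ0) ≤ R) (hTR : c * T ≤ R)
    (hreg : ∀ v, quad (G.fisher X θ0) v ≤ R → ∀ i, |(X *ᵥ v) i| ≤ 1 / 2)
    {y : Fin n → ℝ} (hmax : IsArgmax (G.logLik X y) θh) (ha : 0 ≤ a) (hlam : 0 < lam)
    (hT : √2 ^ Fintype.card ι * Real.exp (-((lam + a * c) * T) / 4) ≤ 1 / 2) :
    ENNReal.ofReal (1 / 2 * √(lam / (lam + a * c)) ^ Fintype.card ι) ≤
      ∫⁻ v, ENNReal.ofReal (Real.exp (a * (G.natLogLik y (X *ᵥ v) - G.natLogLik y (X *ᵥ θ0))) *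
        gaussianDensity θh (lam • G.fisher X θh) v) := by
  have hc := hst.pos
  set F := G.fisher X θh with hFdef
  rw [G.isArgmax_logLik_iff] at hmax
  have hcomp : ∀ w, quad (G.fisher X θ0) w ≤ c * quad F w :=
    hst.quad_fisher_le (hreg _ hclose)
  set U : Set (ι → ℝ) := {w | quad F w ≤ T} with hU
  have hUm : MeasurableSet U := measurableSet_le (continuous_quad F).measurable measurable_const
  have hUreg : ∀ w ∈ U, ∀ i, |(X *ᵥ w) i| ≤ 1 / 2 := by
    intro w hw
    refine hreg w ((hcomp w).trans (le_trans ?_ hTR))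
    exact mul_le_mul_of_nonneg_left hw hc.le
  set K := √(lam • F).det / (√(2 * Real.pi)) ^ Fintype.card ι with hK
  have hK0 : 0 ≤ K := by positivity
  set g : (ι → ℝ) → ℝ := fun w => -(lam * quad F w) / 2 +
    a * (G.natLogLik y (X *ᵥ (w + θh)) - G.natLogLik y (X *ᵥ θ0)) with hg
  set h : (ι → ℝ) → ℝ := fun w => -(lam * quad F w) / 2 + -(a * c * quad F w) / 2 with hh
  have hgm : Measurable g := by
    refine Continuous.measurable ?_
    have h1 : Continuous fun w => X *ᵥ (w + θh) :=
      Continuous.matrix_mulVec continuous_const (by fun_prop)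
    have h2 : Continuous fun w => quad F w := continuous_quad F
    have h3 : Continuous fun w => G.natLogLik y (X *ᵥ (w + θh)) :=
      G.continuous_natLogLik.comp (continuous_const.prodMk h1)
    fun_prop
  have hkey : ∀ w ∈ U, 2 * h w ≤ g w + g (-w) := by
    intro w hw
    have h2 := G.natLogLik_symm (M := fun i => c * iteratedDeriv 2 G.b ((X *ᵥ θh) i)) y
      (η := X *ᵥ θh) (δ := X *ᵥ w) fun i x hx => hst.le_mul (hx.trans (hUreg w hw i))
    have h3 : ∑ i, c * iteratedDeriv 2 G.b ((X *ᵥ θh) i) * (X *ᵥ w) i ^ 2 = c * quad F w := by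
      rw [hFdef, G.quad_fisher, Finset.mul_sum]
      exact Finset.sum_congr rfl fun i _ => by ring
    rw [h3] at h2
    have e1 : X *ᵥ (w + θh) = X *ᵥ θh + X *ᵥ w := by rw [Matrix.mulVec_add, add_comm]
    have e2 : X *ᵥ (-w + θh) = X *ᵥ θh - X *ᵥ w := by
      rw [Matrix.mulVec_add, Matrix.mulVec_neg, add_comm, sub_eq_add_neg]
    simp only [hg, hh, e1, e2, quad_neg_vec]
    have h4 := hmax θ0
    nlinarith
  have hsymm : ∀ w, w ∈ U → -w ∈ U := by
    intro w hw
    simpa [hU, quad_neg_vec] using hw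
  have hint := setLIntegral_exp_le_of_even hUm hsymm hgm hkey
  have htr := le_setLIntegral_gaussianDensity_mul_exp hF hlam (mul_nonneg ha hc.le) hT
  refine htr.trans ?_
  calc ∫⁻ w in U, ENNReal.ofReal (gaussianDensity 0 (lam • F) w *
        Real.exp (-(a * c * quad F w) / 2))
      = ENNReal.ofReal K * ∫⁻ w in U, ENNReal.ofReal (Real.exp (h w)) := by
        rw [← lintegral_const_mul' _ _ ENNReal.ofReal_ne_top]
        refine lintegral_congr fun w => ?_
        rw [← ENNReal.ofReal_mul hK0]
        congr 1
        simp only [hh]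
        rw [Real.exp_add]
        unfold gaussianDensity
        rw [sub_zero, quad_smul]
        ring
    _ ≤ ENNReal.ofReal K * ∫⁻ w in U, ENNReal.ofReal (Real.exp (g w)) := by gcongr
    _ ≤ ENNReal.ofReal K * ∫⁻ w, ENNReal.ofReal (Real.exp (g w)) := by
        gcongr; exact Measure.restrict_le_self
    _ = ∫⁻ w, ENNReal.ofReal (Real.exp (a * (G.natLogLik y (X *ᵥ (w + θh)) -
          G.natLogLik y (X *ᵥ θ0))) * gaussianDensity θh (lam • F) (w + θh)) := by
        rw [← lintegral_const_mul' _ _ ENNReal.ofReal_ne_top]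
        refine lintegral_congr fun w => ?_
        rw [← ENNReal.ofReal_mul hK0]
        congr 1
        simp only [hg]
        rw [Real.exp_add]
        unfold gaussianDensity
        rw [add_sub_cancel_right, quad_smul]
        ring
    _ = _ := lintegral_add_right_eq_self (fun v => ENNReal.ofReal
          (Real.exp (a * (G.natLogLik y (X *ᵥ v) - G.natLogLik y (X *ᵥ θ0))) *
          gaussianDensity θh (lam • F) v)) _

end Localization

/-! ### Replacing the random slab by a deterministic one -/

section Slab

variable {ι : Type*} [Fintype ι] [DecidableEq ι]

/-- A Gaussian density with random centre and precision is dominated by a flatter one with fixed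
centre and precision, up to a factor that is exponential in the dimension. -/
lemma gaussianDensity_le_of_comparable {Fh F : Matrix ι ι ℝ} {m mb : ι → ℝ} {D lam r : ℝ}
    (hFh : Fh.PosDef) (hF : F.PosDef) (hD : 0 < D) (hlam : 0 < lam)
    (hlow : ∀ v, D⁻¹ * quad F v ≤ quad Fh v) (hup : ∀ v, quad Fh v ≤ D * quad F v)
    (hm : quad F (m - mb) ≤ D * r) (v : ι → ℝ) :
    gaussianDensity m (lam • Fh) v ≤
      (√2 * D) ^ Fintype.card ι * Real.exp (lam * r / 2) *
        gaussianDensity mb ((lam / (2 * D)) • F) v := by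
  set k := Fintype.card ι with hk
  have hdet : (lam • Fh).det ≤ (lam • D • F).det := by
    refine det_le_det_of_quad_le (hFh.smul hlam) ((hF.smul hD).smul hlam) fun w => ?_
    simp only [quad_smul]
    exact mul_le_mul_of_nonneg_left (hup w) hlam.le
  have hdet2 : √(lam • Fh).det ≤ (√2 * D) ^ k * √((lam / (2 * D)) • F).det := by
    refine (Real.sqrt_le_sqrt hdet).trans (le_of_eq ?_)
    have e : lam • D • F = (2 * D ^ 2) • ((lam / (2 * D)) • F) := by
      rw [smul_smul, smul_smul]
      congr 1
      field_simp
    rw [e, Matrix.det_smul, Real.sqrt_mul (by positivity), sqrt_pow_nat (by positivity),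
      Real.sqrt_mul (by norm_num), Real.sqrt_sq hD.le]
  have hexp : -(quad (lam • Fh) (v - m)) / 2 ≤
      lam * r / 2 + -(quad ((lam / (2 * D)) • F) (v - mb)) / 2 := by
    simp only [quad_smul]
    have h1 := quad_add_add_quad_sub F (v - m) (m - mb)
    have h2 := quad_nonneg hF.posSemidef (v - m - (m - mb))
    have h3 : v - m + (m - mb) = v - mb := by abel
    rw [h3] at h1
    have h4 := hlow (v - m)
    have h5 : D * (D⁻¹ * quad F (v - m)) = quad F (v - m) := by field_simp
    have h6 : quad F (v - mb) ≤ 2 * (D * quad Fh (v - m)) + 2 * (D * r) := by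
      have := mul_le_mul_of_nonneg_left h4 hD.le
      linarith
    have h7 : lam / (2 * D) * quad F (v - mb) ≤
        lam / (2 * D) * (2 * (D * quad Fh (v - m)) + 2 * (D * r)) := by gcongr
    have h8 : lam / (2 * D) * (2 * (D * quad Fh (v - m)) + 2 * (D * r)) =
        lam * quad Fh (v - m) + lam * r := by field_simp
    linarith
  unfold gaussianDensity
  have hpi : 0 < √(2 * Real.pi) ^ k := by positivity
  calc √(lam • Fh).det / √(2 * Real.pi) ^ k * Real.exp (-(quad (lam • Fh) (v - m)) / 2)
      ≤ ((√2 * D) ^ k * √((lam / (2 * D)) • F).det) / √(2 * Real.pi) ^ k *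
        Real.exp (lam * r / 2 + -(quad ((lam / (2 * D)) • F) (v - mb)) / 2) := by
        gcongr
    _ = _ := by rw [Real.exp_add]; ring

end Slab

/-! ### The posterior as a ratio of evidences -/

section Posterior

variable {n p : ℕ} (P : Problem n p) (G : Family)

instance : IsProbabilityMeasure (P.truth G) := by
  unfold Problem.truth Family.jointLaw; infer_instance

/-- Likelihood ratio of `θ` against the truth, raised to the power `α`. -/
noncomputable def Problem.ratio (α : ℝ) (y : Fin n → ℝ) (θ : Fin p → ℝ) : ℝ :=
  Real.exp (α * (G.natLogLik y (P.X *ᵥ θ) - G.natLogLik y (P.X *ᵥ P.θ0)))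

lemma Problem.continuous_ratio (α : ℝ) :
    Continuous fun q : (Fin n → ℝ) × (Fin p → ℝ) => P.ratio G α q.1 q.2 := by
  unfold Problem.ratio
  refine Real.continuous_exp.comp (continuous_const.mul (Continuous.sub ?_ ?_))
  · exact G.continuous_natLogLik.comp (continuous_fst.prodMk
      (Continuous.matrix_mulVec continuous_const continuous_snd))
  · exact G.continuous_natLogLik.comp (continuous_fst.prodMk continuous_const)

lemma Problem.measurable_ratio_comp {Ω : Type*} [MeasurableSpace Ω] (α : ℝ) {f : Ω → Fin n → ℝ}
    {g : Ω → Fin p → ℝ} (hf : Measurable f) (hg : Measurable g) :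
    Measurable fun ω => P.ratio G α (f ω) (g ω) := by
  have h := (P.continuous_ratio G α).measurable.comp (hf.prodMk hg)
  simp only [Function.comp_def] at h
  exact h

lemma Problem.measurable_ratio (α : ℝ) (y : Fin n → ℝ) :
    Measurable fun θ => ENNReal.ofReal (P.ratio G α y θ) :=
  ENNReal.measurable_ofReal.comp
    ((P.continuous_ratio G α).comp (Continuous.prodMk_right y)).measurable

lemma Problem.posterior_eq (α : ℝ) (y : Fin n → ℝ) (A : Set (Fin p → ℝ)) :
    P.posterior G α y A =
      (∫⁻ θ in A, ENNReal.ofReal (P.ratio G α y θ) ∂(P.prior G y)) /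
        ∫⁻ θ, ENNReal.ofReal (P.ratio G α y θ) ∂(P.prior G y) := by
  set e := ENNReal.ofReal (Real.exp (α * G.logLik P.X y P.θ0)) with he
  have he0 : e ≠ 0 := by simp [he, Real.exp_pos]
  have het : e ≠ ⊤ := ENNReal.ofReal_ne_top
  have hfun : ∀ θ, ENNReal.ofReal (Real.exp (α * G.logLik P.X y θ)) =
      e * ENNReal.ofReal (P.ratio G α y θ) := by
    intro θ
    rw [he, ← ENNReal.ofReal_mul (Real.exp_pos _).le, Problem.ratio, ← Real.exp_add,
      G.logLik_eq, G.logLik_eq]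
    congr 2; ring
  unfold Problem.posterior
  simp_rw [hfun]
  rw [lintegral_const_mul' _ _ het, lintegral_const_mul' _ _ het, ENNReal.mul_div_mul_left _ _ he0 het]

lemma Problem.posterior_le_one (α : ℝ) (y : Fin n → ℝ) (A : Set (Fin p → ℝ)) :
    P.posterior G α y A ≤ 1 := by
  unfold Problem.posterior
  exact (ENNReal.div_le_div_right (setLIntegral_le_lintegral _ _) _).trans ENNReal.div_self_le_one

lemma Problem.measurable_slab (S : Finset (Fin p)) (y : Fin n → ℝ) :
    Measurable fun v => ENNReal.ofReal (P.slab G S y v) :=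
  ENNReal.measurable_ofReal.comp (continuous_gaussianDensity _ _).measurable

lemma Problem.lintegral_prior (y : Fin n → ℝ) {f : (Fin p → ℝ) → ENNReal} (hf : Measurable f) :
    ∫⁻ θ, f θ ∂(P.prior G y) =
      ∑ S : Finset (Fin p), ENNReal.ofReal (P.w S.card / (p.choose S.card : ℝ)) *
        ∫⁻ v, ENNReal.ofReal (P.slab G S y v) * f (zeroExtend S v) := by
  unfold Problem.prior
  rw [lintegral_finsetSum_measure]
  refine Finset.sum_congr rfl fun S _ => ?_
  rw [lintegral_smul_measure, lintegral_map hf (measurable_zeroExtend S),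
    lintegral_withDensity_eq_lintegral_mul _ (P.measurable_slab G S y)
      (show Measurable fun v => f (zeroExtend S v) from hf.comp (measurable_zeroExtend S))]
  rfl

end Posterior

/-! ### Non-asymptotic bound for the expected posterior mass -/

section NonAsymptotic

variable {n p : ℕ}

/-- The requirements at one fixed sample size under which the posterior is controlled: the
hypotheses on the maximum likelihood estimators, with numerical thresholds in place of limits.  The
threshold on `ζ` makes the linear predictors move by at most `1 / 2` within the Fisher ellipsoid of
squared radius `32 c s₀ log p`, a radius at which the gain `R / (16 c)` of the localization argument
equals `2 s₀ log p`. -/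
structure Problem.Regular (P : Problem n p) (G : Family) (c D α : ℝ)
    (θbar : ∀ S : Finset (Fin p), S → ℝ) : Prop where
  stable : G.IsStable c
  D_pos : 0 < D
  lam_pos : 0 < P.lam
  α_pos : 0 < α
  α_lt_one : α < 1
  θ0_ne_zero : P.θ0 ≠ 0
  s0_le : P.s0 ≤ P.smax
  w_nonneg : ∀ s, 0 ≤ P.w s
  w_eq_zero : ∀ s, P.smax < s → P.w s = 0
  w_pos : 0 < P.w P.s0
  nonsingular : ∀ S : Finset (Fin p), S.card ≤ P.smax →
    (G.fisher (cols P.X S) (θbar S)).det ≠ 0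
  mle_close : 1 - (p : ℝ)⁻¹ ≤ (P.truth G).real (P.mleEvent G D θbar)
  nonsingular_S0 : (P.fisherBest G P.S0).det ≠ 0
  zeta_le : P.zeta G P.S0 ^ 2 * P.s0 * Real.log p ≤ 1 / (128 * c)
  log_ge : 1 ≤ α * Real.log p
  p_ge : 2 * √(1 + 2 * c ^ 2) ≤ p

/-- Lower bound for the evidence under the empirical prior, on the good event. -/
noncomputable def Problem.evidenceBound (P : Problem n p) (c α : ℝ) : ℝ :=
  P.w P.s0 / (p.choose P.s0 : ℝ) * (1 / 2 * √(P.lam / (P.lam + α * c)) ^ P.s0)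

/-- Threshold of the mixture likelihood ratio on the good event. -/
noncomputable def Problem.mixtureThreshold (P : Problem n p) (c : ℝ) : ℝ :=
  Real.exp (2 * P.s0 * Real.log p) * (1 / 2 * √(1 / (2 * c) / (1 / (2 * c) + c)) ^ P.s0)

/-- Factor by which replacing the random slab on a model of size `s` by a deterministic one inflates
its density is the `s`-th power of this number. -/
noncomputable def Problem.inflation (P : Problem n p) (D : ℝ) : ℝ :=
  √2 * D * Real.exp (P.lam * Real.log p / 2)

namespace Problem.Regular

variable {P : Problem n p} {G : Family} {c D α : ℝ} {θbar : ∀ S : Finset (Fin p), S → ℝ}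

lemma s0_pos (h : P.Regular G c D α θbar) : 1 ≤ P.s0 := by
  rw [Nat.one_le_iff_ne_zero]
  intro h0
  apply h.θ0_ne_zero
  have : P.S0 = ∅ := Finset.card_eq_zero.mp h0
  ext j
  by_contra hj
  have : j ∈ P.S0 := by simpa [Problem.S0, supp] using hj
  simp_all

lemma log_pos (h : P.Regular G c D α θbar) : 1 ≤ Real.log p := by
  have h1 := h.log_ge
  have h2 := h.α_lt_one
  have h3 := h.α_pos
  by_contra hlt
  push Not at hlt
  nlinarith

lemma p_pos (h : P.Regular G c D α θbar) : (0 : ℝ) < p := by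
  have h1 := h.log_pos
  rcases (Nat.cast_nonneg (α := ℝ) p).lt_or_eq with h2 | h2
  · exact h2
  · rw [← h2, Real.log_zero] at h1; linarith

lemma posDef_bar (h : P.Regular G c D α θbar) {S : Finset (Fin p)} (hS : S.card ≤ P.smax) :
    (G.fisher (cols P.X S) (θbar S)).PosDef :=
  posDef_of_det_ne_zero (G.fisher_posSemidef _ _) (h.nonsingular S hS)

lemma posDef_S0 (h : P.Regular G c D α θbar) :
    (G.fisher (cols P.X P.S0) P.trueRestrict).PosDef := by
  refine posDef_of_det_ne_zero (G.fisher_posSemidef _ _) ?_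
  rw [← P.fisherBest_eq G]
  exact h.nonsingular_S0

lemma linearPredictor_le (h : P.Regular G c D α θbar) (v : P.S0 → ℝ)
    (hv : quad (G.fisher (cols P.X P.S0) P.trueRestrict) v ≤ 32 * c * P.s0 * Real.log p)
    (i : Fin n) : |(cols P.X P.S0 *ᵥ v) i| ≤ 1 / 2 := by
  have hF := h.posDef_S0
  rw [← P.fisherBest_eq G] at hv hF
  have h1 := P.sq_cols_mulVec_le G P.S0 hF v i
  have h2 : P.zeta G P.S0 ^ 2 * quad (P.fisherBest G P.S0) v ≤ (1 / 2) ^ 2 := by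
    have hc := h.stable.pos
    calc P.zeta G P.S0 ^ 2 * quad (P.fisherBest G P.S0) v
        ≤ P.zeta G P.S0 ^ 2 * (32 * c * P.s0 * Real.log p) := by gcongr
      _ = 32 * c * (P.zeta G P.S0 ^ 2 * P.s0 * Real.log p) := by ring
      _ ≤ 32 * c * (1 / (128 * c)) := by gcongr; exact h.zeta_le
      _ = (1 / 2) ^ 2 := by field_simp; norm_num
  exact abs_le_of_sq_le_sq (h1.trans h2) (by norm_num)

lemma sqrt_two_pow_mul_exp_le (h : P.Regular G c D α θbar) {x : ℝ}
    (hx : 2 * P.s0 ≤ x) : √2 ^ P.s0 * Real.exp (-x) ≤ 1 / 2 := by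
  have h1 : Real.exp (-x) ≤ Real.exp (-2) ^ P.s0 := by
    rw [← Real.exp_nat_mul]
    exact Real.exp_le_exp.mpr (by linarith)
  have h2 : √2 * Real.exp (-2) ≤ 1 / 2 := by
    have a1 : √2 ≤ 3 / 2 := by
      rw [Real.sqrt_le_left (by norm_num)]; norm_num
    have a2 : (3 : ℝ) ≤ Real.exp 2 := by
      have := Real.add_one_le_exp (2 : ℝ); linarith
    rw [Real.exp_neg, ← div_eq_mul_inv, div_le_iff₀ (Real.exp_pos _)]
    linarith
  calc √2 ^ P.s0 * Real.exp (-x) ≤ √2 ^ P.s0 * Real.exp (-2) ^ P.s0 := by gcongr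
    _ = (√2 * Real.exp (-2)) ^ P.s0 := (mul_pow _ _ _).symm
    _ ≤ √2 * Real.exp (-2) := pow_le_of_le_one (by positivity) (h2.trans (by norm_num))
        (Nat.one_le_iff_ne_zero.mp h.s0_pos)
    _ ≤ 1 / 2 := h2

/-- On the good event the maximum likelihood estimator of the true model lies in the ellipsoid in
which the information is stable. -/
lemma quad_mle_sub_le (h : P.Regular G c D α θbar) {y : Fin n → ℝ}
    (hy : y ∈ P.mleEvent G D θbar)
    (hZ : G.mixtureRatio (cols P.X P.S0) P.trueRestrict (1 / (2 * c)) y <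
      ENNReal.ofReal (P.mixtureThreshold c)) :
    quad (G.fisher (cols P.X P.S0) P.trueRestrict) (P.mle G P.S0 y - P.trueRestrict) ≤
      32 * c * P.s0 * Real.log p := by
  have hc := h.stable.pos
  have hc1 := h.stable.1
  have hs : (1 : ℝ) ≤ P.s0 := by exact_mod_cast h.s0_pos
  have hL := h.log_pos
  have hcard : Fintype.card P.S0 = P.s0 := Fintype.card_coe _
  refine Family.quad_sub_le_of_isArgmax h.stable h.posDef_S0 (ρ := 1 / (2 * c)) (by positivity) rfl
    h.linearPredictor_le (argmax_isArgmax (hy P.S0 h.s0_le).1) ?_ ?_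
  · rw [hcard]
    have hexp : -((1 / (2 * c) + c) * (32 * c * P.s0 * Real.log p / 4)) / 4 =
        -((1 + 2 * c ^ 2) * (P.s0 * Real.log p)) := by field_simp; ring
    rw [hexp]
    refine h.sqrt_two_pow_mul_exp_le ?_
    have h1 : (2 : ℝ) ≤ 1 + 2 * c ^ 2 := by nlinarith
    have h2 : (P.s0 : ℝ) ≤ P.s0 * Real.log p := le_mul_of_one_le_right (by linarith) hL
    nlinarith
  · rw [hcard]
    have hexp : 32 * c * P.s0 * Real.log p / (16 * c) = 2 * P.s0 * Real.log p := by
      field_simp; norm_num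
    rw [hexp]
    exact hZ

lemma evidenceBound_pos (h : P.Regular G c D α θbar) : 0 < P.evidenceBound c α := by
  have hchoose : (0 : ℝ) < p.choose P.s0 := by
    have : P.s0 ≤ p := (Finset.card_le_univ P.S0).trans_eq (Fintype.card_fin p)
    exact_mod_cast Nat.choose_pos this
  have h1 := h.w_pos
  have h2 := h.lam_pos
  have h3 := h.α_pos
  have h4 := h.stable.pos
  unfold Problem.evidenceBound
  positivity

lemma evidenceBound_le (h : P.Regular G c D α θbar) {y : Fin n → ℝ}
    (hy : y ∈ P.mleEvent G D θbar)
    (hZ : G.mixtureRatio (cols P.X P.S0) P.trueRestrict (1 / (2 * c)) y <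
      ENNReal.ofReal (P.mixtureThreshold c)) :
    ENNReal.ofReal (P.evidenceBound c α) ≤
      ∫⁻ θ, ENNReal.ofReal (P.ratio G α y θ) ∂(P.prior G y) := by
  have hc := h.stable.pos
  have hlam := h.lam_pos
  have hα := h.α_pos
  have hclose := h.quad_mle_sub_le hy hZ
  have hs : (1 : ℝ) ≤ P.s0 := by exact_mod_cast h.s0_pos
  have hL := h.log_pos
  have hcard : Fintype.card P.S0 = P.s0 := Fintype.card_coe _
  have hFh : (G.fisher (cols P.X P.S0) (P.mle G P.S0 y)).PosDef := by
    have hq := (hy P.S0 h.s0_le).2.1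
    have hpos := (h.posDef_bar h.s0_le).smul (inv_pos.mpr h.D_pos)
    have := hpos.add_posSemidef hq
    rwa [add_sub_cancel] at this
  have hev := Family.le_lintegral_exp_mul_gaussianDensity h.stable hFh
    (T := 32 * P.s0 * Real.log p) (a := α) (lam := P.lam) hclose
    (le_of_eq (by ring)) h.linearPredictor_le (argmax_isArgmax (hy P.S0 h.s0_le).1) hα.le hlam (by
      rw [hcard, neg_div]
      refine h.sqrt_two_pow_mul_exp_le ?_
      have h1 : 1 ≤ (P.lam + α * c) * Real.log p := by
        have := h.log_ge
        have h2 : α * Real.log p ≤ (P.lam + α * c) * Real.log p := by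
          gcongr
          nlinarith [h.stable.1]
        linarith
      nlinarith)
  rw [hcard] at hev
  rw [P.lintegral_prior G y (P.measurable_ratio G α y)]
  refine le_trans ?_ (Finset.single_le_sum (f := fun S : Finset (Fin p) =>
    ENNReal.ofReal (P.w S.card / (p.choose S.card : ℝ)) *
        ∫⁻ v, ENNReal.ofReal (P.slab G S y v) * ENNReal.ofReal (P.ratio G α y (zeroExtend S v)))
    (fun S _ => zero_le) (Finset.mem_univ P.S0))
  unfold Problem.evidenceBound
  rw [ENNReal.ofReal_mul (div_nonneg (h.w_nonneg _) (Nat.cast_nonneg _))]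
  refine mul_le_mul_right (hev.trans (le_of_eq (lintegral_congr fun v => ?_))) _
  rw [mul_comm (ENNReal.ofReal (P.slab G P.S0 y v)), ← ENNReal.ofReal_mul
    (show 0 ≤ P.ratio G α y (zeroExtend P.S0 v) from (Real.exp_pos _).le), Problem.ratio, cols_mulVec, cols_mulVec, P.zeroExtend_trueRestrict]
  rfl

/-- Upper bound for the numerator of the posterior mass of `A` on the good event: the random slabs
are replaced by the deterministic Gaussian densities that dominate them.  Unlike the numerator, it is
measurable in the responses, and Tonelli's theorem applies to it. -/
noncomputable def majorant (P : Problem n p) (G : Family) (D α : ℝ)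
    (θbar : ∀ S : Finset (Fin p), S → ℝ) (A : Set (Fin p → ℝ)) (y : Fin n → ℝ) : ENNReal :=
  ∑ S : Finset (Fin p), ENNReal.ofReal (P.w S.card / (p.choose S.card : ℝ)) *
    (ENNReal.ofReal (P.inflation D ^ S.card) *
      ∫⁻ v, ENNReal.ofReal (gaussianDensity (θbar S)
        ((P.lam / (2 * D)) • G.fisher (cols P.X S) (θbar S)) v) *
        A.indicator (fun θ => ENNReal.ofReal (P.ratio G α y θ)) (zeroExtend S v))

lemma measurable_majorant_integrand (A : Set (Fin p → ℝ)) (hA : MeasurableSet A)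
    (S : Finset (Fin p)) : Measurable fun q : (Fin n → ℝ) × (S → ℝ) =>
      ENNReal.ofReal (gaussianDensity (θbar S)
        ((P.lam / (2 * D)) • G.fisher (cols P.X S) (θbar S)) q.2) *
        A.indicator (fun θ => ENNReal.ofReal (P.ratio G α q.1 θ)) (zeroExtend S q.2) := by
  have hz : Measurable fun q : (Fin n → ℝ) × (S → ℝ) => zeroExtend S q.2 :=
    (measurable_zeroExtend S).comp measurable_snd
  have h0 : Measurable fun q : (Fin n → ℝ) × (S → ℝ) => gaussianDensity (θbar S)
      ((P.lam / (2 * D)) • G.fisher (cols P.X S) (θbar S)) q.2 :=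
    (continuous_gaussianDensity _ _).measurable.comp measurable_snd
  have h1 : Measurable fun q : (Fin n → ℝ) × (S → ℝ) => P.ratio G α q.1 (zeroExtend S q.2) :=
    P.measurable_ratio_comp G α measurable_fst hz
  have h2 : (fun q : (Fin n → ℝ) × (S → ℝ) =>
      A.indicator (fun θ => ENNReal.ofReal (P.ratio G α q.1 θ)) (zeroExtend S q.2)) =
      ((fun q : (Fin n → ℝ) × (S → ℝ) => zeroExtend S q.2) ⁻¹' A).indicator
        fun q => ENNReal.ofReal (P.ratio G α q.1 (zeroExtend S q.2)) := by
    ext q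
    rfl
  have h3 := h1.ennreal_ofReal.indicator (hz hA)
  rw [← h2] at h3
  exact h0.ennreal_ofReal.mul h3

lemma measurable_majorant (A : Set (Fin p → ℝ)) (hA : MeasurableSet A) :
    Measurable (majorant P G D α θbar A) := by
  unfold majorant
  refine Finset.measurable_sum _ fun S _ => Measurable.const_mul (Measurable.const_mul ?_ _) _
  exact (measurable_majorant_integrand A hA S).lintegral_prod_right'

lemma setLIntegral_le_majorant (h : P.Regular G c D α θbar) {y : Fin n → ℝ}
    (hy : y ∈ P.mleEvent G D θbar) {A : Set (Fin p → ℝ)} (hA : MeasurableSet A) :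
    ∫⁻ θ in A, ENNReal.ofReal (P.ratio G α y θ) ∂(P.prior G y) ≤
      majorant P G D α θbar A y := by
  rw [← lintegral_indicator hA, P.lintegral_prior G y ((P.measurable_ratio G α y).indicator hA)]
  refine Finset.sum_le_sum fun S _ => ?_
  by_cases hS : S.card ≤ P.smax
  swap
  · rw [h.w_eq_zero _ (not_le.mp hS)]
    simp
  refine mul_le_mul_right ?_ _
  rw [← lintegral_const_mul' _ _ ENNReal.ofReal_ne_top]
  refine lintegral_mono fun v => ?_
  simp only
  rw [← mul_assoc]
  refine mul_le_mul_left ?_ _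
  obtain ⟨hex, hlow, hup, hm⟩ := hy S hS
  have hF := h.posDef_bar hS
  have hFh : (G.fisher (cols P.X S) (P.mle G S y)).PosDef := by
    have := (hF.smul (inv_pos.mpr h.D_pos)).add_posSemidef hlow
    rwa [add_sub_cancel] at this
  have hinf : 0 ≤ P.inflation D := by
    have := h.D_pos
    unfold Problem.inflation; positivity
  rw [← ENNReal.ofReal_mul (pow_nonneg hinf _)]
  refine ENNReal.ofReal_le_ofReal ?_
  have key := gaussianDensity_le_of_comparable (r := S.card * Real.log p) hFh hF h.D_pos h.lam_pos
    (fun v => by simpa only [quad_smul] using quad_le_of_posSemidef_sub hlow v)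
    (fun v => by simpa only [quad_smul] using quad_le_of_posSemidef_sub hup v)
    (by rw [← mul_assoc]; exact hm) v
  rw [Fintype.card_coe] at key
  have e : P.inflation D ^ S.card =
      (√2 * D) ^ S.card * Real.exp (P.lam * (S.card * Real.log p) / 2) := by
    rw [Problem.inflation, mul_pow, ← Real.exp_nat_mul]
    congr 2; ring
  rw [e]
  exact key

variable (P G) in
/-- Sum over the observations of the Jensen gaps between the truth and `θ`. -/
noncomputable def totalGap (α : ℝ) (θ : Fin p → ℝ) : ℝ :=
  ∑ i, G.jensenGap α ((P.X *ᵥ P.θ0) i) ((P.X *ᵥ θ) i)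

lemma lintegral_ratio (α : ℝ) (θ : Fin p → ℝ) :
    ∫⁻ y, ENNReal.ofReal (P.ratio G α y θ) ∂(P.truth G) =
      ENNReal.ofReal (Real.exp (-totalGap P G α θ)) :=
  G.lintegral_exp_natLogLik α _ _

/-- The weights `1 / choose p s` of the models of size `s` add up to one, so the hypothesis leaves a
geometric series in `s`. -/
lemma lintegral_majorant_le (h : P.Regular G c D α θbar) {A : Set (Fin p → ℝ)}
    (hA : MeasurableSet A) {ε : ℝ} (hε : 0 ≤ ε)
    (hbound : ∀ S : Finset (Fin p), S.card ≤ P.smax → ∀ v, zeroExtend S v ∈ A →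
      P.w S.card * P.inflation D ^ S.card * Real.exp (-totalGap P G α (zeroExtend S v)) ≤
        ε * (1 / 2) ^ S.card) :
    ∫⁻ y, majorant P G D α θbar A y ∂(P.truth G) ≤ ENNReal.ofReal (2 * ε) := by
  have hD := h.D_pos
  have hinf : 0 ≤ P.inflation D := by unfold Problem.inflation; positivity
  have hterm : ∀ S : Finset (Fin p),
      ∫⁻ y, ENNReal.ofReal (P.w S.card / (p.choose S.card : ℝ)) *
        (ENNReal.ofReal (P.inflation D ^ S.card) *
        ∫⁻ v, ENNReal.ofReal (gaussianDensity (θbar S)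
        ((P.lam / (2 * D)) • G.fisher (cols P.X S) (θbar S)) v) *
        A.indicator (fun θ => ENNReal.ofReal (P.ratio G α y θ)) (zeroExtend S v)) ∂(P.truth G) ≤
      ENNReal.ofReal ((ε * (1 / 2) ^ S.card) / (p.choose S.card : ℝ)) := by
    intro S
    by_cases hS : S.card ≤ P.smax
    swap
    · rw [h.w_eq_zero _ (not_le.mp hS)]
      simp
    rw [lintegral_const_mul' _ _ ENNReal.ofReal_ne_top,
      lintegral_const_mul' _ _ ENNReal.ofReal_ne_top,
      lintegral_lintegral_swap (measurable_majorant_integrand A hA S).aemeasurable,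
      ← lintegral_const_mul' _ _ ENNReal.ofReal_ne_top,
      ← lintegral_const_mul' _ _ ENNReal.ofReal_ne_top]
    have hgd := lintegral_gaussianDensity ((h.posDef_bar hS).smul
      (show 0 < P.lam / (2 * D) from div_pos h.lam_pos (by positivity))) (θbar S)
    calc _ ≤ ∫⁻ v, ENNReal.ofReal ((ε * (1 / 2) ^ S.card) / (p.choose S.card : ℝ)) *
          ENNReal.ofReal (gaussianDensity (θbar S)
            ((P.lam / (2 * D)) • G.fisher (cols P.X S) (θbar S)) v) := by
          refine lintegral_mono fun v => ?_
          simp only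
          rw [lintegral_const_mul' _ _ ENNReal.ofReal_ne_top]
          by_cases hv : zeroExtend S v ∈ A
          · simp only [Set.indicator_of_mem hv]
            rw [lintegral_ratio]
            set g := ENNReal.ofReal (gaussianDensity (θbar S)
              ((P.lam / (2 * D)) • G.fisher (cols P.X S) (θbar S)) v)
            have hw : 0 ≤ P.w S.card / (p.choose S.card : ℝ) :=
              div_nonneg (h.w_nonneg _) (Nat.cast_nonneg _)
            calc _ = ENNReal.ofReal (P.w S.card / (p.choose S.card : ℝ)) *
                  ENNReal.ofReal (P.inflation D ^ S.card) *
                  ENNReal.ofReal (Real.exp (-totalGap P G α (zeroExtend S v))) * g := by ring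
              _ ≤ _ := by
                  refine mul_le_mul_left ?_ _
                  rw [← ENNReal.ofReal_mul hw,
                    ← ENNReal.ofReal_mul (mul_nonneg hw (pow_nonneg hinf _))]
                  refine ENNReal.ofReal_le_ofReal ?_
                  rw [div_mul_eq_mul_div, div_mul_eq_mul_div]
                  exact div_le_div_of_nonneg_right (hbound S hS v hv) (Nat.cast_nonneg _)
          · simp only [Set.indicator_of_notMem hv, lintegral_zero, mul_zero]
            exact zero_le
      _ = _ := by
          rw [lintegral_const_mul' _ _ ENNReal.ofReal_ne_top, hgd, mul_one]
  unfold majorant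
  rw [lintegral_finsetSum _ fun S _ => Measurable.const_mul (Measurable.const_mul
    (measurable_majorant_integrand A hA S).lintegral_prod_right' _) _]
  refine (Finset.sum_le_sum fun S _ => hterm S).trans ?_
  rw [← ENNReal.ofReal_sum_of_nonneg fun S _ => by positivity]
  refine ENNReal.ofReal_le_ofReal ?_
  have hsum := Finset.sum_powerset_apply_card
    (fun m => (ε * (1 / 2) ^ m) / (p.choose m : ℝ)) (x := (Finset.univ : Finset (Fin p)))
  rw [Finset.powerset_univ, Finset.card_univ, Fintype.card_fin] at hsum
  rw [hsum]
  calc ∑ m ∈ Finset.range (p + 1), p.choose m • ((ε * (1 / 2) ^ m) / (p.choose m : ℝ))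
      = ∑ m ∈ Finset.range (p + 1), ε * (1 / 2) ^ m := by
        refine Finset.sum_congr rfl fun m hm => ?_
        have : (p.choose m : ℝ) ≠ 0 := by
          exact_mod_cast (Nat.choose_pos (Nat.lt_succ_iff.mp (Finset.mem_range.mp hm))).ne'
        rw [nsmul_eq_mul]
        field_simp
    _ = ε * ∑ m ∈ Finset.range (p + 1), (1 / 2 : ℝ) ^ m := by rw [Finset.mul_sum]
    _ ≤ ε * 2 := by
        gcongr
        exact (Summable.sum_le_tsum _ (fun _ _ => by positivity)
          (summable_geometric_of_lt_one (by norm_num) (by norm_num))).trans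
          (le_of_eq (by rw [tsum_geometric_of_lt_one] <;> norm_num))
    _ = 2 * ε := mul_comm _ _

/-- By Markov's inequality, the mixture likelihood ratio thus stays below the threshold with
probability at least `1 - p ^ (-s₀)`. -/
lemma le_mixtureThreshold (h : P.Regular G c D α θbar) :
    (p : ℝ) ^ (P.s0 : ℝ) ≤ P.mixtureThreshold c := by
  have hc := h.stable.pos
  have hp := h.p_pos
  set r := √(1 + 2 * c ^ 2) with hr
  have hr0 : 0 < r := Real.sqrt_pos.mpr (by positivity)
  have e1 : √(1 / (2 * c) / (1 / (2 * c) + c)) = r⁻¹ := by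
    rw [hr, ← Real.sqrt_inv]
    congr 1
    field_simp
  have e2 : Real.exp (2 * P.s0 * Real.log p) = (p : ℝ) ^ P.s0 * (p : ℝ) ^ P.s0 := by
    rw [← Real.exp_log hp, ← Real.exp_nat_mul, ← Real.exp_add, Real.log_exp]
    congr 1; ring
  unfold Problem.mixtureThreshold
  rw [e1, e2, Real.rpow_natCast]
  have h1 : (2 * r) ^ P.s0 ≤ (p : ℝ) ^ P.s0 := pow_le_pow_left₀ (by positivity) h.p_ge _
  have h2 : (2 : ℝ) ≤ 2 ^ P.s0 := by
    exact le_self_pow₀ (by norm_num) (Nat.one_le_iff_ne_zero.mp h.s0_pos)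
  rw [mul_pow] at h1
  have hrs : 0 < r ^ P.s0 := pow_pos hr0 _
  have h3 : 2 * r ^ P.s0 ≤ (p : ℝ) ^ P.s0 := by nlinarith
  rw [inv_pow, mul_assoc]
  refine le_mul_of_one_le_right (by positivity) ?_
  rw [← mul_assoc, ← div_eq_mul_inv, le_div_iff₀ hrs]
  linarith

/-- Non-asymptotic estimate: the posterior mass of `A` has a measurable majorant whose
expectation is controlled by the failure probabilities of the two good events and by the ratio of
the numerator and evidence bounds.  A majorant, rather than the mass itself, is used since the latter
need not be measurable off the good event, where the estimators take conventional values. -/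
lemma exists_majorant (h : P.Regular G c D α θbar) {A : Set (Fin p → ℝ)}
    (hA : MeasurableSet A) {ε : ℝ} (hε : 0 ≤ ε)
    (hbound : ∀ S : Finset (Fin p), S.card ≤ P.smax → ∀ v, zeroExtend S v ∈ A →
      P.w S.card * P.inflation D ^ S.card * Real.exp (-totalGap P G α (zeroExtend S v)) ≤
        ε * (1 / 2) ^ S.card) :
    ∃ H : (Fin n → ℝ) → ENNReal, Measurable H ∧ (∀ y, P.posterior G α y A ≤ H y) ∧
      ∫⁻ y, H y ∂(P.truth G) ≤ ENNReal.ofReal ((p : ℝ)⁻¹ + (p : ℝ) ^ (-(P.s0 : ℝ)) +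
        2 * ε / P.evidenceBound c α) := by
  have hc := h.stable.pos
  have hp := h.p_pos
  have hd := h.evidenceBound_pos
  set E := P.mleEvent G D θbar with hE
  have hEm : MeasurableSet E := P.measurableSet_mleEvent G D θbar h.nonsingular
  set Z := G.mixtureRatio (cols P.X P.S0) P.trueRestrict (1 / (2 * c)) with hZ
  have hZm : Measurable Z := Family.measurable_mixtureRatio _ _ _
  set B := {y | ENNReal.ofReal (P.mixtureThreshold c) ≤ Z y} with hB
  have hBm : MeasurableSet B := measurableSet_le measurable_const hZm
  set d := ENNReal.ofReal (P.evidenceBound c α) with hd'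
  have hd0 : d ≠ 0 := by rw [hd']; simpa using hd
  have hMm := measurable_majorant (P := P) (G := G) (D := D) (α := α) (θbar := θbar) A hA
  have hPE : P.truth G Eᶜ ≤ ENNReal.ofReal (p : ℝ)⁻¹ := by
    have h1 : (P.truth G).real Eᶜ ≤ (p : ℝ)⁻¹ := by
      rw [probReal_compl_eq_one_sub hEm]
      linarith [h.mle_close]
    rw [← ofReal_measureReal]
    exact ENNReal.ofReal_le_ofReal h1
  have hPB : P.truth G B ≤ ENNReal.ofReal ((p : ℝ) ^ (-(P.s0 : ℝ))) := by
    have h1 : ∫⁻ y, Z y ∂(P.truth G) = 1 := by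
      have := Family.lintegral_mixtureRatio (G := G) (ρ := 1 / (2 * c)) (by positivity) h.posDef_S0
      rw [P.cols_mulVec_trueRestrict] at this
      exact this
    have h2 : ENNReal.ofReal (P.mixtureThreshold c) * P.truth G B ≤ 1 := by
      rw [← h1]; exact mul_meas_ge_le_lintegral hZm _
    have h3 : ENNReal.ofReal ((p : ℝ) ^ (P.s0 : ℝ)) * P.truth G B ≤ 1 :=
      le_trans (by gcongr; exact h.le_mixtureThreshold) h2
    rw [Real.rpow_neg hp.le, ENNReal.ofReal_inv_of_pos (by positivity), ← one_div,
      ENNReal.le_div_iff_mul_le (Or.inl (ENNReal.ofReal_pos.mpr (Real.rpow_pos_of_pos hp _)).ne') (by simp), mul_comm]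
    exact h3
  refine ⟨fun y => Eᶜ.indicator 1 y + B.indicator 1 y + majorant P G D α θbar A y / d, ?_, ?_, ?_⟩
  · exact ((measurable_one.indicator hEm.compl).add (measurable_one.indicator hBm)).add
      (hMm.div_const d)
  · intro y
    by_cases hyE : y ∈ E
    · by_cases hyB : y ∈ B
      · refine (P.posterior_le_one G α y A).trans ?_
        simp only [Set.indicator_of_mem hyB, Pi.one_apply]
        rw [add_assoc, add_comm, add_assoc]
        exact le_self_add
      · refine le_trans ?_ le_add_self
        rw [P.posterior_eq]
        exact ENNReal.div_le_div (h.setLIntegral_le_majorant hyE hA)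
          (h.evidenceBound_le hyE (not_le.mp hyB))
    · refine (P.posterior_le_one G α y A).trans ?_
      simp only [Set.indicator_of_mem (Set.mem_compl hyE), Pi.one_apply]
      rw [add_assoc]
      exact le_self_add
  · rw [lintegral_add_right _ (hMm.div_const d), lintegral_add_right _ (measurable_one.indicator hBm),
      lintegral_indicator_one hEm.compl, lintegral_indicator_one hBm,
      ENNReal.ofReal_add (by positivity) (by positivity),
      ENNReal.ofReal_add (by positivity) (by positivity)]
    refine add_le_add (add_le_add hPE hPB) ?_
    simp_rw [div_eq_mul_inv]
    rw [lintegral_mul_const _ hMm, ← div_eq_mul_inv (2 * ε), ENNReal.ofReal_div_of_pos hd,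
      div_eq_mul_inv]
    gcongr
    exact h.lintegral_majorant_le hA hε hbound

end Problem.Regular

end NonAsymptotic

/-! ### Sparsity and compatibility numbers -/

section Sparsity

variable {n p : ℕ}

lemma measurable_card_supp : Measurable fun θ : Fin p → ℝ => ((supp θ).card : ℝ) := by
  have h : (fun θ : Fin p → ℝ => ((supp θ).card : ℝ)) =
      fun θ => ∑ j, if θ j ≠ 0 then (1 : ℝ) else 0 := by
    ext θ
    rw [supp, Finset.sum_boole]
  rw [h]
  refine Finset.measurable_sum _ fun j _ => Measurable.ite ?_ measurable_const measurable_const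
  exact (measurableSet_eq_fun (measurable_pi_apply j) measurable_const).compl

lemma supp_sub_card_le (θ θ' : Fin p → ℝ) :
    (supp (θ - θ')).card ≤ (supp θ).card + (supp θ').card := by
  refine (Finset.card_le_card fun j hj => ?_).trans (Finset.card_union_le _ _)
  simp only [supp, Finset.mem_union, Finset.mem_filter, Finset.mem_univ, true_and,
    Pi.sub_apply] at hj ⊢
  by_contra hcon
  push Not at hcon
  simp [hcon.1, hcon.2] at hj

lemma supp_card_pos {θ : Fin p → ℝ} (h : θ ≠ 0) : 0 < (supp θ).card := by
  obtain ⟨j, hj⟩ := Function.ne_iff.mp h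
  exact Finset.card_pos.mpr ⟨j, by simpa [supp] using hj⟩

lemma l2norm_sq (θ : Fin p → ℝ) : l2norm θ ^ 2 = ∑ j, θ j ^ 2 :=
  Real.sq_sqrt (Finset.sum_nonneg fun _ _ => sq_nonneg _)

lemma l1norm_pos {θ : Fin p → ℝ} (h : θ ≠ 0) : 0 < l1norm θ := by
  obtain ⟨j, hj⟩ := Function.ne_iff.mp h
  exact Finset.sum_pos' (fun _ _ => abs_nonneg _) ⟨j, Finset.mem_univ _, abs_pos.mpr hj⟩

lemma l1norm_sq_le (θ : Fin p → ℝ) : l1norm θ ^ 2 ≤ (supp θ).card * l2norm θ ^ 2 := by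
  have h1 : l1norm θ = ∑ j ∈ supp θ, |θ j| := by
    refine (Finset.sum_subset (Finset.subset_univ _) fun j _ hj => ?_).symm
    have : θ j = 0 := by simpa [supp] using hj
    simp [this]
  rw [h1, l2norm_sq]
  refine sq_sum_le_card_mul_sum_sq.trans ?_
  gcongr
  simp_rw [sq_abs]
  exact Finset.sum_le_sum_of_subset_of_nonneg (Finset.subset_univ _) fun _ _ _ => sq_nonneg _

lemma abs_mulVec_le (X : Matrix (Fin n) (Fin p) ℝ) (θ : Fin p → ℝ) (i : Fin n) :
    |(X *ᵥ θ) i| ≤ maxNorm X * l1norm θ := by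
  have hX : ∀ j, |X i j| ≤ maxNorm X := fun j =>
    (le_ciSup (f := fun j => |X i j|) (Set.finite_range _).bddAbove j).trans
      (le_ciSup (f := fun i => ⨆ j, |X i j|) (Set.finite_range _).bddAbove i)
  simp only [Matrix.mulVec, dotProduct, l1norm, Finset.mul_sum]
  refine (Finset.abs_sum_le_sum_abs _ _).trans (Finset.sum_le_sum fun j _ => ?_)
  rw [abs_mul]
  exact mul_le_mul_of_nonneg_right (hX j) (abs_nonneg _)

variable (P : Problem n p) (G : Family)

lemma Problem.quad_scaled (θ : Fin p → ℝ) :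
    quad ((n : ℝ)⁻¹ • (P.Xᵀ * P.W0 G * P.X)) θ = (n : ℝ)⁻¹ * quad (G.fisher P.X P.θ0) θ :=
  quad_smul _ _ _

lemma Problem.quad_scaled_nonneg (θ : Fin p → ℝ) :
    0 ≤ quad ((n : ℝ)⁻¹ • (P.Xᵀ * P.W0 G * P.X)) θ := by
  rw [P.quad_scaled]
  exact mul_nonneg (by positivity) (quad_nonneg (G.fisher_posSemidef _ _) θ)

lemma Problem.phi2sq_mul_le {s : ℝ} {θ : Fin p → ℝ} (hθ : θ ≠ 0)
    (hs : ((supp θ).card : ℝ) ≤ s) :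
    phi2sq P.X (P.W0 G) s * l2norm θ ^ 2 ≤ (n : ℝ)⁻¹ * quad (G.fisher P.X P.θ0) θ := by
  have h0 : 0 < l2norm θ ^ 2 := by
    have h1 := l1norm_sq_le θ
    have h2 := pow_pos (l1norm_pos hθ) 2
    by_contra hcon
    have : ((supp θ).card : ℝ) * l2norm θ ^ 2 ≤ 0 :=
      mul_nonpos_of_nonneg_of_nonpos (Nat.cast_nonneg _) (not_lt.mp hcon)
    linarith
  rw [← P.quad_scaled, ← le_div_iff₀ h0]
  refine csInf_le ⟨0, ?_⟩ ⟨θ, supp_card_pos hθ, hs, rfl⟩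
  rintro r ⟨θ', -, -, rfl⟩
  exact div_nonneg (P.quad_scaled_nonneg G θ') (sq_nonneg _)

lemma Problem.phi1sq_mul_le {s : ℝ} {θ : Fin p → ℝ} (hθ : θ ≠ 0)
    (hs : ((supp θ).card : ℝ) ≤ s) :
    phi1sq P.X (P.W0 G) s * l1norm θ ^ 2 ≤
      (supp θ).card * ((n : ℝ)⁻¹ * quad (G.fisher P.X P.θ0) θ) := by
  rw [← P.quad_scaled, ← le_div_iff₀ (pow_pos (l1norm_pos hθ) 2)]
  refine csInf_le ⟨0, ?_⟩ ⟨θ, supp_card_pos hθ, hs, rfl⟩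
  rintro r ⟨θ', -, -, rfl⟩
  exact div_nonneg (mul_nonneg (Nat.cast_nonneg _) (P.quad_scaled_nonneg G θ')) (sq_nonneg _)

lemma Problem.phi2sq_le_phi1sq {s : ℝ} (h0 : P.θ0 ≠ 0) (hs : (P.s0 : ℝ) ≤ s) :
    phi2sq P.X (P.W0 G) s ≤ phi1sq P.X (P.W0 G) s := by
  refine le_csInf ⟨_, P.θ0, supp_card_pos h0, hs, rfl⟩ ?_
  rintro r ⟨θ, hθ, hθs, rfl⟩
  have hne : θ ≠ 0 := by
    rintro rfl
    simp [supp] at hθ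
  rw [le_div_iff₀ (pow_pos (l1norm_pos hne) 2), P.quad_scaled]
  have h1 := P.phi2sq_mul_le G hne hθs
  have h2 : 0 ≤ phi2sq P.X (P.W0 G) s := by
    refine Real.sInf_nonneg ?_
    rintro r ⟨θ', -, -, rfl⟩
    exact div_nonneg (P.quad_scaled_nonneg G θ') (sq_nonneg _)
  calc phi2sq P.X (P.W0 G) s * l1norm θ ^ 2
      ≤ phi2sq P.X (P.W0 G) s * ((supp θ).card * l2norm θ ^ 2) := by
        gcongr; exact l1norm_sq_le θ
    _ = (supp θ).card * (phi2sq P.X (P.W0 G) s * l2norm θ ^ 2) := by ring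
    _ ≤ _ := by gcongr

/-- Quadratic lower bound for the affinity exponent.  Parameters outside the Fisher ellipsoid of
squared radius `Q` are first shrunk onto its boundary, where the linear predictors move by at most
`1 / 2` and the information is stable; the Jensen gaps only decrease under the shrinkage. -/
lemma Problem.le_totalGap {c α : ℝ} (hst : G.IsStable c) (hα0 : 0 ≤ α) (hα1 : α < 1) {K Q : ℝ}
    (hQ : 0 ≤ Q)
    (hphi : 0 < phi2sq P.X (P.W0 G) ((K + 1) * P.s0))
    (hdesign : 4 * (maxNorm P.X ^ 2 * ((K + 1) * P.s0) * Q) ≤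
      n * phi2sq P.X (P.W0 G) ((K + 1) * P.s0))
    {θ : Fin p → ℝ} (hθ : ((supp θ).card : ℝ) ≤ K * P.s0)
    (hfar : Q < quad (G.fisher P.X P.θ0) (θ - P.θ0)) :
    α * (1 - α) / (2 * c) * Q ≤ Problem.Regular.totalGap P G α θ := by
  have hc := hst.pos
  set F := G.fisher P.X P.θ0 with hF
  set δ := θ - P.θ0 with hδ
  set φ := phi2sq P.X (P.W0 G) ((K + 1) * P.s0) with hφ
  have hq : 0 < quad F δ := hQ.trans_lt hfar
  have hδ0 : δ ≠ 0 := by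
    intro h0
    rw [h0] at hq
    simp [quad] at hq
  set t := √(Q / quad F δ) with ht
  have ht2 : t ^ 2 = Q / quad F δ := Real.sq_sqrt (by positivity)
  have ht0 : 0 ≤ t := Real.sqrt_nonneg _
  have ht1 : t ≤ 1 := Real.sqrt_le_one.mpr ((div_le_one hq).mpr hfar.le)
  have htq : t ^ 2 * quad F δ = Q := by rw [ht2, div_mul_cancel₀ _ hq.ne']
  have hsupp : ((supp δ).card : ℝ) ≤ (K + 1) * P.s0 := by
    have h1 : ((supp δ).card : ℝ) ≤ (supp θ).card + P.s0 := by
      exact_mod_cast supp_sub_card_le θ P.θ0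
    linarith
  have hn : (0 : ℝ) ≤ n := Nat.cast_nonneg n
  have hpred : ∀ i, |t * (P.X *ᵥ δ) i| ≤ 1 / 2 := by
    intro i
    refine abs_le_of_sq_le_sq ?_ (by norm_num)
    have h1 : (t * (P.X *ᵥ δ) i) ^ 2 ≤ t ^ 2 * (maxNorm P.X ^ 2 * ((K + 1) * P.s0 * l2norm δ ^ 2)) := by
      rw [mul_pow]
      gcongr
      calc (P.X *ᵥ δ) i ^ 2 = |(P.X *ᵥ δ) i| ^ 2 := (sq_abs _).symm
        _ ≤ (maxNorm P.X * l1norm δ) ^ 2 := by gcongr; exact abs_mulVec_le _ _ _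
        _ = maxNorm P.X ^ 2 * l1norm δ ^ 2 := mul_pow _ _ _
        _ ≤ maxNorm P.X ^ 2 * ((K + 1) * P.s0 * l2norm δ ^ 2) := by
          gcongr
          exact (l1norm_sq_le δ).trans (by gcongr)
    have h2 := P.phi2sq_mul_le G hδ0 hsupp
    have hn0 : (0 : ℝ) < n := by
      rcases hn.lt_or_eq with h | h
      · exact h
      · exfalso
        have hl1 := pow_pos (l1norm_pos hδ0) 2
        have hl2 := l1norm_sq_le δ
        rw [← h, inv_zero, zero_mul] at h2
        have : l2norm δ ^ 2 ≤ 0 := by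
          by_contra hcon
          nlinarith [mul_pos hphi (not_le.mp hcon)]
        have : ((supp δ).card : ℝ) * l2norm δ ^ 2 ≤ 0 :=
          mul_nonpos_of_nonneg_of_nonpos (Nat.cast_nonneg _) this
        linarith
    have h3 : n * φ * (t ^ 2 * l2norm δ ^ 2) ≤ Q := by
      have : n * (φ * l2norm δ ^ 2) ≤ quad F δ := by
        have := mul_le_mul_of_nonneg_left h2 hn
        rwa [← mul_assoc, mul_inv_cancel_left₀ hn0.ne', mul_assoc] at this
      calc n * φ * (t ^ 2 * l2norm δ ^ 2) = t ^ 2 * (n * (φ * l2norm δ ^ 2)) := by ring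
        _ ≤ t ^ 2 * quad F δ := by gcongr
        _ = Q := htq
    have hnφ : 0 < n * φ := mul_pos hn0 hphi
    refine h1.trans ?_
    have hKs : 0 ≤ (K + 1) * P.s0 := (Nat.cast_nonneg _).trans hsupp
    have h4 : n * φ * (t ^ 2 * (maxNorm P.X ^ 2 * ((K + 1) * P.s0 * l2norm δ ^ 2))) ≤
        n * φ * (1 / 2) ^ 2 := by
      calc n * φ * (t ^ 2 * (maxNorm P.X ^ 2 * ((K + 1) * P.s0 * l2norm δ ^ 2)))
          = maxNorm P.X ^ 2 * ((K + 1) * P.s0) * (n * φ * (t ^ 2 * l2norm δ ^ 2)) := by ring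
        _ ≤ maxNorm P.X ^ 2 * ((K + 1) * P.s0) * Q := by gcongr
        _ ≤ n * φ * (1 / 2) ^ 2 := by linarith
    exact le_of_mul_le_mul_left h4 hnφ
  have hsum : α * (1 - α) / (2 * c) * Q = ∑ i, iteratedDeriv 2 G.b ((P.X *ᵥ P.θ0) i) / c *
      (α * (1 - α)) / 2 * (t * (P.X *ᵥ δ) i) ^ 2 := by
    rw [← htq, hF, G.quad_fisher, Finset.mul_sum, Finset.mul_sum]
    refine Finset.sum_congr rfl fun i _ => ?_
    field_simp
  rw [hsum]
  refine Finset.sum_le_sum fun i _ => ?_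
  have h1 := G.le_jensenGap hα0 hα1.le (x := (P.X *ᵥ P.θ0) i) (h := t * (P.X *ᵥ δ) i)
    (m := iteratedDeriv 2 G.b ((P.X *ᵥ P.θ0) i) / c) fun z hz => by
      rw [div_le_iff₀' hc]
      refine hst.le_mul ?_
      rw [abs_sub_comm]
      exact hz.trans (hpred i)
  have h2 := G.jensenGap_mono hα0 hα1 ht0 ht1 ((P.X *ᵥ P.θ0) i) ((P.X *ᵥ δ) i)
  have h3 : (P.X *ᵥ P.θ0) i + (P.X *ᵥ δ) i = (P.X *ᵥ θ) i := by
    rw [hδ, Matrix.mulVec_sub, Pi.sub_apply, add_sub_cancel]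
  rw [h3] at h2
  exact h1.trans h2

lemma Problem.Regular.totalGap_nonneg {α : ℝ} (hα0 : 0 ≤ α) (hα1 : α ≤ 1) (θ : Fin p → ℝ) :
    0 ≤ Problem.Regular.totalGap P G α θ :=
  Finset.sum_nonneg fun _ _ => G.jensenGap_nonneg hα0 hα1 _ _

end Sparsity

/-! ### The prior on the model size -/

section ModelSize

variable {n p : ℕ} {P : Problem n p} {A₁ A₂ A₃ A₄ : ℝ}

lemma Problem.Admissible.w_le (h : P.Admissible A₁ A₂ A₃ A₄) (hA₂ : 0 ≤ A₂) (s : ℕ) :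
    P.w s ≤ P.w 0 * (A₂ * (p : ℝ) ^ (-A₄)) ^ s := by
  induction s with
  | zero => simp
  | succ s ih =>
    by_cases hs : s + 1 ≤ P.smax
    · refine (h.w_upper s hs).trans ?_
      rw [pow_succ]
      have : 0 ≤ A₂ * (p : ℝ) ^ (-A₄) := by positivity
      calc _ ≤ A₂ * (p : ℝ) ^ (-A₄) * (P.w 0 * (A₂ * (p : ℝ) ^ (-A₄)) ^ s) := by gcongr
        _ = _ := by ring
    · rw [h.w_eq_zero _ (not_le.mp hs)]
      exact mul_nonneg (h.w_nonneg 0) (by positivity)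

lemma Problem.Admissible.w_zero_le_one (h : P.Admissible A₁ A₂ A₃ A₄) : P.w 0 ≤ 1 := by
  rw [← h.w_sum]
  exact Finset.single_le_sum (f := P.w) (fun s _ => h.w_nonneg s) (by simp)

lemma Problem.Admissible.half_le_w_zero (h : P.Admissible A₁ A₂ A₃ A₄) (hA₂ : 0 ≤ A₂)
    (hsmall : A₂ * (p : ℝ) ^ (-A₄) ≤ 1 / 2) : 1 / 2 ≤ P.w 0 := by
  have h0 := h.w_nonneg 0
  have h1 : (1 : ℝ) ≤ P.w 0 * 2 := by
    calc (1 : ℝ) = ∑ s ∈ Finset.range (P.smax + 1), P.w s := h.w_sum.symm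
      _ ≤ ∑ s ∈ Finset.range (P.smax + 1), P.w 0 * (1 / 2) ^ s := by
        refine Finset.sum_le_sum fun s _ => (h.w_le hA₂ s).trans ?_
        gcongr
      _ = P.w 0 * ∑ s ∈ Finset.range (P.smax + 1), (1 / 2 : ℝ) ^ s := by rw [Finset.mul_sum]
      _ ≤ P.w 0 * 2 := by
        gcongr
        exact (Summable.sum_le_tsum _ (fun _ _ => by positivity)
          (summable_geometric_of_lt_one (by norm_num) (by norm_num))).trans
          (le_of_eq (by rw [tsum_geometric_of_lt_one] <;> norm_num))
  linarith

lemma Problem.Admissible.le_w (h : P.Admissible A₁ A₂ A₃ A₄) (hA₁ : 0 ≤ A₁) {s : ℕ}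
    (hs : s ≤ P.smax) : P.w 0 * (A₁ * (p : ℝ) ^ (-A₃)) ^ s ≤ P.w s := by
  induction s with
  | zero => simp
  | succ s ih =>
    refine le_trans ?_ (h.w_lower s hs)
    rw [pow_succ]
    have : 0 ≤ A₁ * (p : ℝ) ^ (-A₃) := by positivity
    calc _ = A₁ * (p : ℝ) ^ (-A₃) * (P.w 0 * (A₁ * (p : ℝ) ^ (-A₃)) ^ s) := by ring
      _ ≤ _ := by gcongr; exact ih (by omega)

/-- Polynomial lower bound for the evidence, once `p` exceeds constants of the problem. -/
lemma Problem.Admissible.le_evidenceBound (h : P.Admissible A₁ A₂ A₃ A₄) (hA₁ : 0 < A₁)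
    (hA₂ : 0 ≤ A₂) (hsmall : A₂ * (p : ℝ) ^ (-A₄) ≤ 1 / 2) {c α A₅ A₆ : ℝ} (hc : 0 < c)
    (hα0 : 0 < α) (hα1 : α < 1)
    (hs0 : 1 ≤ P.s0) (hlow : (p : ℝ) ^ (-A₅) ≤ P.lam) (hup : P.lam ≤ A₆) (hp2 : (2 : ℝ) ≤ p)
    (hpA₁ : 2 / A₁ ≤ p) (hpc : A₆ + c ≤ p) :
    (p : ℝ) ^ (-(A₃ + A₅ + 4) * P.s0) ≤ P.evidenceBound c α := by
  have hp : (0 : ℝ) < p := by linarith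
  have hlam : 0 < P.lam := lt_of_lt_of_le (Real.rpow_pos_of_pos hp _) hlow
  have hhalf : (1 / 2 : ℝ) ^ P.s0 ≤ 1 / 2 :=
    pow_le_of_le_one (by norm_num) (by norm_num) (Nat.one_le_iff_ne_zero.mp hs0)
  have h1 : ((p : ℝ) ^ (-(A₃ + 1))) ^ P.s0 ≤ P.w P.s0 := by
    refine le_trans ?_ (h.le_w hA₁.le h.s0_le_smax)
    calc ((p : ℝ) ^ (-(A₃ + 1))) ^ P.s0 ≤ (1 / 2 * (A₁ * (p : ℝ) ^ (-A₃))) ^ P.s0 := by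
          gcongr
          rw [neg_add, Real.rpow_add hp, Real.rpow_neg_one]
          rw [div_le_iff₀ hA₁] at hpA₁
          have : (p : ℝ)⁻¹ ≤ 1 / 2 * A₁ := by
            rw [inv_le_iff_one_le_mul₀ hp]; linarith
          calc (p : ℝ) ^ (-A₃) * (p : ℝ)⁻¹ ≤ (p : ℝ) ^ (-A₃) * (1 / 2 * A₁) := by gcongr
            _ = _ := by ring
      _ = (1 / 2) ^ P.s0 * (A₁ * (p : ℝ) ^ (-A₃)) ^ P.s0 := mul_pow _ _ _
      _ ≤ P.w 0 * (A₁ * (p : ℝ) ^ (-A₃)) ^ P.s0 := by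
          gcongr
          exact hhalf.trans (h.half_le_w_zero hA₂ hsmall)
  have hcard : P.s0 ≤ p := (Finset.card_le_univ P.S0).trans_eq (Fintype.card_fin p)
  have hch0 : (0 : ℝ) < p.choose P.s0 := by exact_mod_cast Nat.choose_pos hcard
  have hch : (p.choose P.s0 : ℝ) ≤ (p : ℝ) ^ P.s0 := by exact_mod_cast Nat.choose_le_pow p P.s0
  have h2 : ((p : ℝ) ^ (-(A₅ + 2))) ^ P.s0 ≤ 1 / 2 * √(P.lam / (P.lam + α * c)) ^ P.s0 := by
    have hαc : 0 < α * c := mul_pos hα0 hc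
    have hx0 : 0 < P.lam / (P.lam + α * c) := by positivity
    have hx1 : P.lam / (P.lam + α * c) ≤ 1 := (div_le_one (by positivity)).mpr (by linarith)
    have hx : (p : ℝ) ^ (-(A₅ + 1)) ≤ P.lam / (P.lam + α * c) := by
      rw [neg_add, Real.rpow_add hp, Real.rpow_neg_one, ← div_eq_mul_inv]
      have : P.lam + α * c ≤ p := by nlinarith
      gcongr
    have hsq : P.lam / (P.lam + α * c) ≤ √(P.lam / (P.lam + α * c)) := by
      refine Real.le_sqrt_of_sq_le ?_
      nlinarith
    calc ((p : ℝ) ^ (-(A₅ + 2))) ^ P.s0 ≤ (1 / 2 * √(P.lam / (P.lam + α * c))) ^ P.s0 := by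
          gcongr
          have e : -(A₅ + 2) = -(A₅ + 1) + (-1) := by ring
          rw [e, Real.rpow_add hp, Real.rpow_neg_one, mul_comm]
          have : (p : ℝ)⁻¹ ≤ 1 / 2 := by
            rw [inv_le_comm₀ hp (by norm_num)]; norm_num; exact_mod_cast hp2
          gcongr
          exact hx.trans hsq
      _ = (1 / 2) ^ P.s0 * √(P.lam / (P.lam + α * c)) ^ P.s0 := mul_pow _ _ _
      _ ≤ _ := by gcongr
  have e : (p : ℝ) ^ (-(A₃ + A₅ + 4) * P.s0) =
      ((p : ℝ) ^ (-(A₃ + 1))) ^ P.s0 / (p : ℝ) ^ P.s0 * ((p : ℝ) ^ (-(A₅ + 2))) ^ P.s0 := by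
    rw [← Real.rpow_natCast, ← Real.rpow_natCast, ← Real.rpow_natCast, ← Real.rpow_mul hp.le,
      ← Real.rpow_mul hp.le, ← Real.rpow_sub hp, ← Real.rpow_add hp]
    congr 1; ring
  rw [e]
  unfold Problem.evidenceBound
  have hw0 := h.w_nonneg P.s0
  gcongr

/-- The complexity penalty of the prior beats the inflation of the slabs. -/
lemma Problem.Admissible.w_mul_inflation_le (h : P.Admissible A₁ A₂ A₃ A₄) (hA₂ : 0 < A₂)
    {D : ℝ} (hp1 : (1 : ℝ) ≤ p) (hD0 : 0 < D) (hD : D ≤ (p : ℝ) ^ (A₄ / 8))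
    (hA : √2 * A₂ ≤ (p : ℝ) ^ (A₄ / 8)) (hlam : P.lam ≤ A₄) (s : ℕ) :
    P.w s * P.inflation D ^ s ≤ ((p : ℝ) ^ (-(A₄ / 4))) ^ s := by
  have hp : (0 : ℝ) < p := by linarith
  have hinf : 0 ≤ P.inflation D := by unfold Problem.inflation; positivity
  have hw : P.w s ≤ (A₂ * (p : ℝ) ^ (-A₄)) ^ s := by
    refine (h.w_le hA₂.le s).trans ?_
    exact mul_le_of_le_one_left (by positivity) h.w_zero_le_one
  calc P.w s * P.inflation D ^ s ≤ (A₂ * (p : ℝ) ^ (-A₄)) ^ s * P.inflation D ^ s := by gcongr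
    _ = (A₂ * (p : ℝ) ^ (-A₄) * P.inflation D) ^ s := (mul_pow _ _ _).symm
    _ ≤ _ := by
      refine pow_le_pow_left₀ (by positivity) ?_ s
      have he : Real.exp (P.lam * Real.log p / 2) ≤ (p : ℝ) ^ (A₄ / 2) := by
        rw [Real.rpow_def_of_pos hp]
        refine Real.exp_le_exp.mpr ?_
        have := Real.log_nonneg hp1
        nlinarith
      unfold Problem.inflation
      calc A₂ * (p : ℝ) ^ (-A₄) * (√2 * D * Real.exp (P.lam * Real.log p / 2))
          = (p : ℝ) ^ (-A₄) * ((√2 * A₂) * D * Real.exp (P.lam * Real.log p / 2)) := by ring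
        _ ≤ (p : ℝ) ^ (-A₄) * ((p : ℝ) ^ (A₄ / 8) * (p : ℝ) ^ (A₄ / 8) * (p : ℝ) ^ (A₄ / 2)) := by
          gcongr
        _ = _ := by
          rw [← Real.rpow_add hp, ← Real.rpow_add hp, ← Real.rpow_add hp]
          congr 1; ring

end ModelSize

/-! ### Asymptotics -/

section Asymptotics

variable {n p : ℕ} (P : Problem n p) (G : Family)

lemma Problem.posterior_le_add {α : ℝ} {y : Fin n → ℝ} {A B₁ B₂ : Set (Fin p → ℝ)}
    (h : A ⊆ B₁ ∪ B₂) : P.posterior G α y A ≤ P.posterior G α y B₁ + P.posterior G α y B₂ := by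
  unfold Problem.posterior
  rw [← ENNReal.add_div]
  exact ENNReal.div_le_div_right ((lintegral_mono_set h).trans (lintegral_union_le _ _ _)) _

variable {P G}

/-- The non-asymptotic estimate with a polynomially small numerator. -/
lemma Problem.Regular.exists_majorant_of_pow {c D α M : ℝ} {θbar : ∀ S : Finset (Fin p), S → ℝ}
    (h : P.Regular G c D α θbar) (hev : (p : ℝ) ^ (-M * P.s0) ≤ P.evidenceBound c α)
    {A : Set (Fin p → ℝ)} (hA : MeasurableSet A)
    (hbound : ∀ S : Finset (Fin p), S.card ≤ P.smax → ∀ v, zeroExtend S v ∈ A →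
      P.w S.card * P.inflation D ^ S.card *
        Real.exp (-Problem.Regular.totalGap P G α (zeroExtend S v)) ≤
        (p : ℝ) ^ (-(M + 2) * P.s0) * (1 / 2) ^ S.card) :
    ∃ H : (Fin n → ℝ) → ENNReal, Measurable H ∧ (∀ y, P.posterior G α y A ≤ H y) ∧
      ∫⁻ y, H y ∂(P.truth G) ≤ ENNReal.ofReal ((P.s0 * Real.log p)⁻¹ + 2 * (p : ℝ)⁻¹ +
        (p : ℝ) ^ (-(P.s0 : ℝ))) := by
  have hp := h.p_pos
  obtain ⟨H, hH1, hH2, hH3⟩ := h.exists_majorant hA (by positivity) hbound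
  refine ⟨H, hH1, hH2, hH3.trans (ENNReal.ofReal_le_ofReal ?_)⟩
  have hlog := h.log_pos
  have hp2 : (2 : ℝ) ≤ p := by
    have := Real.log_le_sub_one_of_pos hp; linarith
  have hs : (1 : ℝ) ≤ P.s0 := by exact_mod_cast h.s0_pos
  have h1 : 2 * (p : ℝ) ^ (-(M + 2) * P.s0) / P.evidenceBound c α ≤ (p : ℝ)⁻¹ := by
    rw [div_le_iff₀ h.evidenceBound_pos]
    have e : (p : ℝ) ^ (-(M + 2) * P.s0) = (p : ℝ) ^ (-2 * P.s0 : ℝ) * (p : ℝ) ^ (-M * P.s0) := by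
      rw [← Real.rpow_add hp]; congr 1; ring
    have h2 : (p : ℝ) ^ (-2 * P.s0 : ℝ) ≤ (p : ℝ)⁻¹ * (p : ℝ)⁻¹ := by
      rw [← Real.rpow_neg_one, ← Real.rpow_add hp]
      exact Real.rpow_le_rpow_of_exponent_le (by linarith) (by linarith)
    have h3 : 2 * (p : ℝ)⁻¹ ≤ 1 := by
      rw [← div_eq_mul_inv, div_le_one hp]; exact hp2
    have hM : 0 < (p : ℝ) ^ (-M * P.s0) := Real.rpow_pos_of_pos hp _
    have hpi : 0 < (p : ℝ)⁻¹ := inv_pos.mpr hp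
    calc 2 * (p : ℝ) ^ (-(M + 2) * P.s0)
        = 2 * (p : ℝ) ^ (-2 * P.s0 : ℝ) * (p : ℝ) ^ (-M * P.s0) := by rw [e]; ring
      _ ≤ 2 * ((p : ℝ)⁻¹ * (p : ℝ)⁻¹) * P.evidenceBound c α := by gcongr
      _ = (2 * (p : ℝ)⁻¹) * ((p : ℝ)⁻¹ * P.evidenceBound c α) := by ring
      _ ≤ (p : ℝ)⁻¹ * P.evidenceBound c α :=
        mul_le_of_le_one_left (mul_nonneg hpi.le h.evidenceBound_pos.le) h3
  have h4 : 0 ≤ ((P.s0 : ℝ) * Real.log p)⁻¹ := by positivity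
  linarith

end Asymptotics

/-- What the assumptions give at all large sample sizes. -/
lemma eventually_regular {G : Family} {p : ℕ → ℕ} {P : ∀ n, Problem n (p n)} {D : ℕ → ℝ}
    {θbar : ∀ n, ∀ S : Finset (Fin (p n)), S → ℝ} {α C A₁ A₂ A₃ A₄ A₅ A₆ A₇ : ℝ}
    (hC : 0 < C) (hp : ∀ᶠ n : ℕ in atTop, (n : ℝ) ^ C ≤ (p n : ℝ))
    (hA₁ : 0 < A₁) (hA₂ : 0 < A₂) (hA₄ : 0 < A₄)
    (hP : ∀ᶠ n in atTop, (P n).Admissible A₁ A₂ A₃ A₄)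
    (h1 : A1 G p P D θbar) (h2 : A2 G p P D α A₄ A₅ A₆ A₇) {c : ℝ} (hst : G.IsStable c) :
    ∀ᶠ n in atTop, (P n).Regular G c (D n) α (θbar n) ∧
      (∀ s, (P n).w s * (P n).inflation (D n) ^ s ≤ ((p n : ℝ) ^ (-(A₄ / 4))) ^ s) ∧
      (p n : ℝ) ^ (-(A₃ + A₅ + 4) * (P n).s0) ≤ (P n).evidenceBound c α ∧
      (p n : ℝ) ^ (-(A₄ / 8)) ≤ 1 / 2 := by
  have hc := hst.pos
  have hpt : Tendsto (fun n => (p n : ℝ)) atTop atTop :=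
    tendsto_atTop_mono' _ hp ((tendsto_rpow_atTop hC).comp tendsto_natCast_atTop_atTop)
  have hlogt : Tendsto (fun n => α * Real.log (p n)) atTop atTop :=
    (Real.tendsto_log_atTop.comp hpt).const_mul_atTop h2.α_pos
  have hpow : Tendsto (fun n => (p n : ℝ) ^ (A₄ / 8)) atTop atTop :=
    (tendsto_rpow_atTop (by linarith)).comp hpt
  have hneg : Tendsto (fun n => A₂ * (p n : ℝ) ^ (-A₄)) atTop (𝓝 0) := by
    simpa using ((tendsto_rpow_neg_atTop hA₄).comp hpt).const_mul A₂
  have hneg' : Tendsto (fun n => (p n : ℝ) ^ (-(A₄ / 8))) atTop (𝓝 0) :=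
    (tendsto_rpow_neg_atTop (by linarith)).comp hpt
  filter_upwards [hP, h1.D_gt, h1.nonsingular, h1.mle_close, h1.nonsingular_S0,
    h1.regular.eventually_le_const (show (0 : ℝ) < 1 / (128 * c) by positivity),
    h2.lam_bounds, h2.lt_A₄,
    h2.logD.eventually_le_const (show (0 : ℝ) < A₄ / 8 by positivity),
    hlogt.eventually_ge_atTop 1, hpt.eventually_ge_atTop (2 * √(1 + 2 * c ^ 2)),
    hpt.eventually_ge_atTop 2, hpt.eventually_ge_atTop (2 / A₁), hpt.eventually_ge_atTop (A₆ + c),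
    hpow.eventually_ge_atTop (√2 * A₂),
    hneg.eventually_le_const (show (0 : ℝ) < 1 / 2 by norm_num),
    hneg'.eventually_le_const (show (0 : ℝ) < 1 / 2 by norm_num)]
    with n hadm hD hns hmle hS0 hzeta hlam hltA hlogD hlog hpc hp2 hpA₁ hpA₆ hpA₂ hsmall hhalf
  have hp0 : (0 : ℝ) < p n := by linarith
  have hD0 : 0 < D n := (Real.sqrt_nonneg 2).trans_lt hD
  have hlam0 : 0 < (P n).lam := lt_of_lt_of_le (Real.rpow_pos_of_pos hp0 _) hlam.1
  have hs0 : 1 ≤ (P n).s0 := supp_card_pos hadm.θ0_ne_zero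
  have hlamA₆ : (P n).lam ≤ A₆ := by
    refine hlam.2.trans (mul_le_of_le_one_right h2.A₆_pos.le ?_)
    exact Real.rpow_le_one_of_one_le_of_nonpos (by linarith) (by linarith [h2.A₇_nonneg])
  have hwpos : 0 < (P n).w (P n).s0 := by
    refine lt_of_lt_of_le ?_ (hadm.le_w hA₁.le hadm.s0_le_smax)
    have := hadm.half_le_w_zero hA₂.le hsmall
    have hw0 : 0 < (P n).w 0 := by linarith
    positivity
  refine ⟨⟨hst, hD0, hlam0, h2.α_pos, h2.α_lt_one, hadm.θ0_ne_zero, hadm.s0_le_smax,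
    hadm.w_nonneg, hadm.w_eq_zero, hwpos, hns, hmle, hS0, hzeta, hlog, hpc⟩, ?_, ?_, hhalf⟩
  · refine hadm.w_mul_inflation_le hA₂ (by linarith) hD0 ?_ hpA₂ (hlam.2.trans hltA.le)
    rwa [Real.logb_le_iff_le_rpow (by linarith) hD0] at hlogD
  · exact hadm.le_evidenceBound hA₁ hA₂.le hsmall hc h2.α_pos h2.α_lt_one hs0 hlam.1 hlamA₆ hp2
      hpA₁ hpA₆

/-- Models larger than `K s₀` carry little prior mass: half of the exponent of the size penalty pays
for the evidence bound, the other half for the sum over the model sizes. -/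
lemma Problem.Regular.bound_of_card_gt {n p : ℕ} {P : Problem n p} {G : Family} {c D α A₄ M K : ℝ}
    {θbar : ∀ S : Finset (Fin p), S → ℝ} (h : P.Regular G c D α θbar) (hA₄ : 0 < A₄)
    (hw : ∀ s, P.w s * P.inflation D ^ s ≤ ((p : ℝ) ^ (-(A₄ / 4))) ^ s)
    (hhalf : (p : ℝ) ^ (-(A₄ / 8)) ≤ 1 / 2) (hK : M + 2 ≤ A₄ / 8 * K) (S : Finset (Fin p))
    (v : S → ℝ) (hv : K * P.s0 < ((supp (zeroExtend S v)).card : ℝ)) :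
    P.w S.card * P.inflation D ^ S.card *
      Real.exp (-Problem.Regular.totalGap P G α (zeroExtend S v)) ≤
        (p : ℝ) ^ (-(M + 2) * P.s0) * (1 / 2) ^ S.card := by
  have hp := h.p_pos
  have hp1 : (1 : ℝ) ≤ p := by
    have := Real.log_le_sub_one_of_pos hp
    linarith [h.log_pos]
  have hcard : K * P.s0 ≤ (S.card : ℝ) := hv.le.trans (by exact_mod_cast supp_zeroExtend_card_le S v)
  have hexp : Real.exp (-Problem.Regular.totalGap P G α (zeroExtend S v)) ≤ 1 := by
    rw [Real.exp_le_one_iff, neg_nonpos]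
    exact totalGap_nonneg P G h.α_pos.le h.α_lt_one.le _
  have hs : (1 : ℝ) ≤ P.s0 := by exact_mod_cast h.s0_pos
  have e : (p : ℝ) ^ (-(A₄ / 4)) = (p : ℝ) ^ (-(A₄ / 8)) * (p : ℝ) ^ (-(A₄ / 8)) := by
    rw [← Real.rpow_add hp]; congr 1; ring
  calc _ ≤ ((p : ℝ) ^ (-(A₄ / 4))) ^ S.card * 1 :=
        mul_le_mul (hw _) hexp (Real.exp_pos _).le (by positivity)
    _ = ((p : ℝ) ^ (-(A₄ / 8))) ^ S.card * ((p : ℝ) ^ (-(A₄ / 8))) ^ S.card := by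
        rw [mul_one, e, mul_pow]
    _ ≤ (p : ℝ) ^ (-(M + 2) * P.s0) * (1 / 2) ^ S.card := by
        gcongr
        rw [← Real.rpow_natCast, ← Real.rpow_mul hp.le]
        refine Real.rpow_le_rpow_of_exponent_le hp1 ?_
        have h1 : (M + 2) * P.s0 ≤ A₄ / 8 * K * P.s0 := by gcongr
        have h2 : A₄ / 8 * (K * P.s0) ≤ A₄ / 8 * S.card := by gcongr
        linarith

/-- Far from the truth the affinity exponent pays for the evidence bound, and the size penalty for
the sum over the model sizes. -/
lemma Problem.Regular.bound_of_quad_gt {n p : ℕ} {P : Problem n p} {G : Family}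
    {c D α A₄ M K r : ℝ} {θbar : ∀ S : Finset (Fin p), S → ℝ} (h : P.Regular G c D α θbar)
    (hA₄ : 0 < A₄) (hw : ∀ s, P.w s * P.inflation D ^ s ≤ ((p : ℝ) ^ (-(A₄ / 4))) ^ s)
    (hhalf : (p : ℝ) ^ (-(A₄ / 8)) ≤ 1 / 2) (hr0 : 0 ≤ r)
    (hr : M + 2 ≤ α * (1 - α) / (2 * c) * r)
    (hphi : 0 < phi2sq P.X (P.W0 G) ((K + 1) * P.s0))
    (hdesign : 4 * (maxNorm P.X ^ 2 * ((K + 1) * P.s0) * (r * (P.s0 * Real.log p))) ≤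
      n * phi2sq P.X (P.W0 G) ((K + 1) * P.s0)) (S : Finset (Fin p)) (v : S → ℝ)
    (hv : ((supp (zeroExtend S v)).card : ℝ) ≤ K * P.s0)
    (hfar : r * (P.s0 * Real.log p) < quad (G.fisher P.X P.θ0) (zeroExtend S v - P.θ0)) :
    P.w S.card * P.inflation D ^ S.card *
      Real.exp (-Problem.Regular.totalGap P G α (zeroExtend S v)) ≤
        (p : ℝ) ^ (-(M + 2) * P.s0) * (1 / 2) ^ S.card := by
  have hp := h.p_pos
  have hp1 : (1 : ℝ) ≤ p := by
    have := Real.log_le_sub_one_of_pos hp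
    linarith [h.log_pos]
  have hlog : 0 ≤ Real.log p := by linarith [h.log_pos]
  have hgap := P.le_totalGap G h.stable h.α_pos.le h.α_lt_one (by positivity) hphi hdesign hv hfar
  have hexp : Real.exp (-Problem.Regular.totalGap P G α (zeroExtend S v)) ≤
      (p : ℝ) ^ (-(M + 2) * P.s0) := by
    rw [Real.rpow_def_of_pos hp]
    refine Real.exp_le_exp.mpr ?_
    have h1 : (M + 2) * (P.s0 * Real.log p) ≤
        α * (1 - α) / (2 * c) * r * (P.s0 * Real.log p) := by gcongr
    linarith
  have hbase : (p : ℝ) ^ (-(A₄ / 4)) ≤ 1 / 2 :=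
    (Real.rpow_le_rpow_of_exponent_le hp1 (by linarith)).trans hhalf
  calc _ ≤ (1 / 2) ^ S.card * (p : ℝ) ^ (-(M + 2) * P.s0) := by
        refine mul_le_mul ((hw _).trans ?_) hexp (Real.exp_pos _).le (by positivity)
        gcongr
    _ = _ := mul_comm _ _

/-- Off the sets of large dimension or large Fisher distance, both norms obey the claimed rates. -/
lemma Problem.norm_bounds {n p : ℕ} (P : Problem n p) (G : Family) {K r t : ℝ} (h0 : P.θ0 ≠ 0)
    (hK : 0 ≤ K) (hr : 0 ≤ r) (ht : 1 ≤ t) (hrt : (K + 1) * r ≤ t) (_hlog : 0 ≤ Real.log p)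
    (hphi : 0 < phi2sq P.X (P.W0 G) ((K + 1) * P.s0)) {θ : Fin p → ℝ}
    (hθ : ((supp θ).card : ℝ) ≤ K * P.s0)
    (hclose : quad (G.fisher P.X P.θ0) (θ - P.θ0) ≤ r * (P.s0 * Real.log p)) :
    l1norm (θ - P.θ0) ≤ t * P.s0 / √(phi1sq P.X (P.W0 G) ((K + 1) * P.s0)) *
        √(Real.log p / n) ∧
    l2norm (θ - P.θ0) ≤ t / √(phi2sq P.X (P.W0 G) ((K + 1) * P.s0)) *
        √(P.s0 * Real.log p / n) := by
  set δ := θ - P.θ0 with hδ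
  have hphi1 : 0 < phi1sq P.X (P.W0 G) ((K + 1) * P.s0) := by
    refine hphi.trans_le (P.phi2sq_le_phi1sq G h0 ?_)
    nlinarith [Nat.cast_nonneg (α := ℝ) P.s0]
  by_cases hδ0 : δ = 0
  · rw [hδ0]
    constructor
    · have : l1norm (0 : Fin p → ℝ) = 0 := by simp [l1norm]
      rw [this]; positivity
    · have : l2norm (0 : Fin p → ℝ) = 0 := by simp [l2norm]
      rw [this]; positivity
  have hs : (0 : ℝ) ≤ P.s0 := Nat.cast_nonneg _
  have hsupp : ((supp δ).card : ℝ) ≤ (K + 1) * P.s0 := by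
    have h1 : ((supp δ).card : ℝ) ≤ (supp θ).card + P.s0 := by
      exact_mod_cast supp_sub_card_le θ P.θ0
    linarith
  have hquad : (n : ℝ)⁻¹ * quad (G.fisher P.X P.θ0) δ ≤ (n : ℝ)⁻¹ * (r * (P.s0 * Real.log p)) := by
    gcongr
  have hqn := quad_nonneg (G.fisher_posSemidef P.X P.θ0) δ
  have ht2 : t ≤ t ^ 2 := by nlinarith
  have hrr : r ≤ (K + 1) * r := by nlinarith
  constructor
  · refine abs_le_of_sq_le_sq' ?_ (by positivity) |>.2
    have h1 := P.phi1sq_mul_le G hδ0 hsupp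
    rw [mul_pow, div_pow, Real.sq_sqrt hphi1.le, Real.sq_sqrt (by positivity), div_mul_eq_mul_div,
      le_div_iff₀ hphi1, mul_comm]
    calc _ ≤ _ := h1
      _ ≤ ((K + 1) * P.s0) * ((n : ℝ)⁻¹ * (r * (P.s0 * Real.log p))) := by gcongr
      _ = ((K + 1) * r) * (P.s0 ^ 2 * (Real.log p / n)) := by ring
      _ ≤ t ^ 2 * (P.s0 ^ 2 * (Real.log p / n)) := by gcongr; linarith
      _ = _ := by ring
  · refine abs_le_of_sq_le_sq' ?_ (by positivity) |>.2
    have h1 := P.phi2sq_mul_le G hδ0 hsupp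
    rw [mul_pow, div_pow, Real.sq_sqrt hphi.le, Real.sq_sqrt (by positivity), div_mul_eq_mul_div,
      le_div_iff₀ hphi, mul_comm]
    calc _ ≤ _ := h1
      _ ≤ (n : ℝ)⁻¹ * (r * (P.s0 * Real.log p)) := hquad
      _ = r * (P.s0 * Real.log p / n) := by ring
      _ ≤ t ^ 2 * (P.s0 * Real.log p / n) := by gcongr; linarith

end SparseGLM

open SparseGLM in
theorem theorem3p3 (G : SparseGLM.Family) (p : ℕ → ℕ)
    (P : ∀ n, SparseGLM.Problem n (p n))
    (D : ℕ → ℝ) (θbar : ∀ n, ∀ S : Finset (Fin (p n)), S → ℝ)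
    (α C A₁ A₂ A₃ A₄ A₅ A₆ A₇ : ℝ)
    (hC : 0 < C) (hp : ∀ᶠ n : ℕ in atTop, (n : ℝ) ^ C ≤ (p n : ℝ))
    (hA₁ : 0 < A₁) (hA₂ : 0 < A₂) (hA₃ : 0 < A₃) (hA₄ : 0 < A₄)
    (hP : ∀ᶠ n in atTop, (P n).Admissible A₁ A₂ A₃ A₄)
    (h1 : SparseGLM.A1 G p P D θbar)
    (h2 : SparseGLM.A2 G p P D α A₄ A₅ A₆ A₇) :
    (∃ Kdim : ℝ, SparseGLM.IsDimConstant G p P α Kdim) ∧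
    ∀ Kdim : ℝ, SparseGLM.IsDimConstant G p P α Kdim → SparseGLM.A3 G p P Kdim →
      ∃ Ktheta : ℝ, 0 < Ktheta ∧ ∀ᶠ n in atTop,
        (P n).expPosterior G α
            {θ | Ktheta * (P n).s0 /
                √(SparseGLM.phi1sq (P n).X ((P n).W0 G) ((Kdim + 1) * (P n).s0)) *
                √(Real.log (p n) / n) < SparseGLM.l1norm (θ - (P n).θ0)} ≤
          ENNReal.ofReal (SparseGLM.failureBound (P n).s0 (p n)) ∧
        (P n).expPosterior G α
            {θ | Ktheta /
                √(SparseGLM.phi2sq (P n).X ((P n).W0 G) ((Kdim + 1) * (P n).s0)) *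
                √((P n).s0 * Real.log (p n) / n) < SparseGLM.l2norm (θ - (P n).θ0)} ≤
          ENNReal.ofReal (SparseGLM.failureBound (P n).s0 (p n)) ∧
        (P n).expPosterior G α
            {θ | Ktheta * ((P n).s0 * Real.log (p n)) <
                SparseGLM.quad (G.fisher (P n).X (P n).θ0) (θ - (P n).θ0)} ≤
          ENNReal.ofReal (SparseGLM.failureBound (P n).s0 (p n)) := by
  obtain ⟨c, hc1, hstab⟩ := G.stable
  have hst : G.IsStable c := ⟨hc1, hstab⟩
  have hc := hst.pos
  have hreg := eventually_regular hC hp hA₁ hA₂ hA₄ hP h1 h2 hst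
  have hα0 := h2.α_pos
  have hα1 := h2.α_lt_one
  have hA₅ := h2.A₅_pos
  set M := A₃ + A₅ + 4 with hM
  have hM0 : 0 < M := by positivity
  have hdimMeas : ∀ n (K : ℝ), MeasurableSet
      {θ : Fin (p n) → ℝ | K * (P n).s0 < ((supp θ).card : ℝ)} := fun n K =>
    measurableSet_lt measurable_const measurable_card_supp
  refine ⟨⟨8 * (M + 2) / A₄ + 2, ?_, ?_⟩, ?_⟩
  · have : 0 < 8 * (M + 2) / A₄ := by positivity
    linarith
  · filter_upwards [hreg] with n hn
    obtain ⟨hR, hw, hev, hhalf⟩ := hn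
    have hK : M + 2 ≤ A₄ / 8 * (8 * (M + 2) / A₄ + 2) := by
      have : A₄ / 8 * (8 * (M + 2) / A₄ + 2) = M + 2 + A₄ / 4 := by field_simp; ring
      linarith
    obtain ⟨H, -, hH2, hH3⟩ := hR.exists_majorant_of_pow hev
      (hdimMeas n (8 * (M + 2) / A₄ + 2))
      fun S _ v hv => hR.bound_of_card_gt hA₄ hw hhalf hK S v hv
    exact (lintegral_mono hH2).trans hH3
  intro K hKdim hA3
  have hK0 : 0 < K := by linarith [hKdim.1]
  -- the Fisher radius at which the affinity exponent outweighs the evidence lower bound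
  set r := (M + 2) * (2 * c) / (α * (1 - α)) with hr
  have hαα : 0 < α * (1 - α) := mul_pos hα0 (by linarith)
  have hr0 : 0 < r := by positivity
  have hrM : M + 2 ≤ α * (1 - α) / (2 * c) * r := by
    rw [hr]
    refine le_of_eq ?_
    have h1α : 1 - α ≠ 0 := by linarith
    field_simp
  have hKr : 0 < (K + 1) * r := by positivity
  refine ⟨(K + 1) * r + 1, by linarith, ?_⟩
  have hdes := hA3.design.def (show 0 < 1 / (4 * ((K + 1) * r)) by positivity)
  filter_upwards [hreg, hA3.phi2_pos, hdes, hKdim.2] with n hn hphi hdesn hdimn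
  obtain ⟨hR, hw, hev, hhalf⟩ := hn
  have hlog : 0 ≤ Real.log (p n) := by linarith [hR.log_pos]
  have hdesign : 4 * (maxNorm (P n).X ^ 2 * ((K + 1) * (P n).s0) *
      (r * ((P n).s0 * Real.log (p n)))) ≤
      n * phi2sq (P n).X ((P n).W0 G) ((K + 1) * (P n).s0) := by
    rw [Real.norm_of_nonneg (by positivity), Real.norm_of_nonneg (by positivity),
      div_le_iff₀ hphi, one_div, mul_assoc (4 * ((K + 1) * r))⁻¹, ← div_eq_inv_mul,
      le_div_iff₀ (by positivity)] at hdesn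
    linarith
  set B : Set (Fin (p n) → ℝ) := {θ | ((supp θ).card : ℝ) ≤ K * (P n).s0 ∧
    r * ((P n).s0 * Real.log (p n)) < quad (G.fisher (P n).X (P n).θ0) (θ - (P n).θ0)} with hB
  have hBm : MeasurableSet B :=
    (measurableSet_le measurable_card_supp measurable_const).inter
      (measurableSet_lt measurable_const
        ((continuous_quad _).comp (continuous_id.sub continuous_const)).measurable)
  obtain ⟨H, hH1, hH2, hH3⟩ := hR.exists_majorant_of_pow hev hBm
    fun S _ v hv => hR.bound_of_quad_gt hA₄ hw hhalf hr0.le hrM hphi hdesign S v hv.1 hv.2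
  have hmain : ∀ A : Set (Fin (p n) → ℝ),
      A ⊆ {θ | K * (P n).s0 < ((supp θ).card : ℝ)} ∪ B →
      (P n).expPosterior G α A ≤ ENNReal.ofReal (failureBound (P n).s0 (p n)) := by
    intro A hA
    set f := ((P n).s0 * Real.log (p n))⁻¹ + 2 * (p n : ℝ)⁻¹ + (p n : ℝ) ^ (-((P n).s0 : ℝ)) with hf
    have hf0 : 0 ≤ f := by positivity
    have e : failureBound (P n).s0 (p n) = f + f := by
      rw [hf, failureBound]; ring
    calc (P n).expPosterior G α A
        ≤ ∫⁻ y, ((P n).posterior G α y {θ | K * (P n).s0 < ((supp θ).card : ℝ)} + H y)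
            ∂((P n).truth G) :=
          lintegral_mono fun y => ((P n).posterior_le_add G hA).trans (by gcongr; exact hH2 y)
      _ = (P n).expPosterior G α {θ | K * (P n).s0 < ((supp θ).card : ℝ)} +
            ∫⁻ y, H y ∂((P n).truth G) := lintegral_add_right _ hH1
      _ ≤ ENNReal.ofReal f + ENNReal.ofReal f := add_le_add hdimn hH3
      _ = _ := by rw [e, ENNReal.ofReal_add hf0 hf0]
  have hnorm := fun θ hθ hcl => (P n).norm_bounds G (θ := θ) hR.θ0_ne_zero hK0.le hr0.le
    (show 1 ≤ (K + 1) * r + 1 by linarith) (by linarith) hlog hphi hθ hcl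
  refine ⟨hmain _ fun θ hθ => ?_, hmain _ fun θ hθ => ?_, hmain _ fun θ hθ => ?_⟩
  · by_contra hcon
    simp only [hB, Set.mem_union, Set.mem_ofPred_eq, not_or, not_and, not_lt] at hcon
    exact absurd hθ (not_lt.mpr (hnorm θ hcon.1 (hcon.2 hcon.1)).1)
  · by_contra hcon
    simp only [hB, Set.mem_union, Set.mem_ofPred_eq, not_or, not_and, not_lt] at hcon
    exact absurd hθ (not_lt.mpr (hnorm θ hcon.1 (hcon.2 hcon.1)).2)
  · by_contra hcon
    simp only [hB, Set.mem_union, Set.mem_ofPred_eq, not_or, not_and, not_lt] at hcon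
    refine absurd hθ (not_lt.mpr ((hcon.2 hcon.1).trans ?_))
    gcongr
    nlinarith
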